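/- Let $d\ge 1$, $[d]=\{1,\dots,d\}$, and let $\mathcal S_d=\{x\in[0,1]^d:\sum_i x_i\le 1\}$. Let $f$ be a probability density on $\mathbb R^d$ vanishing outside $\mathcal S_d$, and assume that there are an open set $\mathcal U\supseteq\mathcal S_d$ and $f_{\mathrm{ext}}\in C^2(\mathcal U)$ with $f_{\mathrm{ext}}=f$ on $\mathcal S_d$; partial derivatives of $f$ on $\mathcal S_d$ are those of $f_{\mathrm{ext}}$. Let $X_1,X_2,\dots$ be independent with density $f$. For integers $n,m\ge 1$ and $x\in\mathcal S_d$ put $$\tilde f_{n,m}(x)=\sum_{k\in\mathbb N_0^d,\ \sum_i k_i\le m-1} m^d\Big\{\frac1n\sum_{i=1}^n \mathbf 1\big[X_i\in\textstyle\prod_{j}(\tfrac{k_j}{m},\tfrac{k_j+1}{m}]\big]\Big\}P_{k,m-1}(x),$$ where $P_{k,N}(x)=\frac{N!}{(N-\sum_i k_i)!\prod_i k_i!}(1-\sum_i x_i)^{N-\sum_i k_i}\prod_i x_i^{k_i}$, and let $\mathrm{MSE}(\tilde f_{n,m}(x))=\mathbb E[(\tilde f_{n,m}(x)-f(x))^2]$.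 Fix $J\subseteq[d]$ and assume that on the face $\{x\in\mathcal S_d:x_J=0\}$ one has $\partial f/\partial x_i=0$ for all $i\in[d]$ (shoulder condition) and $\partial^2 f/\partial x_i\partial x_j=0$ for all $i,j\in[d]\setminus J$. Let $\lambda_i\ge0$ for $i\in J$ and $x_i\in(0,1)$ for $i\notin J$ be fixed, with $\sum_{i\notin J}x_i<1$, let $m=m(n)\to\infty$ be integers, and set $x_i=\lambda_i/m$ for $i\in J$. Write $x^0$ for the point $x$ with its coordinates in $J$ replaced by $0$, $I_0(z)=\sum_{k\ge0}(z/2)^{2k}/(k!)^2$, $$A=f(x^0)\Big[(4\pi)^{d-|J|}\Big(1-\sum_{i\notin J}x_i\Big)\prod_{i\notin J}x_i\Big]^{-1/2}\prod_{i\in J}e^{-2\lambda_i}I_0(2\lambda_i),$$ $$B=\sum_{(i,j)\in[d]^2\setminus([d]\setminus J)^2}\Big((\tfrac16+\lambda_i)\mathbf 1_{i=j}+(\tfrac18+\tfrac{\lambda_j}{2})\mathbf 1_{i\ne j}\Big)\frac{\partial^2 f}{\partial x_i\partial x_j}(x^0),$$ where the values of $\lambda_j$ for $j\notin J$ are arbitrary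 (the terms containing them vanish). Then, as $n\to\infty$, $$\mathrm{MSE}(\tilde f_{n,m}(x))=n^{-1}m^{(d+|J|)/2}A+m^{-4}B^2+n^{-1}m^{(d+|J|)/2}\big[O_{\lambda_J}(m^{-1})+\mathbf 1_{\{J\ne[d]\}}\,o_{x_{[d]\setminus J}}(1)\big]+o_{\lambda_J,x_{[d]\setminus J}}\big(m^{-4}+\mathbf 1_{\{J\neq[d]\}}m^{-3}\big).$$ Here subscripts indicate what the constants and rates may depend on, besides $f$, $d$ and $J$; the bounds hold for all $n$ large enough, where how large may depend on everything. If $J=[d]$, $f(0)\ne0$ and $B\ne0$, the asymptotically optimal choice of $m$ is $$m_{\mathrm{opt}}=n^{\frac1{d+4}}\,\frac{|B|^{\frac2{d+4}}}{\{\frac d4 A\}^{\frac1{d+4}}},\qquad A=f(0)\prod_{i\in[d]}e^{-2\lambda_i}I_0(2\lambda_i),$$ in the following sense: an integer sequence $m(n)$ satisfies $m(n)/m_{\mathrm{opt}}\to1$ if and only if $m(n)\to\infty$ and, for every integer sequence $m'(n)\to\infty$ and every $\eta>0$, the MSE with $m(n)$ is at most $(1+\eta)$ times the MSE with $m'(n)$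 for all large $n$ (each MSE being taken at the point $\lambda/m(n)$, respectively $\lambda/m'(n)$). For every integer sequence $m(n)$ with $m(n)/m_{\mathrm{opt}}\to1$, as $n\to\infty$, $$\mathrm{MSE}(\tilde f_{n,m}(\lambda/m))=n^{-\frac4{d+4}}\,\frac{|B|^{\frac{2d}{d+4}}}{\Big[\frac{(4/d)^{4/(d+4)}}{4/d+1}\Big]A^{-\frac4{d+4}}}+o_\lambda\big(n^{-\frac4{d+4}}\big).$$ -/

import Mathlib

open MeasureTheory ProbabilityTheory Filter Asymptotics
open scoped Topology Nat

noncomputable section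

namespace BernsteinSimplex

variable {d : ℕ}

/-- The closed unit simplex of `ℝ^d`. -/
def simplex (d : ℕ) : Set (Fin d → ℝ) :=
  {x | (∀ i, 0 ≤ x i) ∧ ∑ i, x i ≤ 1}

/-- The lattice points of the dilated simplex: `k ∈ ℕ₀^d` with `k₁ + ⋯ + k_d ≤ N`. -/
def latticeSimplex (d N : ℕ) : Finset (Fin d → ℕ) :=
  (Fintype.piFinset fun _ => Finset.range (N + 1)).filter fun k => ∑ i, k i ≤ N

/-- The multinomial probability `P_{k,N}(x)`, for `k₁ + ⋯ + k_d ≤ N` and `x` in the simplex. -/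
def multinomialProb (N : ℕ) (k : Fin d → ℕ) (x : Fin d → ℝ) : ℝ :=
  (N ! : ℝ) / (((N - ∑ i, k i)! : ℝ) * ∏ i, ((k i)! : ℝ))
    * (1 - ∑ i, x i) ^ (N - ∑ i, k i) * ∏ i, x i ^ k i

/-- The half-open cube `(k/m, (k+1)/m]`. -/
def cell (m : ℕ) (k : Fin d → ℕ) : Set (Fin d → ℝ) :=
  {y | ∀ i, (k i : ℝ) / m < y i ∧ y i ≤ ((k i : ℝ) + 1) / m}

/-- The Bernstein density estimator of order `m` at `x`, built from the first `n` terms of a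
sequence of observations. -/
def densityEstimator (n m : ℕ) (obs : ℕ → Fin d → ℝ) (x : Fin d → ℝ) : ℝ :=
  ∑ k ∈ latticeSimplex d (m - 1),
    (m : ℝ) ^ d
      * ((n : ℝ)⁻¹ * ∑ i ∈ Finset.range n, (cell m k).indicator (fun _ => (1 : ℝ)) (obs i))
      * multinomialProb (m - 1) k x

/-- The mean squared error `E[(estimator(x) - f(x))²]`. -/
def mse {Ω : Type*} [MeasurableSpace Ω] (P : Measure Ω) (X : ℕ → Ω → Fin d → ℝ)
    (f : (Fin d → ℝ) → ℝ) (n m : ℕ) (x : Fin d → ℝ) : ℝ :=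
  ∫ ω, (densityEstimator n m (fun i => X i ω) x - f x) ^ 2 ∂P

/-- First partial derivative `∂g/∂x_i`. -/
def partialDeriv (g : (Fin d → ℝ) → ℝ) (i : Fin d) (x : Fin d → ℝ) : ℝ :=
  fderiv ℝ g x (Pi.single i 1)

/-- Second partial derivative `∂²g/∂x_i∂x_j`. -/
def secondPartialDeriv (g : (Fin d → ℝ) → ℝ) (i j : Fin d) (x : Fin d → ℝ) : ℝ :=
  partialDeriv (partialDeriv g j) i x

/-- Modified Bessel function of the first kind, of integer order `ν`. -/
def besselI (ν : ℕ) (z : ℝ) : ℝ :=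
  ∑' k : ℕ, (z / 2) ^ (2 * k + ν) / ((k ! : ℝ) * ((k + ν)! : ℝ))

/-- `ψ_A(x) = [(4π)^{|A|} (1 - ∑_{i∈A} x_i) ∏_{i∈A} x_i]^{-1/2}`. -/
def psi (A : Finset (Fin d)) (x : Fin d → ℝ) : ℝ :=
  ((4 * Real.pi) ^ A.card * (1 - ∑ i ∈ A, x i) * ∏ i ∈ A, x i) ^ (-(1 / 2) : ℝ)

/-- The point with coordinates `lam i / m` for `i ∈ J` and `y i` for `i ∉ J`. -/
def nearPoint (J : Finset (Fin d)) (lam y : Fin d → ℝ) (m : ℕ) : Fin d → ℝ :=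
  fun i => if i ∈ J then lam i / m else y i

/-- The point `y` with its coordinates in `J` replaced by `0`. -/
def facePoint (J : Finset (Fin d)) (y : Fin d → ℝ) : Fin d → ℝ :=
  fun i => if i ∈ J then 0 else y i

/-- The constant of the leading variance term,
`f(x)|_{x_J = 0} ψ_{[d]∖J}(x) ∏_{i∈J} e^{-2λ_i} I₀(2λ_i)`. -/
def varianceConst (f : (Fin d → ℝ) → ℝ) (J : Finset (Fin d)) (lam y : Fin d → ℝ) : ℝ :=
  f (facePoint J y) * psi Jᶜ y * ∏ i ∈ J, (Real.exp (-2 * lam i) * besselI 0 (2 * lam i))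

/-- The second bias bracket: the sum, over the pairs `(i, j)` that are not both outside `J`, of
`((1/6 + λ_i) 1_{i=j} + (1/8 + λ_j/2) 1_{i≠j}) ∂²g/∂x_i∂x_j` at the point with `x_J = 0`. -/
def biasBracket (g : (Fin d → ℝ) → ℝ) (J : Finset (Fin d)) (lam y : Fin d → ℝ) : ℝ :=
  ∑ p ∈ (Finset.univ : Finset (Fin d × Fin d)).filter (fun p => ¬ (p.1 ∉ J ∧ p.2 ∉ J)),
    (if p.1 = p.2 then 1 / 6 + lam p.1 else 1 / 8 + lam p.2 / 2)
      * secondPartialDeriv g p.1 p.2 (facePoint J y)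

/-- `n^{1/(d+4)} |B|^{2/(d+4)} / ((d/4) A)^{1/(d+4)}`. -/
def optBandwidth (d : ℕ) (A B : ℝ) (n : ℕ) : ℝ :=
  (n : ℝ) ^ (1 / ((d : ℝ) + 4)) * |B| ^ (2 / ((d : ℝ) + 4))
    / ((d : ℝ) / 4 * A) ^ (1 / ((d : ℝ) + 4))

/-- `|B|^{2d/(d+4)} / ([(4/d)^{4/(d+4)} / (4/d + 1)] A^{-4/(d+4)})`. -/
def optMseConst (d : ℕ) (A B : ℝ) : ℝ :=
  |B| ^ (2 * (d : ℝ) / ((d : ℝ) + 4))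
    / (((4 / (d : ℝ)) ^ (4 / ((d : ℝ) + 4)) / (4 / (d : ℝ) + 1)) * A ^ (-4 / ((d : ℝ) + 4)))

/-- A bandwidth sequence `m(n) → ∞` is asymptotically optimal for the risk `R n m` if no other
bandwidth sequence tending to infinity has an asymptotically smaller risk. -/
def IsAsymptoticallyOptimal (R : ℕ → ℕ → ℝ) (m : ℕ → ℕ) : Prop :=
  Tendsto m atTop atTop ∧
    ∀ m' : ℕ → ℕ, Tendsto m' atTop atTop →
      ∀ η : ℝ, 0 < η → ∀ᶠ n in atTop, R n (m n) ≤ (1 + η) * R n (m' n)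

end BernsteinSimplex

end

open BernsteinSimplex

namespace BernsteinSimplex

/-! The estimator is the sample mean of `W (X i)`, where `W` is the step function equal to `m^d
P_{k,m-1}(x)` on the cell of index `k`. Since the cells are disjoint, the MSE is exactly `n⁻¹ *
estVar + (estMean - f)^2` (`mse_eq`), and both `estVar` and `estMean` are sums against the
multinomial law, independent of `n`.

Variance. Up to the oscillation of `f` near the face point and a negligible squared mean, `estVar`
is `f(x⁰) m^d ∑ P_k²`. By Parseval, `∑ P_k²` is the mean over a period box of `|φ|^{2(m-1)}`, with
`φ` the characteristic function of one trial (`sum_multinomialProb_sq`). Scale the frequencies off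
`J` by `m^{-1/2}` and keep those in `J`: then `m (1 - |φ|²)` converges, and dominated convergence
yields an integral with a Bessel factor for each index in `J` and a correlated Gaussian off `J`
(`tendsto_scaled_sum_multinomialProb_sq`). Chernoff bounds discard the indices far from the face
point. At the vertex the same representation has an explicit `O(1/m)` error
(`exists_abs_sum_multinomialProb_sq_sub_le`).

Bias. By the shoulder condition `f` is constant on the face and has zero gradient there, and at a
relative interior point of the face every second derivative with an index off `J` vanishes.
Expansion from the projection of `z` onto the face (`taylor_face`) therefore leaves a quadratic form
in the coordinates in `J`, which are of order `1/m`, with an error `o(∑_{j∈J} z_j²)`. Exact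
multinomial and cell moments then give `m² * bias → B` (`tendsto_bias`).

Optimal bandwidth. At the vertex the risk is `n⁻¹ m^d α_m + m^{-4} β_m` with `α_m → A` and `β_m →
B²`. In terms of the ratio `t` of `m` to the claimed optimum it is asymptotically `n^{-4/(d+4)} (c₁
t^d + c₂ t^{-4})` with `c₁ d = 4 c₂`. A quantitative gap above the minimum at `t = 1`
(`riskProfile_one_add_le`) gives both directions of the characterization. -/

/-! ### Multinomial probabilities, generating function and moments. -/

theorem mem_latticeSimplex {d N : ℕ} {k : Fin d → ℕ} :
    k ∈ latticeSimplex d N ↔ ∑ i, k i ≤ N := by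
  simp only [latticeSimplex, Finset.mem_filter, Fintype.mem_piFinset, Finset.mem_range,
    and_iff_right_iff_imp]
  intro h i
  have := Finset.single_le_sum (f := k) (fun _ _ => Nat.zero_le _) (Finset.mem_univ i)
  omega

theorem multinomialProb_nonneg {d : ℕ} (N : ℕ) (k : Fin d → ℕ) {x : Fin d → ℝ}
    (hx : ∀ i, 0 ≤ x i) (hx1 : ∑ i, x i ≤ 1) : 0 ≤ multinomialProb N k x := by
  unfold multinomialProb
  have h1 : 0 ≤ 1 - ∑ i, x i := by linarith
  have h2 : 0 ≤ ∏ i, x i ^ k i := Finset.prod_nonneg fun i _ => pow_nonneg (hx i) _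
  positivity

theorem sum_add_single {d : ℕ} (k : Fin d → ℕ) (i : Fin d) :
    ∑ j, (k + (Pi.single i 1 : Fin d → ℕ)) j = ∑ j, k j + 1 := by
  simp [Finset.sum_add_distrib]

theorem prod_factorial_add_single {d : ℕ} (k : Fin d → ℕ) (i : Fin d) :
    ∏ j, (((k + (Pi.single i 1 : Fin d → ℕ)) j)! : ℝ) = (k i + 1) * ∏ j, ((k j)! : ℝ) := by
  rw [← Finset.mul_prod_erase _ _ (Finset.mem_univ i),
    ← Finset.mul_prod_erase _ (fun j => ((k j)! : ℝ)) (Finset.mem_univ i), ← mul_assoc]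
  congr 1
  · simp [Nat.factorial_succ]
  · refine Finset.prod_congr rfl fun j hj => ?_
    rw [Finset.mem_erase] at hj
    simp [hj.1]

theorem prod_pow_add_single {d : ℕ} {A : Type*} [CommMonoid A] (x : Fin d → A) (k : Fin d → ℕ)
    (i : Fin d) : ∏ j, x j ^ ((k + (Pi.single i 1 : Fin d → ℕ)) j) = x i * ∏ j, x j ^ k j := by
  rw [← Finset.mul_prod_erase _ _ (Finset.mem_univ i),
    ← Finset.mul_prod_erase _ (fun j => x j ^ k j) (Finset.mem_univ i), ← mul_assoc]
  congr 1
  · simp [pow_succ']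
  · refine Finset.prod_congr rfl fun j hj => ?_
    rw [Finset.mem_erase] at hj
    simp [hj.1]

/-- Pascal's rule for multinomial probabilities. -/
theorem multinomialProb_succ {d N : ℕ} {k : Fin d → ℕ} (hk : ∑ i, k i ≤ N + 1) (x : Fin d → ℝ) :
    multinomialProb (N + 1) k x =
      (if ∑ i, k i ≤ N then (1 - ∑ i, x i) * multinomialProb N k x else 0)
      + ∑ i, (if 1 ≤ k i then x i * multinomialProb N (k - (Pi.single i 1 : Fin d → ℕ)) x else 0) := by
  -- All terms are multiples of this common quantity, by `N + 1`, by `N + 1 - ∑ k` and by the `k i`,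
  -- so the rule reduces to `N + 1 = (N + 1 - ∑ k) + ∑ k`. The terms set to zero in the statement
  -- are those whose multiplier vanishes.
  set c : ℝ := (N ! : ℝ) / (((N + 1 - ∑ i, k i)! : ℝ) * ∏ i, ((k i)! : ℝ))
    * (1 - ∑ i, x i) ^ (N + 1 - ∑ i, k i) * ∏ i, x i ^ k i with hc
  have h0 : multinomialProb (N + 1) k x = ((N + 1 : ℕ) : ℝ) * c := by
    rw [multinomialProb, hc, Nat.factorial_succ]
    push_cast
    ring
  have h1 : (if ∑ i, k i ≤ N then (1 - ∑ i, x i) * multinomialProb N k x else 0)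
      = ((N + 1 - ∑ i, k i : ℕ) : ℝ) * c := by
    split_ifs with h
    · have e : N + 1 - ∑ i, k i = (N - ∑ i, k i) + 1 := by omega
      rw [multinomialProb, hc, e, Nat.factorial_succ, pow_succ]
      have : (((N - ∑ i, k i) + 1 : ℕ) : ℝ) ≠ 0 := by positivity
      have h3 : (((N - ∑ i, k i)! : ℕ) : ℝ) ≠ 0 := by positivity
      have h4 : ∏ i, ((k i)! : ℝ) ≠ 0 := by positivity
      rw [Nat.cast_mul]
      field_simp
    · have e : N + 1 - ∑ i, k i = 0 := by omega
      simp [e]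
  have h2 : ∀ i, (if 1 ≤ k i then x i * multinomialProb N (k - (Pi.single i 1 : Fin d → ℕ)) x else 0)
      = (k i : ℝ) * c := by
    intro i
    split_ifs with h
    · obtain ⟨k', rfl⟩ : ∃ k', k = k' + (Pi.single i 1 : Fin d → ℕ) := by
        refine ⟨k - (Pi.single i 1 : Fin d → ℕ), ?_⟩
        ext j
        by_cases hj : j = i
        · subst hj; simp; omega
        · simp [hj]
      rw [add_tsub_cancel_right, hc, prod_factorial_add_single, prod_pow_add_single,
        sum_add_single, Nat.add_sub_add_right, multinomialProb]
      have : (k' i : ℝ) + 1 ≠ 0 := by positivity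
      have h3 : (((N - ∑ i, k' i)! : ℕ) : ℝ) ≠ 0 := by positivity
      have h4 : ∏ i, ((k' i)! : ℝ) ≠ 0 := by positivity
      simp only [Pi.add_apply, Pi.single_eq_same, Nat.cast_add, Nat.cast_one]
      field_simp
    · have : k i = 0 := by omega
      simp [this]
  rw [h0, h1, Finset.sum_congr rfl fun i _ => h2 i, ← Finset.sum_mul, ← add_mul]
  congr 1
  rw [← Nat.cast_sum, ← Nat.cast_add]
  congr 1
  omega

/-- The expectation of `g` under the multinomial distribution with `N` trials. -/
noncomputable def multinomialExp {d : ℕ} {E : Type*} [AddCommGroup E] [Module ℝ E] (N : ℕ)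
    (x : Fin d → ℝ) (g : (Fin d → ℕ) → E) : E :=
  ∑ k ∈ latticeSimplex d N, multinomialProb N k x • g k

section Exp

variable {d : ℕ} {E : Type*} [AddCommGroup E] [Module ℝ E]

theorem multinomialExp_zero (x : Fin d → ℝ) (g : (Fin d → ℕ) → E) :
    multinomialExp 0 x g = g 0 := by
  have : latticeSimplex d 0 = {0} := by
    ext k
    rw [mem_latticeSimplex, Finset.mem_singleton, Nat.le_zero, Finset.sum_eq_zero_iff, funext_iff]
    simp
  simp [multinomialExp, this, multinomialProb]

/-- Conditioning on the last trial. The generating function and all moments below follow from this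
recursion by induction on `N`; values in a module are allowed because the generating function is
later taken over `ℂ`. -/
theorem multinomialExp_succ (N : ℕ) (x : Fin d → ℝ) (g : (Fin d → ℕ) → E) :
    multinomialExp (N + 1) x g = (1 - ∑ i, x i) • multinomialExp N x g
      + ∑ i, x i • multinomialExp N x (fun k => g (k + (Pi.single i 1 : Fin d → ℕ))) := by
  have h1 : ∑ k ∈ latticeSimplex d (N + 1),
      (if ∑ i, k i ≤ N then (1 - ∑ i, x i) * multinomialProb N k x else 0) • g k
      = (1 - ∑ i, x i) • multinomialExp N x g := by
    simp only [ite_smul, zero_smul, multinomialExp]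
    rw [← Finset.sum_filter, Finset.smul_sum]
    refine Finset.sum_congr ?_ fun k _ => by rw [mul_smul]
    ext k
    simp only [Finset.mem_filter, mem_latticeSimplex]
    omega
  have h2 : ∀ i, ∑ k ∈ latticeSimplex d (N + 1),
      (if 1 ≤ k i then x i * multinomialProb N (k - (Pi.single i 1 : Fin d → ℕ)) x else 0) • g k
      = x i • multinomialExp N x (fun k => g (k + (Pi.single i 1 : Fin d → ℕ))) := by
    intro i
    simp only [ite_smul, zero_smul, multinomialExp]
    rw [← Finset.sum_filter, Finset.smul_sum]
    have hinv : ∀ k : Fin d → ℕ, 1 ≤ k i → k - (Pi.single i 1 : Fin d → ℕ) + (Pi.single i 1 : Fin d → ℕ) = k := by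
      intro k hk
      ext j
      by_cases hj : j = i
      · subst hj; simp; omega
      · simp [hj]
    refine Finset.sum_nbij' (fun k => k - (Pi.single i 1 : Fin d → ℕ)) (fun k => k + (Pi.single i 1 : Fin d → ℕ)) ?_ ?_ ?_ ?_ ?_
    · intro k hk
      simp only [Finset.mem_filter, mem_latticeSimplex] at hk ⊢
      have := sum_add_single (k - (Pi.single i 1 : Fin d → ℕ)) i
      rw [hinv k hk.2] at this
      omega
    · intro k hk
      simp only [Finset.mem_filter, mem_latticeSimplex] at hk ⊢
      rw [sum_add_single]
      exact ⟨by omega, by simp⟩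
    · intro k hk
      exact hinv k (Finset.mem_filter.1 hk).2
    · intro k _
      simp
    · intro k hk
      simp only [hinv k (Finset.mem_filter.1 hk).2, mul_smul]
  rw [multinomialExp, ← h1, ← Finset.sum_congr rfl fun i _ => h2 i, Finset.sum_comm,
    ← Finset.sum_add_distrib]
  refine Finset.sum_congr rfl fun k hk => ?_
  rw [multinomialProb_succ (mem_latticeSimplex.1 hk), add_smul, Finset.sum_smul]

theorem multinomialExp_add (N : ℕ) (x : Fin d → ℝ) (g h : (Fin d → ℕ) → E) :
    multinomialExp N x (fun k => g k + h k) = multinomialExp N x g + multinomialExp N x h := by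
  simp [multinomialExp, Finset.sum_add_distrib]

theorem multinomialExp_sub (N : ℕ) (x : Fin d → ℝ) (g h : (Fin d → ℕ) → E) :
    multinomialExp N x (fun k => g k - h k) = multinomialExp N x g - multinomialExp N x h := by
  simp [multinomialExp, smul_sub]

theorem multinomialExp_sum {ι : Type*} (s : Finset ι) (N : ℕ) (x : Fin d → ℝ)
    (g : ι → (Fin d → ℕ) → E) :
    multinomialExp N x (fun k => ∑ i ∈ s, g i k) = ∑ i ∈ s, multinomialExp N x (g i) := by
  simp only [multinomialExp, Finset.smul_sum]
  exact Finset.sum_comm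

theorem multinomialExp_const_mul (N : ℕ) (x : Fin d → ℝ) (c : ℝ) (g : (Fin d → ℕ) → ℝ) :
    multinomialExp N x (fun k => c * g k) = c * multinomialExp N x g := by
  simp only [multinomialExp, Finset.mul_sum, smul_eq_mul]
  exact Finset.sum_congr rfl fun k _ => by ring

theorem multinomialExp_const (N : ℕ) (x : Fin d → ℝ) (c : E) :
    multinomialExp N x (fun _ => c) = c := by
  induction N with
  | zero => rw [multinomialExp_zero]
  | succ N ih => rw [multinomialExp_succ, ih, ← Finset.sum_smul, ← add_smul]; simp

/-- The generating function of the multinomial distribution. -/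
theorem multinomialExp_prod_pow {A : Type*} [CommRing A] [Algebra ℝ A] (N : ℕ) (x : Fin d → ℝ)
    (z : Fin d → A) :
    multinomialExp N x (fun k => ∏ j, z j ^ k j)
      = (algebraMap ℝ A (1 - ∑ i, x i) + ∑ i, x i • z i) ^ N := by
  induction N with
  | zero => simp [multinomialExp_zero]
  | succ N ih =>
    have h : ∀ i, multinomialExp N x (fun k => ∏ j, z j ^ (k + (Pi.single i 1 : Fin d → ℕ)) j)
        = z i * multinomialExp N x (fun k => ∏ j, z j ^ k j) := by
      intro i
      simp only [prod_pow_add_single, multinomialExp, Finset.mul_sum, mul_smul_comm]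
    rw [multinomialExp_succ]
    simp only [h]
    rw [ih, pow_succ', add_mul, Finset.sum_mul, Algebra.smul_def]
    simp only [smul_mul_assoc]

theorem multinomialExp_apply (N : ℕ) (x : Fin d → ℝ) (i : Fin d) :
    multinomialExp N x (fun k => (k i : ℝ)) = N * x i := by
  induction N with
  | zero => simp [multinomialExp_zero]
  | succ N ih =>
    have h : ∀ j, multinomialExp N x (fun k => (((k + (Pi.single j 1 : Fin d → ℕ)) i : ℕ) : ℝ))
        = N * x i + if i = j then 1 else 0 := by
      intro j
      rw [← ih, ← multinomialExp_const N x (if i = j then (1 : ℝ) else 0), ← multinomialExp_add]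
      congr 1
      ext k
      by_cases hij : i = j
      · subst hij; simp
      · simp [hij]
    rw [multinomialExp_succ, ih]
    simp only [h, smul_eq_mul, mul_add, Finset.sum_add_distrib, ← Finset.sum_mul]
    simp
    ring

theorem multinomialExp_apply_mul_apply (N : ℕ) (x : Fin d → ℝ) (i j : Fin d) :
    multinomialExp N x (fun k => (k i : ℝ) * k j)
      = N * (N - 1) * (x i * x j) + if i = j then N * x i else 0 := by
  induction N with
  | zero => simp [multinomialExp_zero]
  | succ N ih =>
    set δ : Fin d → Fin d → ℝ := fun i l => if i = l then 1 else 0 with hδ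
    have h : ∀ l, multinomialExp N x
        (fun k => (((k + (Pi.single l 1 : Fin d → ℕ)) i : ℕ) : ℝ) * (((k + (Pi.single l 1 : Fin d → ℕ)) j : ℕ) : ℝ))
        = (N * (N - 1) * (x i * x j) + if i = j then N * x i else 0) + δ j l * (N * x i)
          + δ i l * (N * x j) + δ i l * δ j l := by
      intro l
      rw [← ih, ← multinomialExp_apply, ← multinomialExp_apply,
        ← multinomialExp_const N x (δ i l * δ j l), ← multinomialExp_const_mul,
        ← multinomialExp_const_mul, ← multinomialExp_add, ← multinomialExp_add,
        ← multinomialExp_add]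
      congr 1
      ext k
      have : ∀ i, (((k + (Pi.single l 1 : Fin d → ℕ)) i : ℕ) : ℝ) = k i + δ i l := by
        intro i
        by_cases hij : i = l
        · subst hij; simp [hδ]
        · simp [hδ, hij]
      rw [this, this]
      ring
    rw [multinomialExp_succ, ih]
    simp only [h, smul_eq_mul, mul_add, Finset.sum_add_distrib, ← Finset.sum_mul]
    by_cases hij : i = j
    · subst hij; simp [hδ]; ring
    · simp [hδ, hij]
      ring

theorem multinomialExp_mono {N : ℕ} {x : Fin d → ℝ} (hx : ∀ i, 0 ≤ x i) (hx1 : ∑ i, x i ≤ 1)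
    {g h : (Fin d → ℕ) → ℝ} (hgh : ∀ k ∈ latticeSimplex d N, g k ≤ h k) :
    multinomialExp N x g ≤ multinomialExp N x h :=
  Finset.sum_le_sum fun k hk =>
    mul_le_mul_of_nonneg_left (hgh k hk) (multinomialProb_nonneg N k hx hx1)

theorem abs_multinomialExp_le {N : ℕ} {x : Fin d → ℝ} (hx : ∀ i, 0 ≤ x i) (hx1 : ∑ i, x i ≤ 1)
    (g : (Fin d → ℕ) → ℝ) : |multinomialExp N x g| ≤ multinomialExp N x (fun k => |g k|) := by
  refine (Finset.abs_sum_le_sum_abs _ _).trans_eq (Finset.sum_congr rfl fun k _ => ?_)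
  rw [smul_eq_mul, abs_mul, abs_of_nonneg (multinomialProb_nonneg N k hx hx1), smul_eq_mul]

theorem multinomialProb_le_one {N : ℕ} {x : Fin d → ℝ} (hx : ∀ i, 0 ≤ x i) (hx1 : ∑ i, x i ≤ 1)
    {k : Fin d → ℕ} (hk : k ∈ latticeSimplex d N) : multinomialProb N k x ≤ 1 := by
  have h := multinomialExp_const (E := ℝ) N x 1
  simp only [multinomialExp, smul_eq_mul, mul_one] at h
  rw [← h]
  exact Finset.single_le_sum (f := fun k => multinomialProb N k x)
    (fun k _ => multinomialProb_nonneg N k hx hx1) hk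

end Exp

/-! ### Parseval's identity and the integral form of the Bessel factor. -/

/-- The period box `(-π, π]^d`. -/
def periodBox (d : ℕ) : Set (Fin d → ℝ) := Set.univ.pi fun _ => Set.Ioc (-Real.pi) Real.pi

theorem measurableSet_periodBox (d : ℕ) : MeasurableSet (periodBox d) :=
  MeasurableSet.univ_pi fun _ => measurableSet_Ioc

theorem integrableOn_periodBox {d : ℕ} {E : Type*} [NormedAddCommGroup E]
    {g : (Fin d → ℝ) → E} (hg : Continuous g) : IntegrableOn g (periodBox d) := by
  have hK : IsCompact (Set.univ.pi fun _ : Fin d => Set.Icc (-Real.pi) Real.pi) :=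
    isCompact_univ_pi fun _ => isCompact_Icc
  exact (hg.continuousOn.integrableOn_compact hK).mono_set
    (Set.pi_mono fun _ _ => Set.Ioc_subset_Icc_self)

theorem setIntegral_periodBox_prod {d : ℕ} {𝕜 : Type*} [RCLike 𝕜] (g : Fin d → ℝ → 𝕜) :
    ∫ t in periodBox d, ∏ j, g j (t j) = ∏ j, ∫ t in Set.Ioc (-Real.pi) Real.pi, g j t := by
  rw [periodBox, volume_pi, Measure.restrict_pi_pi, integral_fintype_prod_eq_prod]

/-- Pythagoras in `L²`. It serves twice: for characters of the `d`-dimensional period box, and in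
dimension one for the Bessel function. -/
theorem integral_norm_sq_sum_of_orthogonal {α ι : Type*} [MeasurableSpace α] {μ : Measure α}
    (s : Finset ι) (c : ι → ℝ) (e : ι → α → ℂ) (C : ℝ)
    (hint : ∀ k l, Integrable (fun t => e k t * (starRingEnd ℂ) (e l t)) μ)
    (horth : ∀ k ∈ s, ∀ l ∈ s, k ≠ l → ∫ t, e k t * (starRingEnd ℂ) (e l t) ∂μ = 0)
    (hnorm : ∀ k, ∫ t, e k t * (starRingEnd ℂ) (e k t) ∂μ = C) :
    ∫ t, ‖∑ k ∈ s, (c k : ℂ) * e k t‖ ^ 2 ∂μ = C * ∑ k ∈ s, c k ^ 2 := by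
  have h1 : ∀ t, ((‖∑ k ∈ s, (c k : ℂ) * e k t‖ ^ 2 : ℝ) : ℂ)
      = ∑ k ∈ s, ∑ l ∈ s, (c k * c l : ℂ) * (e k t * (starRingEnd ℂ) (e l t)) := by
    intro t
    rw [Complex.ofReal_pow, ← Complex.mul_conj', map_sum, Finset.sum_mul_sum]
    refine Finset.sum_congr rfl fun k _ => Finset.sum_congr rfl fun l _ => ?_
    rw [map_mul, Complex.conj_ofReal]
    ring
  have h2 : ((∫ t, ‖∑ k ∈ s, (c k : ℂ) * e k t‖ ^ 2 ∂μ : ℝ) : ℂ)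
      = ((C * ∑ k ∈ s, c k ^ 2 : ℝ) : ℂ) := by
    rw [← integral_complex_ofReal]
    simp_rw [h1]
    rw [integral_finsetSum _ fun k _ => integrable_finsetSum _ fun l _ => (hint k l).const_mul _]
    push_cast
    rw [Finset.mul_sum]
    refine Finset.sum_congr rfl fun k hk => ?_
    rw [integral_finsetSum _ fun l _ => (hint k l).const_mul _, Finset.sum_eq_single k]
    · rw [integral_const_mul, hnorm]; ring
    · intro l hl hlk
      rw [integral_const_mul, horth k hk l hl (Ne.symm hlk), mul_zero]
    · exact fun h => absurd hk h
  exact_mod_cast h2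

theorem integral_Ioc_exp_pow_mul_conj (k l : ℕ) :
    ∫ t in Set.Ioc (-Real.pi) Real.pi, Complex.exp (t * Complex.I) ^ k
      * (starRingEnd ℂ) (Complex.exp (t * Complex.I) ^ l)
      = if k = l then (2 * Real.pi : ℂ) else 0 := by
  have h : ∀ t : ℝ, Complex.exp (t * Complex.I) ^ k
      * (starRingEnd ℂ) (Complex.exp (t * Complex.I) ^ l)
      = Complex.exp (((k - l : ℂ) * Complex.I) * t) := by
    intro t
    rw [map_pow, ← Complex.exp_conj, ← Complex.exp_nat_mul, ← Complex.exp_nat_mul,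
      ← Complex.exp_add]
    congr 1
    simp
    ring
  simp_rw [h]
  rw [← intervalIntegral.integral_of_le (by linarith [Real.pi_pos])]
  split_ifs with hkl
  · simp [hkl]; ring
  · have hne : (k - l : ℂ) ≠ 0 := sub_ne_zero.2 (by exact_mod_cast hkl)
    rw [integral_exp_mul_complex (mul_ne_zero hne Complex.I_ne_zero), div_eq_zero_iff]
    left
    rw [sub_eq_zero, Complex.exp_eq_exp_iff_exists_int]
    -- The exponents at `π` and `-π` differ by `2πi (k - l)`, so the antiderivative takes the same
    -- value at both ends.
    refine ⟨(k : ℤ) - l, ?_⟩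
    push_cast
    ring

/-- Parseval's identity for trigonometric polynomials with real coefficients. -/
theorem integral_periodBox_norm_sq {d : ℕ} (s : Finset (Fin d → ℕ)) (c : (Fin d → ℕ) → ℝ) :
    ∫ t in periodBox d, ‖∑ k ∈ s, (c k : ℂ) * ∏ j, Complex.exp (t j * Complex.I) ^ k j‖ ^ 2
      = (2 * Real.pi) ^ d * ∑ k ∈ s, c k ^ 2 := by
  have h : ∀ k l : Fin d → ℕ, ∫ t in periodBox d, (∏ j, Complex.exp (t j * Complex.I) ^ k j)
      * (starRingEnd ℂ) (∏ j, Complex.exp (t j * Complex.I) ^ l j)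
      = ∏ j, if k j = l j then (2 * Real.pi : ℂ) else 0 := by
    intro k l
    simp_rw [map_prod, ← Finset.prod_mul_distrib]
    rw [setIntegral_periodBox_prod (fun j t => Complex.exp (t * Complex.I) ^ k j
      * (starRingEnd ℂ) (Complex.exp (t * Complex.I) ^ l j))]
    exact Finset.prod_congr rfl fun j _ => integral_Ioc_exp_pow_mul_conj _ _
  refine integral_norm_sq_sum_of_orthogonal s c _ _ ?_ ?_ ?_
  · intro k l
    refine integrableOn_periodBox ?_
    fun_prop
  · intro k _ l _ hkl
    rw [h]
    obtain ⟨j, hj⟩ := Function.ne_iff.1 hkl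
    exact Finset.prod_eq_zero (Finset.mem_univ j) (if_neg hj)
  · intro k
    rw [h]
    simp

/-- The coefficients of `I₀(2λ)` are the squares of the Taylor terms of `e^λ`, which is the form
Parseval's identity produces. -/
theorem besselI_zero_two_mul (lam : ℝ) :
    besselI 0 (2 * lam) = ∑' k : ℕ, (lam ^ k / (k ! : ℝ)) ^ 2 := by
  unfold besselI
  refine tsum_congr fun k => ?_
  rw [mul_div_cancel_left₀ _ two_ne_zero, add_zero, add_zero, div_pow, ← pow_mul, mul_comm k 2]
  ring

/-- The partial sums of the series of `I₀(2 λ)` are controlled by the integral representation. -/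
theorem hasSum_bessel_integral {lam : ℝ} (hlam : 0 ≤ lam) :
    HasSum (fun k : ℕ => (lam ^ k / (k ! : ℝ)) ^ 2)
      ((2 * Real.pi)⁻¹ * ∫ t in Set.Ioc (-Real.pi) Real.pi, Real.exp (2 * lam * Real.cos t)) := by
  rw [hasSum_iff_tendsto_nat_of_nonneg (fun k => sq_nonneg _)]
  have hpi : (2 * Real.pi) ≠ 0 := by positivity
  -- Parseval on the unit circle for the partial sums of `exp (λ z)`. These are dominated by `e^λ`
  -- and converge at `z = e^{it}` to a number of squared modulus `e^{2λ cos t}`, which passes the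
  -- identity to the limit.
  have hpars : ∀ n, ∫ t in Set.Ioc (-Real.pi) Real.pi,
      ‖∑ k ∈ Finset.range n, ((lam ^ k / (k ! : ℝ) : ℝ) : ℂ) * Complex.exp (t * Complex.I) ^ k‖ ^ 2
      = (2 * Real.pi) * ∑ k ∈ Finset.range n, (lam ^ k / (k ! : ℝ)) ^ 2 := by
    intro n
    refine integral_norm_sq_sum_of_orthogonal _ (fun k => lam ^ k / (k ! : ℝ))
      (fun k (t : ℝ) => Complex.exp (t * Complex.I) ^ k) _ ?_ ?_ ?_
    · intro k l
      refine (Continuous.integrableOn_Icc ?_).mono_set Set.Ioc_subset_Icc_self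
      fun_prop
    · intro k _ l _ hkl
      rw [integral_Ioc_exp_pow_mul_conj, if_neg hkl]
    · intro k
      rw [integral_Ioc_exp_pow_mul_conj, if_pos rfl]
      push_cast
      rfl
  have hlim : Tendsto (fun n => ∫ t in Set.Ioc (-Real.pi) Real.pi,
      ‖∑ k ∈ Finset.range n, ((lam ^ k / (k ! : ℝ) : ℝ) : ℂ) * Complex.exp (t * Complex.I) ^ k‖ ^ 2)
      atTop (𝓝 (∫ t in Set.Ioc (-Real.pi) Real.pi, Real.exp (2 * lam * Real.cos t))) := by
    refine tendsto_integral_of_dominated_convergence (fun _ => Real.exp lam ^ 2) ?_ ?_ ?_ ?_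
    · intro n
      refine Continuous.aestronglyMeasurable ?_
      fun_prop
    · exact integrable_const _
    · intro n
      refine ae_of_all _ fun t => ?_
      rw [Real.norm_of_nonneg (by positivity)]
      refine pow_le_pow_left₀ (norm_nonneg _) ((norm_sum_le _ _).trans ?_) 2
      refine le_trans (Finset.sum_le_sum fun k _ => ?_) (Real.sum_le_exp_of_nonneg hlam n)
      rw [norm_mul, norm_pow, Complex.norm_exp_ofReal_mul_I, one_pow, mul_one, Complex.norm_real,
        Real.norm_of_nonneg (by positivity)]
    · refine ae_of_all _ fun t => ?_
      have h1 : Tendsto (fun n => ∑ k ∈ Finset.range n, ((lam ^ k / (k ! : ℝ) : ℝ) : ℂ)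
          * Complex.exp (t * Complex.I) ^ k) atTop
          (𝓝 (Complex.exp (lam * Complex.exp (t * Complex.I)))) := by
        have := (NormedSpace.expSeries_div_hasSum_exp
          (lam * Complex.exp (t * Complex.I))).tendsto_sum_nat
        rw [← Complex.exp_eq_exp_ℂ] at this
        refine this.congr fun n => Finset.sum_congr rfl fun k _ => ?_
        push_cast
        rw [mul_pow]
        ring
      have h2 := (h1.norm).pow 2
      have h3 : ‖Complex.exp (lam * Complex.exp (t * Complex.I))‖ ^ 2
          = Real.exp (2 * lam * Real.cos t) := by
        rw [Complex.norm_exp, Complex.re_ofReal_mul, Complex.exp_ofReal_mul_I_re, ← Real.exp_nat_mul]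
        congr 1
        push_cast
        ring
      rwa [h3] at h2
  have := hlim.const_mul (2 * Real.pi)⁻¹
  refine this.congr fun n => ?_
  rw [hpars, inv_mul_cancel_left₀ hpi]

/-- This is where the factors `e^{-2λ} I₀(2λ)` of the constant `A` come from: one such integral for
each frequency that is not rescaled. -/
theorem integral_exp_one_sub_cos {lam : ℝ} (hlam : 0 ≤ lam) :
    ∫ t in Set.Ioc (-Real.pi) Real.pi, Real.exp (-(2 * lam * (1 - Real.cos t)))
      = 2 * Real.pi * (Real.exp (-2 * lam) * besselI 0 (2 * lam)) := by
  rw [besselI_zero_two_mul, (hasSum_bessel_integral hlam).tsum_eq]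
  have hpi : (2 * Real.pi) ≠ 0 := by positivity
  rw [mul_left_comm, mul_inv_cancel_left₀ hpi, ← integral_const_mul]
  congr 1
  ext t
  rw [← Real.exp_add]
  congr 1
  ring

theorem besselI_zero_pos {lam : ℝ} (hlam : 0 ≤ lam) : 0 < besselI 0 (2 * lam) := by
  rw [besselI_zero_two_mul]
  exact (hasSum_bessel_integral hlam).summable.tsum_pos (fun k => sq_nonneg _) 0 (by simp)

/-! ### The modulus of the characteristic function of one trial. -/

/-- One minus the squared modulus of `1 - ∑ x_j + ∑ x_j e^{i t_j}`. -/
noncomputable def modulusDefect {d : ℕ} (x t : Fin d → ℝ) : ℝ :=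
  2 * (1 - ∑ i, x i) * ∑ j, x j * (1 - Real.cos (t j))
    + ∑ j, ∑ l, x j * x l * (1 - Real.cos (t j - t l))

/-- With `s = ∑ x_i`, expand `1 = (1-s)² + 2(1-s)s + s²` and subtract the squares of the real and
imaginary parts, using `cos a cos b + sin a sin b = cos (a - b)`. The point of this form is that the
defect becomes a combination of terms `1 - cos`, nonnegative on the simplex. -/
theorem norm_sq_charFun {d : ℕ} (x t : Fin d → ℝ) :
    ‖((1 - ∑ i, x i : ℝ) : ℂ) + ∑ j, (x j : ℂ) * Complex.exp (t j * Complex.I)‖ ^ 2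
      = 1 - modulusDefect x t := by
  have h : ((1 - ∑ i, x i : ℝ) : ℂ) + ∑ j, (x j : ℂ) * Complex.exp (t j * Complex.I)
      = ((1 - ∑ i, x i + ∑ j, x j * Real.cos (t j) : ℝ) : ℂ)
        + ((∑ j, x j * Real.sin (t j) : ℝ) : ℂ) * Complex.I := by
    push_cast
    rw [add_assoc, Finset.sum_mul, ← Finset.sum_add_distrib]
    congr 1
    refine Finset.sum_congr rfl fun j _ => ?_
    rw [Complex.exp_mul_I]
    ring
  have hs : (∑ j, x j * Real.cos (t j)) ^ 2 + (∑ j, x j * Real.sin (t j)) ^ 2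
      = ∑ j, ∑ l, x j * x l * Real.cos (t j - t l) := by
    simp only [sq, Finset.sum_mul_sum, ← Finset.sum_add_distrib, Real.cos_sub]
    exact Finset.sum_congr rfl fun j _ => Finset.sum_congr rfl fun l _ => by ring
  have hx : (∑ j, x j) ^ 2 = ∑ j, ∑ l, x j * x l := by
    simp only [sq, Finset.sum_mul_sum]
  rw [h, ← Complex.normSq_eq_norm_sq, Complex.normSq_add_mul_I, modulusDefect]
  simp only [mul_sub, mul_one, Finset.sum_sub_distrib]
  rw [← hs, ← hx]
  ring

/-- The collision probability of the multinomial distribution as an integral. -/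
theorem sum_multinomialProb_sq {d : ℕ} (N : ℕ) (x : Fin d → ℝ) :
    ∑ k ∈ latticeSimplex d N, multinomialProb N k x ^ 2
      = ((2 * Real.pi) ^ d)⁻¹ * ∫ t in periodBox d, (1 - modulusDefect x t) ^ N := by
  have h := integral_periodBox_norm_sq (latticeSimplex d N) (fun k => multinomialProb N k x)
  have h2 : ∀ t : Fin d → ℝ, ‖∑ k ∈ latticeSimplex d N, (multinomialProb N k x : ℂ)
      * ∏ j, Complex.exp (t j * Complex.I) ^ k j‖ ^ 2 = (1 - modulusDefect x t) ^ N := by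
    intro t
    have := multinomialExp_prod_pow N x (fun j => Complex.exp (t j * Complex.I))
    simp only [multinomialExp, Complex.real_smul, Complex.coe_algebraMap] at this
    rw [this, norm_pow, ← pow_mul, mul_comm N 2, pow_mul, norm_sq_charFun]
  simp_rw [h2] at h
  rw [h, inv_mul_cancel_left₀ (by positivity)]

/-! ### Elementary inequalities. -/

section Elementary

theorem abs_exp_neg_sub_exp_neg_le {a b : ℝ} (ha : 0 ≤ a) (hb : 0 ≤ b) :
    |Real.exp (-a) - Real.exp (-b)| ≤ |a - b| := by
  wlog h : a ≤ b generalizing a b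
  · rw [abs_sub_comm, abs_sub_comm a]
    exact this hb ha (not_le.1 h).le
  have h1 : Real.exp (-b) ≤ Real.exp (-a) := Real.exp_le_exp.2 (by linarith)
  rw [abs_of_nonneg (by linarith), abs_of_nonpos (by linarith)]
  have h2 : Real.exp (-b) = Real.exp (-a) * Real.exp (-(b - a)) := by
    rw [← Real.exp_add]; congr 1; ring
  have h3 := Real.one_sub_le_exp_neg (b - a)
  have h4 : Real.exp (-a) ≤ 1 := Real.exp_le_one_iff.2 (by linarith)
  have h5 := Real.exp_pos (-a)
  rw [h2]
  nlinarith

/-- For `v ≤ 1/2` one has `e^{-(v+2v²)} ≤ 1 - v ≤ e^{-v}`; take `N`-th powers and use that `e^{-·}`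
is 1-Lipschitz on the half-line. The explicit error serves both the limit theorem and the `O(1/m)`
rate at the vertex. -/
theorem abs_one_sub_pow_sub_exp_le {v L : ℝ} (hv : 0 ≤ v) (hv2 : v ≤ 1 / 2) (hL : 0 ≤ L) (N : ℕ) :
    |(1 - v) ^ N - Real.exp (-L)| ≤ |N * v - L| + 2 * N * v ^ 2 := by
  have h1 : 0 < 1 - v := by linarith
  have hup : (1 - v) ^ N ≤ Real.exp (-(N * v)) := by
    rw [neg_mul_eq_mul_neg, Real.exp_nat_mul]
    exact pow_le_pow_left₀ h1.le (Real.one_sub_le_exp_neg v) N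
  have hlo : Real.exp (-(N * (v + 2 * v ^ 2))) ≤ (1 - v) ^ N := by
    rw [neg_mul_eq_mul_neg, Real.exp_nat_mul]
    refine pow_le_pow_left₀ (Real.exp_pos _).le ?_ N
    rw [← Real.le_log_iff_exp_le h1]
    refine le_trans ?_ (Real.one_sub_inv_le_log_of_pos h1)
    have : (1 - v)⁻¹ ≤ 1 + v + 2 * v ^ 2 := by
      rw [inv_le_iff_one_le_mul₀ h1]
      nlinarith [mul_nonneg (sq_nonneg v) (by linarith : (0:ℝ) ≤ 1 / 2 - v)]
    linarith
  have hN : (0 : ℝ) ≤ N := Nat.cast_nonneg N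
  have hs : 0 ≤ 2 * (N : ℝ) * v ^ 2 := by positivity
  have e1 := abs_exp_neg_sub_exp_neg_le (mul_nonneg hN hv) hL
  have e2 := abs_exp_neg_sub_exp_neg_le (a := N * (v + 2 * v ^ 2)) (by positivity) hL
  have e3 : |N * (v + 2 * v ^ 2) - L| ≤ |N * v - L| + 2 * N * v ^ 2 := by
    have : N * (v + 2 * v ^ 2) - L = (N * v - L) + 2 * N * v ^ 2 := by ring
    rw [this]
    exact (abs_add_le _ _).trans (by rw [abs_of_nonneg hs])
  rw [abs_le] at e1 e2 ⊢
  constructor <;> linarith [e1.1, e1.2, e2.1, e2.2]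

theorem tendsto_mul_one_sub_cos {ι : Type*} {l : Filter ι} {m : ι → ℕ} (hm : Tendsto m l atTop)
    (a : ℝ) : Tendsto (fun i => (m i : ℝ) * (1 - Real.cos ((√(m i : ℝ))⁻¹ * a))) l
      (𝓝 (a ^ 2 / 2)) := by
  have hmR : Tendsto (fun i => (m i : ℝ)) l atTop := tendsto_natCast_atTop_atTop.comp hm
  rw [tendsto_iff_norm_sub_tendsto_zero]
  have hb : Tendsto (fun i => a ^ 4 * (m i : ℝ)⁻¹) l (𝓝 0) := by
    simpa using (tendsto_inv_atTop_zero.comp hmR).const_mul (a ^ 4)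
  refine squeeze_zero' (.of_forall fun _ => norm_nonneg _) ?_ hb
  filter_upwards [hmR.eventually_ge_atTop (a ^ 2), hmR.eventually_gt_atTop 0] with i h1 h2
  set M : ℝ := (m i : ℝ)
  set u := (√M)⁻¹ * a with hu
  have hu2 : u ^ 2 = M⁻¹ * a ^ 2 := by rw [hu, mul_pow, inv_pow, Real.sq_sqrt h2.le]
  have hu1 : |u| ≤ 1 := by
    rw [← sq_le_one_iff_abs_le_one, hu2, inv_mul_le_one₀ h2]
    exact h1
  have hc := Real.cos_bound hu1
  have h3 : M * (1 - Real.cos u) - a ^ 2 / 2 = -(M * (Real.cos u - (1 - u ^ 2 / 2))) := by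
    rw [hu2]
    field_simp
    ring
  rw [h3, norm_neg, Real.norm_eq_abs, abs_mul, abs_of_pos h2]
  have h4 : |u| ^ 4 = M⁻¹ ^ 2 * a ^ 4 := by
    rw [show |u| ^ 4 = (|u| ^ 2) ^ 2 by ring, sq_abs, hu2]; ring
  rw [h4] at hc
  calc M * |Real.cos u - (1 - u ^ 2 / 2)| ≤ M * (M⁻¹ ^ 2 * a ^ 4 * (5 / 96)) := by gcongr
    _ = (5 / 96) * (a ^ 4 * M⁻¹) := by field_simp
    _ ≤ 1 * (a ^ 4 * M⁻¹) := by
      have : 0 ≤ a ^ 4 * M⁻¹ := by positivity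
      gcongr; norm_num
    _ = _ := one_mul _

end Elementary

theorem modulusDefect_nonneg {d : ℕ} {x : Fin d → ℝ} (hx : ∀ i, 0 ≤ x i) (hx1 : ∑ i, x i ≤ 1)
    (t : Fin d → ℝ) : 0 ≤ modulusDefect x t := by
  have hc : ∀ a, 0 ≤ 1 - Real.cos a := fun a => by linarith [Real.cos_le_one a]
  refine add_nonneg (mul_nonneg (by linarith) (Finset.sum_nonneg fun j _ => mul_nonneg (hx j) (hc _)))
    (Finset.sum_nonneg fun j _ => Finset.sum_nonneg fun l _ =>
      mul_nonneg (mul_nonneg (hx j) (hx l)) (hc _))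

theorem modulusDefect_le_one {d : ℕ} (x t : Fin d → ℝ) : modulusDefect x t ≤ 1 := by
  have := norm_sq_charFun x t
  nlinarith [sq_nonneg ‖((1 - ∑ i, x i : ℝ) : ℂ) + ∑ j, (x j : ℂ) * Complex.exp (t j * Complex.I)‖]

/-- On a period `1 - cos t ≥ 2t²/π²`, and the double sum may be discarded. This supplies the
Gaussian majorant for dominated convergence. -/
theorem le_modulusDefect {d : ℕ} {x : Fin d → ℝ} (hx : ∀ i, 0 ≤ x i) (hx1 : ∑ i, x i ≤ 1)
    {t : Fin d → ℝ} (ht : t ∈ periodBox d) (A : Finset (Fin d)) :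
    2 * (1 - ∑ i, x i) * ∑ j ∈ A, x j * (2 / Real.pi ^ 2 * t j ^ 2) ≤ modulusDefect x t := by
  have hc : ∀ a, 0 ≤ 1 - Real.cos a := fun a => by linarith [Real.cos_le_one a]
  have h1 : ∑ j ∈ A, x j * (2 / Real.pi ^ 2 * t j ^ 2) ≤ ∑ j, x j * (1 - Real.cos (t j)) := by
    refine (Finset.sum_le_sum fun j _ => mul_le_mul_of_nonneg_left ?_ (hx j)).trans
      (Finset.sum_le_sum_of_subset_of_nonneg (Finset.subset_univ A)
        fun j _ _ => mul_nonneg (hx j) (hc _))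
    have hj := ht j (Set.mem_univ j)
    have := Real.cos_le_one_sub_mul_cos_sq (x := t j) (abs_le.2 ⟨hj.1.le, hj.2⟩)
    linarith
  have h2 : 0 ≤ ∑ j, ∑ l, x j * x l * (1 - Real.cos (t j - t l)) :=
    Finset.sum_nonneg fun j _ => Finset.sum_nonneg fun l _ =>
      mul_nonneg (mul_nonneg (hx j) (hx l)) (hc _)
  have h3 := mul_le_mul_of_nonneg_left h1 (by linarith : 0 ≤ 2 * (1 - ∑ i, x i))
  unfold modulusDefect
  linarith

/-! ### Pointwise limit of the scaled defect. -/

/-- The scaling of the frequencies: none for `j ∈ J`, by `m^{-1/2}` for `j ∉ J`. -/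
noncomputable def freqScale {d : ℕ} (J : Finset (Fin d)) (m : ℕ) (j : Fin d) : ℝ :=
  if j ∈ J then 1 else (√(m : ℝ))⁻¹

/-- The limit of `m` times the modulus defect at scaled frequencies. -/
noncomputable def limitExponent {d : ℕ} (J : Finset (Fin d)) (lam y s : Fin d → ℝ) : ℝ :=
  2 * ∑ j, (if j ∈ J then lam j * (1 - Real.cos (s j)) else 0)
    + ∑ j, (if j ∈ J then 0 else y j) * s j ^ 2 - (∑ j, (if j ∈ J then 0 else y j) * s j) ^ 2

section Limit

variable {d : ℕ} {J : Finset (Fin d)} {ι : Type*} {l : Filter ι} {m : ι → ℕ}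
  {lam : ι → Fin d → ℝ} {lam₀ y : Fin d → ℝ}

theorem tendsto_nearPoint (hm : Tendsto m l atTop) (hlam : Tendsto lam l (𝓝 lam₀)) :
    Tendsto (fun i => nearPoint J (lam i) y (m i)) l (𝓝 (facePoint J y)) := by
  have hmR : Tendsto (fun i => (m i : ℝ)) l atTop := tendsto_natCast_atTop_atTop.comp hm
  rw [tendsto_pi_nhds] at hlam ⊢
  intro j
  simp only [nearPoint, facePoint]
  split_ifs with h
  · exact (hlam j).div_atTop hmR
  · exact tendsto_const_nhds

/-- In the double sum, pairs inside `J` disappear, since `m x_j x_k → 0`; pairs off `J` become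
quadratic; a mixed pair tends to `λ_j y_k (1 - cos s_j)`. The mixed pairs restore the part of `∑ λ_j
(1 - cos s_j)` lost to the factor `1 - ∑ x_i` of the first sum. The parameter `lam` may vary along
the filter because uniformity in it is needed later. -/
theorem tendsto_mul_modulusDefect (hm : Tendsto m l atTop) (hlam : Tendsto lam l (𝓝 lam₀))
    (s : Fin d → ℝ) :
    Tendsto (fun i => (m i : ℝ) * modulusDefect (nearPoint J (lam i) y (m i))
      (fun j => freqScale J (m i) j * s j)) l (𝓝 (limitExponent J lam₀ y s)) := by
  have hmR : Tendsto (fun i => (m i : ℝ)) l atTop := tendsto_natCast_atTop_atTop.comp hm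
  have hx := tendsto_nearPoint (J := J) (y := y) hm hlam
  have hxj := tendsto_pi_nhds.1 hx
  have hlamj := tendsto_pi_nhds.1 hlam
  set x := fun i => nearPoint J (lam i) y (m i) with hxdef
  set a : Fin d → ℝ := fun j => if j ∈ J then lam₀ j * (1 - Real.cos (s j)) else 0 with ha
  set b : Fin d → ℝ := fun j => if j ∈ J then 0 else y j with hb
  have hbface : facePoint J y = b := rfl
  have hinv : Tendsto (fun i => (√(m i : ℝ))⁻¹) l (𝓝 0) :=
    tendsto_inv_atTop_zero.comp (Real.tendsto_sqrt_atTop.comp hmR)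
  have hmx : ∀ j ∈ J, ∀ᶠ i in l, lam i j = (m i : ℝ) * x i j := by
    intro j hj
    filter_upwards [hmR.eventually_gt_atTop 0] with i hi
    simp only [hxdef, nearPoint, if_pos hj]
    field_simp
  have h1 : ∀ j, Tendsto (fun i => (m i : ℝ) * (x i j * (1 - Real.cos (freqScale J (m i) j * s j))))
      l (𝓝 (a j + b j * s j ^ 2 / 2)) := by
    intro j
    by_cases hj : j ∈ J
    · simp only [ha, hb, if_pos hj, freqScale, one_mul, zero_mul, zero_div, add_zero]
      refine ((hlamj j).mul_const _).congr' ?_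
      filter_upwards [hmx j hj] with i hi
      rw [hi]; ring
    · simp only [ha, hb, if_neg hj, freqScale, zero_add]
      have := (tendsto_mul_one_sub_cos hm (s j)).const_mul (y j)
      rw [← mul_div_assoc] at this
      refine this.congr fun i => ?_
      simp only [hxdef, nearPoint, if_neg hj]
      ring
  have h2 : ∀ j k, Tendsto (fun i => (m i : ℝ) * (x i j * x i k *
      (1 - Real.cos (freqScale J (m i) j * s j - freqScale J (m i) k * s k))))
      l (𝓝 (a j * b k + a k * b j + b j * b k * (s j - s k) ^ 2 / 2)) := by
    intro j k
    by_cases hj : j ∈ J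
    · by_cases hk : k ∈ J
      · have hlim : Tendsto (fun i => lam i j * x i k * (1 - Real.cos (s j - s k))) l
            (𝓝 (lam₀ j * facePoint J y k * (1 - Real.cos (s j - s k)))) :=
          ((hlamj j).mul (hxj k)).mul_const _
        simp only [ha, hb, if_pos hj, if_pos hk, freqScale, one_mul]
        simp only [facePoint, if_pos hk, mul_zero, zero_mul] at hlim
        simp only [mul_zero, zero_mul, zero_div, add_zero]
        refine hlim.congr' ?_
        filter_upwards [hmx j hj] with i hi
        rw [hi]; ring
      · have hlim : Tendsto (fun i => lam i j * x i k
            * (1 - Real.cos (s j - (√(m i : ℝ))⁻¹ * s k))) l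
            (𝓝 (lam₀ j * facePoint J y k * (1 - Real.cos (s j - 0 * s k)))) := by
          refine ((hlamj j).mul (hxj k)).mul (tendsto_const_nhds.sub ?_)
          exact (Real.continuous_cos.tendsto _).comp (tendsto_const_nhds.sub (hinv.mul_const _))
        simp only [ha, hb, if_pos hj, if_neg hk, freqScale, one_mul]
        simp only [facePoint, if_neg hk, zero_mul, sub_zero] at hlim
        have e : lam₀ j * (1 - Real.cos (s j)) * y k + 0 * 0 + 0 * y k * (s j - s k) ^ 2 / 2
          = lam₀ j * y k * (1 - Real.cos (s j)) := by ring
        rw [e]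
        refine hlim.congr' ?_
        filter_upwards [hmx j hj] with i hi
        rw [hi]; ring
    · by_cases hk : k ∈ J
      · have hlim : Tendsto (fun i => lam i k * x i j
            * (1 - Real.cos ((√(m i : ℝ))⁻¹ * s j - s k))) l
            (𝓝 (lam₀ k * facePoint J y j * (1 - Real.cos (0 * s j - s k)))) := by
          refine ((hlamj k).mul (hxj j)).mul (tendsto_const_nhds.sub ?_)
          exact (Real.continuous_cos.tendsto _).comp ((hinv.mul_const _).sub tendsto_const_nhds)
        simp only [ha, hb, if_neg hj, if_pos hk, freqScale, one_mul]
        simp only [facePoint, if_neg hj, zero_mul, zero_sub, Real.cos_neg] at hlim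
        have e : 0 * 0 + lam₀ k * (1 - Real.cos (s k)) * y j + y j * 0 * (s j - s k) ^ 2 / 2
          = lam₀ k * y j * (1 - Real.cos (s k)) := by ring
        rw [e]
        refine hlim.congr' ?_
        filter_upwards [hmx k hk] with i hi
        rw [hi]; ring
      · simp only [ha, hb, if_neg hj, if_neg hk, freqScale]
        have := (tendsto_mul_one_sub_cos hm (s j - s k)).const_mul (y j * y k)
        have e : 0 * y k + 0 * y j + y j * y k * (s j - s k) ^ 2 / 2
          = y j * y k * ((s j - s k) ^ 2 / 2) := by ring
        rw [e]
        refine this.congr fun i => ?_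
        simp only [hxdef, nearPoint, if_neg hj, if_neg hk, mul_sub]
        ring
  have hsum : Tendsto (fun i => 1 - ∑ j, x i j) l (𝓝 (1 - ∑ j, b j)) :=
    tendsto_const_nhds.sub (tendsto_finsetSum _ fun j _ => hxj j)
  have hmain := ((hsum.const_mul 2).mul (tendsto_finsetSum Finset.univ fun j _ => h1 j)).add
    (tendsto_finsetSum Finset.univ fun j _ => tendsto_finsetSum Finset.univ fun k _ => h2 j k)
  have e : 2 * (1 - ∑ j, b j) * ∑ j, (a j + b j * s j ^ 2 / 2)
      + ∑ j, ∑ k, (a j * b k + a k * b j + b j * b k * (s j - s k) ^ 2 / 2)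
      = limitExponent J lam₀ y s := by
    have e1 : ∀ j k, a j * b k + a k * b j + b j * b k * (s j - s k) ^ 2 / 2
        = a j * b k + b j * a k + (b j * s j ^ 2) * (b k / 2) + (b j / 2) * (b k * s k ^ 2)
          - (b j * s j) * (b k * s k) := fun j k => by ring
    simp only [e1, Finset.sum_add_distrib, Finset.sum_sub_distrib, ← Finset.sum_mul_sum,
      ← Finset.sum_div]
    unfold limitExponent
    ring
  rw [e] at hmain
  refine hmain.congr fun i => ?_
  simp only [modulusDefect, mul_add, Finset.mul_sum]
  congr 1
  exact Finset.sum_congr rfl fun j _ => by ring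

/-- Cauchy–Schwarz with weights `y_j`, of total mass at most one, bounds the squared linear form by
the quadratic sum. -/
theorem limitExponent_nonneg (hlam : ∀ j ∈ J, 0 ≤ lam₀ j) (hy : ∀ j ∉ J, 0 < y j)
    (hy1 : ∑ j ∈ Jᶜ, y j ≤ 1) (s : Fin d → ℝ) : 0 ≤ limitExponent J lam₀ y s := by
  set b : Fin d → ℝ := fun j => if j ∈ J then 0 else y j with hb
  have hb0 : ∀ j, 0 ≤ b j := fun j => by
    simp only [hb]; split_ifs with h; exacts [le_rfl, (hy j h).le]
  have hb1 : ∑ j, b j ≤ 1 := by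
    have : ∑ j, b j = ∑ j ∈ Jᶜ, y j := by
      rw [Finset.sum_ite, Finset.sum_const_zero, zero_add]
      congr 1
      ext j; simp
    rw [this]; exact hy1
  have h1 : 0 ≤ ∑ j, (if j ∈ J then lam₀ j * (1 - Real.cos (s j)) else 0) :=
    Finset.sum_nonneg fun j _ => by
      split_ifs with h
      exacts [mul_nonneg (hlam j h) (by linarith [Real.cos_le_one (s j)]), le_rfl]
  have h2 : (∑ j, b j * s j) ^ 2 ≤ (∑ j, b j) * ∑ j, b j * s j ^ 2 := by
    refine Finset.sum_sq_le_sum_mul_sum_of_sq_le_mul _ (fun j _ => hb0 j)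
      (fun j _ => mul_nonneg (hb0 j) (sq_nonneg _)) fun j _ => le_of_eq (by ring)
  have h3 : 0 ≤ ∑ j, b j * s j ^ 2 :=
    Finset.sum_nonneg fun j _ => mul_nonneg (hb0 j) (sq_nonneg _)
  unfold limitExponent
  nlinarith

end Limit

/-! ### The limiting Gaussian–Bessel integral. -/

section GaussianLinear

theorem exp_quadratic_eq (a u s : ℝ) :
    Real.exp (-(a * s ^ 2)) * Real.exp (2 * u * (a * s))
      = Real.exp (a * u ^ 2) * Real.exp (-a * (s - u) ^ 2) := by
  rw [← Real.exp_add, ← Real.exp_add]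
  congr 1
  ring

theorem integrable_exp_quadratic {a : ℝ} (ha : 0 < a) (u : ℝ) :
    Integrable fun s : ℝ => Real.exp (-(a * s ^ 2)) * Real.exp (2 * u * (a * s)) := by
  simp_rw [exp_quadratic_eq]
  exact ((integrable_exp_neg_mul_sq ha).comp_sub_right u).const_mul _

theorem integral_exp_quadratic {a : ℝ} (u : ℝ) :
    ∫ s : ℝ, Real.exp (-(a * s ^ 2)) * Real.exp (2 * u * (a * s))
      = √(Real.pi / a) * Real.exp (a * u ^ 2) := by
  simp_rw [exp_quadratic_eq]
  rw [integral_const_mul, integral_sub_right_eq_self (fun s => Real.exp (-a * s ^ 2)),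
    integral_gaussian, mul_comm]

end GaussianLinear

variable {d : ℕ}

/-- The one-dimensional factors of the limit kernel. -/
noncomputable def limitFactor (J : Finset (Fin d)) (lam y : Fin d → ℝ) (j : Fin d) (s : ℝ) : ℝ :=
  if j ∈ J then (Set.Ioc (-Real.pi) Real.pi).indicator
    (fun s => Real.exp (-(2 * lam j * (1 - Real.cos s)))) s
  else Real.exp (-(y j * s ^ 2))

theorem measurable_limitFactor (J : Finset (Fin d)) (lam y : Fin d → ℝ) (j : Fin d) :
    Measurable (limitFactor J lam y j) := by
  unfold limitFactor
  split_ifs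
  · exact Measurable.indicator (by fun_prop) measurableSet_Ioc
  · fun_prop

theorem limitFactor_nonneg (J : Finset (Fin d)) (lam y : Fin d → ℝ) (j : Fin d) (s : ℝ) :
    0 ≤ limitFactor J lam y j s := by
  unfold limitFactor
  split_ifs
  · exact Set.indicator_nonneg (fun _ _ => (Real.exp_pos _).le) _
  · exact (Real.exp_pos _).le

/-- The value of the one-dimensional integrals. -/
noncomputable def limitFactorConst (J : Finset (Fin d)) (lam y : Fin d → ℝ) (j : Fin d) : ℝ :=
  if j ∈ J then 2 * Real.pi * (Real.exp (-2 * lam j) * besselI 0 (2 * lam j)) else √(Real.pi / y j)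

section

variable {J : Finset (Fin d)} {lam y : Fin d → ℝ}

/-- The tilt `e^{2u b_j s}` is what the linearization of the squared sum leaves in each coordinate;
it is trivial for `j ∈ J`. The case `u = 0` yields integrability of the majorant. -/
theorem integrable_limitFactor (hy : ∀ j ∉ J, 0 < y j) (j : Fin d) (u : ℝ) :
    Integrable fun s => limitFactor J lam y j s
      * Real.exp (2 * u * ((if j ∈ J then 0 else y j) * s)) := by
  by_cases hj : j ∈ J
  · simp only [limitFactor, if_pos hj, zero_mul, mul_zero, Real.exp_zero, mul_one]
    rw [integrable_indicator_iff measurableSet_Ioc]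
    refine (Continuous.integrableOn_Icc ?_).mono_set Set.Ioc_subset_Icc_self
    fun_prop
  · simp only [limitFactor, if_neg hj]
    exact integrable_exp_quadratic (hy j hj) u

theorem integral_limitFactor (hlam : ∀ j ∈ J, 0 ≤ lam j) (j : Fin d) (u : ℝ) :
    ∫ s, limitFactor J lam y j s * Real.exp (2 * u * ((if j ∈ J then 0 else y j) * s))
      = limitFactorConst J lam y j * Real.exp ((if j ∈ J then 0 else y j) * u ^ 2) := by
  by_cases hj : j ∈ J
  · simp only [limitFactor, limitFactorConst, if_pos hj, zero_mul, mul_zero, Real.exp_zero, mul_one]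
    rw [integral_indicator measurableSet_Ioc, integral_exp_one_sub_cos (hlam j hj)]
  · simp only [limitFactor, limitFactorConst, if_neg hj]
    exact integral_exp_quadratic u

theorem sum_ite_compl (J : Finset (Fin d)) (y : Fin d → ℝ) :
    ∑ j, (if j ∈ J then 0 else y j) = ∑ j ∈ Jᶜ, y j := by
  rw [Finset.sum_ite, Finset.sum_const_zero, zero_add]
  congr 1
  ext j; simp

/-- The Gaussian and Bessel integral that governs the collision probability. -/
theorem integral_limitFactor_mul_exp_sq (hlam : ∀ j ∈ J, 0 ≤ lam j) (hy : ∀ j ∉ J, 0 < y j)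
    (hy1 : ∑ j ∈ Jᶜ, y j < 1) :
    ∫ s : Fin d → ℝ, (∏ j, limitFactor J lam y j (s j))
        * Real.exp ((∑ j, (if j ∈ J then 0 else y j) * s j) ^ 2)
      = (∏ j, limitFactorConst J lam y j) * (√(1 - ∑ j ∈ Jᶜ, y j))⁻¹ := by
  set b : Fin d → ℝ := fun j => if j ∈ J then 0 else y j with hb
  set Y := ∑ j ∈ Jᶜ, y j with hY
  have hbY : ∑ j, b j = Y := sum_ite_compl J y
  -- The correlated square is decoupled by `√π e^{w²} = ∫ e^{2uw - u²} du` with `w = ∑ b_j s_j`. For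
  -- fixed `u` the integrand is a product over coordinates and integrates to a constant times
  -- `e^{-(1-Y)u²}`; `Y < 1` then justifies Fubini and produces the factor `(1-Y)^{-1/2}`.
  set G : (Fin d → ℝ) → ℝ → ℝ := fun s u =>
    (∏ j, limitFactor J lam y j (s j) * Real.exp (2 * u * (b j * s j))) * Real.exp (-(u ^ 2)) with hG
  have hpi : (0 : ℝ) < √Real.pi := Real.sqrt_pos.2 Real.pi_pos
  have hGin : ∀ u, ∫ s, G s u = (∏ j, limitFactorConst J lam y j) * Real.exp (-(1 - Y) * u ^ 2) := by
    intro u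
    simp only [hG]
    rw [integral_mul_const, integral_fintype_prod_volume_eq_prod
      (fun j s => limitFactor J lam y j s * Real.exp (2 * u * (b j * s))),
      Finset.prod_congr rfl fun j _ => integral_limitFactor hlam j u, Finset.prod_mul_distrib,
      ← Real.exp_sum, ← Finset.sum_mul, hbY, mul_assoc, ← Real.exp_add]
    congr 2
    ring
  have hGint : ∀ u, Integrable fun s => G s u := fun u =>
    (Integrable.fintype_prod fun j => integrable_limitFactor hy j u).mul_const _
  have hGnn : ∀ s u, 0 ≤ G s u := fun s u =>
    mul_nonneg (Finset.prod_nonneg fun j _ =>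
      mul_nonneg (limitFactor_nonneg _ _ _ _ _) (Real.exp_pos _).le) (Real.exp_pos _).le
  have hjoint : Integrable (Function.uncurry G) (volume.prod volume) := by
    rw [integrable_prod_iff']
    · refine ⟨ae_of_all _ fun u => hGint u, ?_⟩
      simp only [Function.uncurry, Real.norm_of_nonneg (hGnn _ _), hGin]
      exact (integrable_exp_neg_mul_sq (by linarith)).const_mul _
    · refine Measurable.aestronglyMeasurable ?_
      refine Measurable.mul (Finset.measurable_prod _ fun j _ => Measurable.mul ?_ ?_) ?_
      · exact (measurable_limitFactor J lam y j).comp ((measurable_pi_apply j).comp measurable_fst)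
      · fun_prop
      · fun_prop
  have hinner : ∀ s : Fin d → ℝ, ∫ u, G s u = √Real.pi * ((∏ j, limitFactor J lam y j (s j))
      * Real.exp ((∑ j, b j * s j) ^ 2)) := by
    intro s
    have e : ∀ u, G s u = (∏ j, limitFactor J lam y j (s j))
        * (Real.exp (-(1 * u ^ 2)) * Real.exp (2 * (∑ j, b j * s j) * (1 * u))) := by
      intro u
      simp only [hG, Finset.prod_mul_distrib, ← Real.exp_sum, ← Finset.mul_sum]
      rw [one_mul, one_mul, mul_assoc]
      congr 1
      rw [mul_comm]
      congr 2
      ring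
    simp_rw [e]
    rw [integral_const_mul, integral_exp_quadratic, div_one, one_mul]
    ring
  have hswap := integral_integral_swap hjoint
  simp_rw [hinner, hGin] at hswap
  rw [integral_const_mul, integral_const_mul, integral_gaussian, Real.sqrt_div' _ (by linarith)]
    at hswap
  apply mul_left_cancel₀ hpi.ne'
  rw [hswap]
  ring

/-- The limit constant of the scaled collision probability. -/
noncomputable def collisionConst (J : Finset (Fin d)) (lam y : Fin d → ℝ) : ℝ :=
  psi Jᶜ y * ∏ i ∈ J, (Real.exp (-2 * lam i) * besselI 0 (2 * lam i))

/-- Distributing one factor `(2π)⁻¹` to each coordinate leaves `(4π y_j)^{-1/2}` off `J` and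
`e^{-2λ_j} I₀(2λ_j)` in `J`. -/
theorem collisionConst_eq (hy : ∀ j ∉ J, 0 < y j) (hy1 : ∑ j ∈ Jᶜ, y j < 1) :
    ((2 * Real.pi) ^ d)⁻¹ * ((∏ j, limitFactorConst J lam y j) * (√(1 - ∑ j ∈ Jᶜ, y j))⁻¹)
      = collisionConst J lam y := by
  have hpi := Real.pi_pos
  have h1 : ((2 * Real.pi) ^ d)⁻¹ = ∏ _j : Fin d, (2 * Real.pi)⁻¹ := by
    rw [Finset.prod_const, Finset.card_univ, Fintype.card_fin, inv_pow]
  have h2 : ∀ j ∈ Jᶜ, (2 * Real.pi)⁻¹ * limitFactorConst J lam y j = (√(4 * Real.pi * y j))⁻¹ := by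
    intro j hj
    have hj' : j ∉ J := by simpa using hj
    have hyj := hy j hj'
    rw [limitFactorConst, if_neg hj', ← Real.sqrt_inv]
    have e : (4 * Real.pi * y j)⁻¹ = ((2 * Real.pi)⁻¹) ^ 2 * (Real.pi / y j) := by
      field_simp
      norm_num
    rw [e, Real.sqrt_mul (by positivity), Real.sqrt_sq (by positivity)]
  have h3 : ∀ j ∈ J, (2 * Real.pi)⁻¹ * limitFactorConst J lam y j
      = Real.exp (-2 * lam j) * besselI 0 (2 * lam j) := by
    intro j hj
    rw [limitFactorConst, if_pos hj, inv_mul_cancel_left₀ (by positivity)]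
  rw [h1, ← mul_assoc, ← Finset.prod_mul_distrib, ← Finset.prod_mul_prod_compl J,
    Finset.prod_congr rfl h2, Finset.prod_congr rfl h3, collisionConst, psi, mul_assoc, mul_comm]
  congr 1
  have hY : 0 < 1 - ∑ j ∈ Jᶜ, y j := by linarith
  have hprod : 0 < ∏ j ∈ Jᶜ, y j := Finset.prod_pos fun j hj => hy j (by simpa using hj)
  rw [Real.rpow_neg (by positivity), ← Real.sqrt_eq_rpow, Finset.prod_inv_distrib,
    ← Real.sqrt_prod _ fun j hj => ?_, Finset.prod_mul_distrib, Finset.prod_const, ← mul_inv,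
    ← Real.sqrt_mul (by positivity)]
  · congr 2
    ring
  · have := hy j (by simpa using hj)
    positivity

end

/-! ### The local limit theorem for the collision probability. -/

/-- Change of variables for the scaling of the frequencies. -/
theorem integral_comp_freqScale {J : Finset (Fin d)} {m : ℕ} (hm : 0 < m) {g : (Fin d → ℝ) → ℝ}
    (hg : Measurable g) :
    ∫ s : Fin d → ℝ, g (fun j => freqScale J m j * s j) = √(m : ℝ) ^ Jᶜ.card * ∫ t, g t := by
  have hsq : 0 < √(m : ℝ) := Real.sqrt_pos.2 (by exact_mod_cast hm)
  have hdet : (Matrix.diagonal (freqScale J m)).det = (√(m : ℝ) ^ Jᶜ.card)⁻¹ := by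
    have h1 : ∀ j ∈ J, freqScale J m j = 1 := fun j hj => if_pos hj
    have h2 : ∀ j ∈ Jᶜ, freqScale J m j = (√(m : ℝ))⁻¹ := fun j hj => if_neg (Finset.mem_compl.1 hj)
    rw [Matrix.det_diagonal, ← Finset.prod_mul_prod_compl J, Finset.prod_congr rfl h1,
      Finset.prod_congr rfl h2, Finset.prod_const_one, one_mul, Finset.prod_const, inv_pow]
  have hne : (Matrix.diagonal (freqScale J m)).det ≠ 0 := by rw [hdet]; positivity
  have hmeas : Measurable (Matrix.toLin' (Matrix.diagonal (freqScale J m))) :=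
    (LinearMap.continuous_of_finiteDimensional _).measurable
  have h := congrArg (fun μ => ∫ t, g t ∂μ) (Real.smul_map_diagonal_volume_pi hne)
  simp only [integral_smul_measure] at h
  rw [integral_map hmeas.aemeasurable hg.aestronglyMeasurable, hdet,
    ENNReal.toReal_ofReal (abs_nonneg _), abs_of_pos (by positivity), smul_eq_mul] at h
  rw [← h, mul_inv_cancel_left₀ (by positivity)]
  congr 1
  ext s
  congr 1
  ext j
  simp [Matrix.mulVec_diagonal]

theorem continuous_modulusDefect (x : Fin d → ℝ) : Continuous (modulusDefect x) := by
  unfold modulusDefect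
  fun_prop

/-- The scaled collision probability as an integral over scaled frequencies. -/
theorem scaled_sum_multinomialProb_sq {J : Finset (Fin d)} {m : ℕ} (hm : 0 < m) (N : ℕ)
    (x : Fin d → ℝ) :
    √(m : ℝ) ^ Jᶜ.card * ∑ k ∈ latticeSimplex d N, multinomialProb N k x ^ 2
      = ((2 * Real.pi) ^ d)⁻¹ * ∫ s : Fin d → ℝ, (periodBox d).indicator
          (fun t => (1 - modulusDefect x t) ^ N) (fun j => freqScale J m j * s j) := by
  have hmeas : Measurable ((periodBox d).indicator fun t => (1 - modulusDefect x t) ^ N) := by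
    refine Measurable.indicator ?_ (measurableSet_periodBox d)
    exact ((continuous_const.sub (continuous_modulusDefect x)).pow N).measurable
  rw [integral_comp_freqScale hm hmeas, sum_multinomialProb_sq,
    integral_indicator (measurableSet_periodBox d)]
  ring

section Limit

variable {J : Finset (Fin d)} {ι : Type*} {l : Filter ι} {m : ι → ℕ}
  {lam : ι → Fin d → ℝ} {lam₀ y : Fin d → ℝ}

theorem sum_facePoint (J : Finset (Fin d)) (y : Fin d → ℝ) :
    ∑ j, facePoint J y j = ∑ j ∈ Jᶜ, y j := sum_ite_compl J y

/-- Conditions under which the evaluation points eventually lie in the simplex. -/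
theorem eventually_nearPoint (hm : Tendsto m l atTop) (hlam : Tendsto lam l (𝓝 lam₀))
    (hlam0 : ∀ᶠ i in l, ∀ j ∈ J, 0 ≤ lam i j) (hy : ∀ j ∉ J, 0 < y j) (hy1 : ∑ j ∈ Jᶜ, y j < 1) :
    ∀ᶠ i in l, (∀ j, 0 ≤ nearPoint J (lam i) y (m i) j) ∧
      (1 - ∑ j ∈ Jᶜ, y j) / 2 ≤ 1 - ∑ j, nearPoint J (lam i) y (m i) j := by
  have hx := tendsto_nearPoint (J := J) (y := y) hm hlam
  have hsum : Tendsto (fun i => 1 - ∑ j, nearPoint J (lam i) y (m i) j) l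
      (𝓝 (1 - ∑ j, facePoint J y j)) :=
    tendsto_const_nhds.sub (tendsto_finsetSum _ fun j _ => tendsto_pi_nhds.1 hx j)
  rw [sum_facePoint] at hsum
  filter_upwards [hsum.eventually_const_le (by linarith : (1 - ∑ j ∈ Jᶜ, y j) / 2 < _), hlam0]
    with i hi hl
  refine ⟨fun j => ?_, hi⟩
  unfold nearPoint
  split_ifs with hj
  · exact div_nonneg (hl j hj) (Nat.cast_nonneg _)
  · exact (hy j hj).le

/-- The local limit theorem for the collision probability of the multinomial distribution, with
small cell probabilities for the indices in `J`. -/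
theorem tendsto_scaled_sum_multinomialProb_sq [l.IsCountablyGenerated] (hm : Tendsto m l atTop)
    (hlam : Tendsto lam l (𝓝 lam₀)) (hlam0 : ∀ᶠ i in l, ∀ j ∈ J, 0 ≤ lam i j)
    (hlam1 : ∀ j ∈ J, 0 ≤ lam₀ j)
    (hy : ∀ j ∉ J, 0 < y j) (hy1 : ∑ j ∈ Jᶜ, y j < 1) :
    Tendsto (fun i => √(m i : ℝ) ^ Jᶜ.card * ∑ k ∈ latticeSimplex d (m i - 1),
      multinomialProb (m i - 1) k (nearPoint J (lam i) y (m i)) ^ 2) l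
      (𝓝 (collisionConst J lam₀ y)) := by
  set Y := ∑ j ∈ Jᶜ, y j with hY
  set x := fun i => nearPoint J (lam i) y (m i) with hx
  set F : ι → (Fin d → ℝ) → ℝ := fun i s => (periodBox d).indicator
    (fun t => (1 - modulusDefect (x i) t) ^ (m i - 1)) (fun j => freqScale J (m i) j * s j) with hF
  -- The rate of the Gaussian majorant: eventually `2(1 - ∑ x_j) ≥ 1 - Y`, the quadratic bound on
  -- the cosine gives `2/π²`, and `m - 1 ≥ m/2` for `m ≥ 2`. The majorant is the limit kernel with
  -- `lam = 0` and `y` replaced by `κ • y`, that is, an indicator in `J` and a Gaussian off `J`.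
  set κ := (1 - Y) / Real.pi ^ 2 with hκ
  have hκ0 : 0 < κ := div_pos (by linarith) (by positivity)
  have hmR : Tendsto (fun i => (m i : ℝ)) l atTop := tendsto_natCast_atTop_atTop.comp hm
  have hnear := eventually_nearPoint hm hlam hlam0 hy hy1
  have hlim : Tendsto (fun i => ∫ s, F i s) l (𝓝 (∫ s : Fin d → ℝ,
      (∏ j, limitFactor J lam₀ y j (s j))
        * Real.exp ((∑ j, (if j ∈ J then 0 else y j) * s j) ^ 2))) := by
    refine tendsto_integral_filter_of_dominated_convergence
      (fun s => ∏ j, limitFactor J 0 (κ • y) j (s j)) ?_ ?_ ?_ ?_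
    · refine .of_forall fun i => ?_
      have hmeas : Measurable
          ((periodBox d).indicator fun t => (1 - modulusDefect (x i) t) ^ (m i - 1)) := by
        refine Measurable.indicator ?_ (measurableSet_periodBox d)
        exact ((continuous_const.sub (continuous_modulusDefect (x i))).pow _).measurable
      exact (hmeas.comp (by fun_prop)).aestronglyMeasurable
    · filter_upwards [hnear, hm.eventually_ge_atTop 2] with i hi hmi
      refine ae_of_all _ fun s => ?_
      obtain ⟨hx0, hxs⟩ := hi
      have hx1 : ∑ j, x i j ≤ 1 := by linarith
      simp only [hF]
      by_cases hs : (fun j => freqScale J (m i) j * s j) ∈ periodBox d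
      · rw [Set.indicator_of_mem hs]
        have hv1 := modulusDefect_le_one (x i) fun j => freqScale J (m i) j * s j
        have hvl := le_modulusDefect hx0 hx1 hs Jᶜ
        set v := modulusDefect (x i) fun j => freqScale J (m i) j * s j
        rw [Real.norm_of_nonneg (pow_nonneg (by linarith) _)]
        have hmpos : (0 : ℝ) < m i := by exact_mod_cast (by omega : 0 < m i)
        have hsum : ∑ j ∈ Jᶜ, x i j * (2 / Real.pi ^ 2 * (freqScale J (m i) j * s j) ^ 2)
            = (m i : ℝ)⁻¹ * (2 / Real.pi ^ 2) * ∑ j ∈ Jᶜ, y j * s j ^ 2 := by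
          rw [Finset.mul_sum]
          refine Finset.sum_congr rfl fun j hj => ?_
          have hj' := Finset.mem_compl.1 hj
          simp only [hx, nearPoint, freqScale, if_neg hj', mul_pow, inv_pow,
            Real.sq_sqrt hmpos.le]
          ring
        rw [hsum] at hvl
        have hS : 0 ≤ ∑ j ∈ Jᶜ, y j * s j ^ 2 := Finset.sum_nonneg fun j hj =>
          mul_nonneg (hy j (Finset.mem_compl.1 hj)).le (sq_nonneg _)
        set S := ∑ j ∈ Jᶜ, y j * s j ^ 2
        have hN : (m i : ℝ) / 2 ≤ ((m i - 1 : ℕ) : ℝ) := by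
          rw [Nat.cast_sub (by omega)]
          have : (2 : ℝ) ≤ m i := by exact_mod_cast hmi
          push_cast; linarith
        have hNv : κ * S ≤ ((m i - 1 : ℕ) : ℝ) * v := by
          have h0 : 0 ≤ (m i : ℝ)⁻¹ * (2 / Real.pi ^ 2) * S := by positivity
          have h1 : (1 - Y) * ((m i : ℝ)⁻¹ * (2 / Real.pi ^ 2) * S) ≤ v :=
            le_trans (mul_le_mul_of_nonneg_right (by linarith) h0) hvl
          have h2 : 0 ≤ (1 - Y) * ((m i : ℝ)⁻¹ * (2 / Real.pi ^ 2) * S) :=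
            mul_nonneg (by linarith) h0
          calc κ * S = (m i : ℝ) / 2 * ((1 - Y) * ((m i : ℝ)⁻¹ * (2 / Real.pi ^ 2) * S)) := by
                rw [hκ]; field_simp
            _ ≤ ((m i - 1 : ℕ) : ℝ) * v := mul_le_mul hN h1 h2 (by positivity)
        have hprod : ∏ j, limitFactor J 0 (κ • y) j (s j) = Real.exp (-(κ * S)) := by
          have e1 : ∀ j ∈ J, limitFactor J 0 (κ • y) j (s j) = 1 := by
            intro j hj
            have := hs j (Set.mem_univ j)
            simp only [freqScale, if_pos hj, one_mul] at this
            simp [limitFactor, hj, Set.indicator_of_mem this]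
          have e2 : ∀ j ∈ Jᶜ, limitFactor J 0 (κ • y) j (s j)
              = Real.exp (-(κ * (y j * s j ^ 2))) := by
            intro j hj
            rw [limitFactor, if_neg (Finset.mem_compl.1 hj)]
            simp only [Pi.smul_apply, smul_eq_mul, mul_assoc]
          rw [← Finset.prod_mul_prod_compl J, Finset.prod_eq_one e1, one_mul,
            Finset.prod_congr rfl e2, ← Real.exp_sum, Finset.sum_neg_distrib, ← Finset.mul_sum]
        rw [hprod]
        calc (1 - v) ^ (m i - 1) ≤ Real.exp (-v) ^ (m i - 1) :=
              pow_le_pow_left₀ (by linarith) (Real.one_sub_le_exp_neg v) _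
          _ = Real.exp (-(((m i - 1 : ℕ) : ℝ) * v)) := by
              rw [← Real.exp_nat_mul]; congr 1; ring
          _ ≤ _ := Real.exp_le_exp.2 (by linarith)
      · rw [Set.indicator_of_notMem hs, norm_zero]
        exact Finset.prod_nonneg fun j _ => limitFactor_nonneg _ _ _ _ _
    · have := fun j => integrable_limitFactor (J := J) (lam := 0) (y := κ • y)
        (fun j hj => by simpa using mul_pos hκ0 (hy j hj)) j 0
      simp only [mul_zero, zero_mul, Real.exp_zero, mul_one] at this
      exact Integrable.fintype_prod this
    · refine ae_of_all _ fun s => ?_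
      -- Frequencies in `J` are not rescaled, so the box constrains them permanently; those off `J`
      -- enter it eventually. If some `s j` with `j ∈ J` lies outside the period, both the
      -- integrands and the limit are zero.
      by_cases hs : ∀ j ∈ J, s j ∈ Set.Ioc (-Real.pi) Real.pi
      · have hmem : ∀ᶠ i in l, (fun j => freqScale J (m i) j * s j) ∈ periodBox d := by
          have : ∀ j, ∀ᶠ i in l, freqScale J (m i) j * s j ∈ Set.Ioc (-Real.pi) Real.pi := by
            intro j
            by_cases hj : j ∈ J
            · refine .of_forall fun i => ?_
              simpa [freqScale, hj] using hs j hj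
            · have hinv : Tendsto (fun i => (√(m i : ℝ))⁻¹ * s j) l (𝓝 0) := by
                simpa using ((tendsto_inv_atTop_zero.comp
                  (Real.tendsto_sqrt_atTop.comp hmR)).mul_const (s j))
              filter_upwards [hinv.eventually (Ioc_mem_nhds (neg_lt_zero.2 Real.pi_pos)
                Real.pi_pos)] with i hi
              simpa [freqScale, hj] using hi
          filter_upwards [eventually_all.2 this] with i hi j _ using hi j
        have hL : (∏ j, limitFactor J lam₀ y j (s j))
            * Real.exp ((∑ j, (if j ∈ J then 0 else y j) * s j) ^ 2)
            = Real.exp (-limitExponent J lam₀ y s) := by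
          have : ∀ j, limitFactor J lam₀ y j (s j)
              = Real.exp (-(2 * (if j ∈ J then lam₀ j * (1 - Real.cos (s j)) else 0)
                + (if j ∈ J then 0 else y j) * s j ^ 2)) := by
            intro j
            by_cases hj : j ∈ J
            · simp [limitFactor, hj, Set.indicator_of_mem (hs j hj)]; ring_nf
            · simp [limitFactor, hj]
          rw [Finset.prod_congr rfl fun j _ => this j, ← Real.exp_sum, ← Real.exp_add,
            Finset.sum_neg_distrib, Finset.sum_add_distrib, ← Finset.mul_sum, limitExponent]
          congr 1
          ring
        rw [hL]
        have hv := tendsto_mul_modulusDefect (J := J) (y := y) hm hlam s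
        have hL0 := limitExponent_nonneg hlam1 hy hy1.le s
        set v := fun i => modulusDefect (x i) fun j => freqScale J (m i) j * s j with hvdef
        have hv0 : Tendsto v l (𝓝 0) := by
          have := hv.mul (tendsto_inv_atTop_zero.comp hmR)
          rw [mul_zero] at this
          refine this.congr' ?_
          filter_upwards [hmR.eventually_gt_atTop 0] with i hi
          simp only [Function.comp, hvdef]
          field_simp
          rfl
        -- The number of trials is `m - 1`; the difference from `m` is one copy of `v`, which tends
        -- to zero.
        have hNv : Tendsto (fun i => ((m i - 1 : ℕ) : ℝ) * v i) l
            (𝓝 (limitExponent J lam₀ y s)) := by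
          have := hv.sub hv0
          rw [sub_zero] at this
          refine this.congr' ?_
          filter_upwards [hm.eventually_ge_atTop 1] with i hi
          rw [Nat.cast_sub hi]
          push_cast
          simp only [hvdef]
          ring
        rw [tendsto_iff_norm_sub_tendsto_zero]
        have hb : Tendsto (fun i => |((m i - 1 : ℕ) : ℝ) * v i - limitExponent J lam₀ y s|
            + 2 * (((m i - 1 : ℕ) : ℝ) * v i) * v i) l (𝓝 0) := by
          have h1 := (hNv.sub_const (limitExponent J lam₀ y s)).abs
          have h2 := (hNv.const_mul 2).mul hv0
          simpa using h1.add h2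
        refine squeeze_zero' (.of_forall fun _ => norm_nonneg _) ?_ hb
        filter_upwards [hmem, hnear, hv0.eventually_le_const (by norm_num : (0 : ℝ) < 1 / 2)]
          with i hi1 hi2 hi3
        have hvn : 0 ≤ v i := modulusDefect_nonneg hi2.1 (by linarith [hi2.2]) _
        simp only [hF, Set.indicator_of_mem hi1, Real.norm_eq_abs]
        refine (abs_one_sub_pow_sub_exp_le hvn hi3 hL0 _).trans (le_of_eq ?_)
        ring
      · push Not at hs
        obtain ⟨j, hj, hsj⟩ := hs
        have h1 : ∏ j, limitFactor J lam₀ y j (s j) = 0 :=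
          Finset.prod_eq_zero (Finset.mem_univ j) (by
            rw [limitFactor, if_pos hj, Set.indicator_of_notMem hsj])
        have h2 : ∀ i, F i s = 0 := fun i => by
          refine Set.indicator_of_notMem (fun h => hsj ?_) _
          simpa [freqScale, hj] using h j (Set.mem_univ j)
        simpa [h1, h2] using tendsto_const_nhds
  rw [integral_limitFactor_mul_exp_sq hlam1 hy hy1] at hlim
  have := hlim.const_mul ((2 * Real.pi) ^ d)⁻¹
  rw [collisionConst_eq hy hy1] at this
  refine this.congr' ?_
  filter_upwards [hm.eventually_gt_atTop 0] with i hi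
  rw [scaled_sum_multinomialProb_sq hi]

end Limit

/-! ### Rate of the collision probability at the vertex. -/

variable {d : ℕ}

theorem measureReal_periodBox (d : ℕ) : volume.real (periodBox d) = (2 * Real.pi) ^ d := by
  have h := setIntegral_periodBox_prod (d := d) (fun _ _ => (1 : ℝ))
  simp only [Finset.prod_const_one, setIntegral_const, smul_eq_mul, mul_one, Finset.prod_const,
    Finset.card_univ, Fintype.card_fin, Real.volume_real_Ioc] at h
  rw [h, max_eq_left (by linarith [Real.pi_pos])]
  ring

/-- The rate of convergence of the collision probability in the Poisson regime. -/
theorem exists_abs_sum_multinomialProb_sq_sub_le {lam : Fin d → ℝ} (hlam : ∀ i, 0 ≤ lam i) :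
    ∃ C : ℝ, ∀ᶠ m : ℕ in atTop, |∑ k ∈ latticeSimplex d (m - 1),
      multinomialProb (m - 1) k (fun i => lam i / m) ^ 2
        - ∏ i, (Real.exp (-2 * lam i) * besselI 0 (2 * lam i))| ≤ C * (m : ℝ)⁻¹ := by
  set Λ := ∑ i, lam i with hΛ
  have hΛ0 : 0 ≤ Λ := Finset.sum_nonneg fun i _ => hlam i
  -- Below, `S ≤ 2Λ` and `Q ≤ 2Λ²`, so the defect is at most `(2S + Q)/m ≤ K/m`.
  set K := 4 * Λ + 2 * Λ ^ 2 with hK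
  have hK0 : 0 ≤ K := by positivity
  -- `6Λ²` bounds `|-2ΛS + Q|`, the deviation of `m v` from its limit; `K` pays for `m - 1` trials
  -- in place of `m`; `2K²` is the second-order error of `(1 - v)^N`.
  refine ⟨6 * Λ ^ 2 + K + 2 * K ^ 2, ?_⟩
  have hmR := tendsto_natCast_atTop_atTop (R := ℝ)
  filter_upwards [eventually_ge_atTop 1, hmR.eventually_ge_atTop Λ,
    hmR.eventually_ge_atTop (2 * K)] with m hm hmΛ hmK
  have hm1 : (1 : ℝ) ≤ m := by exact_mod_cast hm
  have hm0 : (0 : ℝ) < m := by linarith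
  set x : Fin d → ℝ := fun i => lam i / m with hx
  have hx0 : ∀ i, 0 ≤ x i := fun i => div_nonneg (hlam i) hm0.le
  have hxs : ∑ i, x i = Λ / m := by rw [hx, ← Finset.sum_div]
  have hx1 : ∑ i, x i ≤ 1 := by rw [hxs, div_le_one hm0]; exact hmΛ
  set L : (Fin d → ℝ) → ℝ := fun t => ∑ j, 2 * lam j * (1 - Real.cos (t j)) with hL
  have hconst : ((2 * Real.pi) ^ d)⁻¹ * ∫ t in periodBox d, Real.exp (-L t)
      = ∏ i, (Real.exp (-2 * lam i) * besselI 0 (2 * lam i)) := by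
    simp only [hL, ← Finset.sum_neg_distrib, Real.exp_sum]
    rw [setIntegral_periodBox_prod (fun j t => Real.exp (-(2 * lam j * (1 - Real.cos t)))),
      Finset.prod_congr rfl fun j _ => integral_exp_one_sub_cos (hlam j), Finset.prod_mul_distrib,
      Finset.prod_const, Finset.card_univ, Fintype.card_fin, inv_mul_cancel_left₀ (by positivity)]
  rw [sum_multinomialProb_sq, ← hconst, ← mul_sub, ← integral_sub]
  rotate_left
  · exact integrableOn_periodBox ((continuous_const.sub (continuous_modulusDefect x)).pow _)
  · refine integrableOn_periodBox ?_
    simp only [hL]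
    fun_prop
  have hpt : ∀ t ∈ periodBox d, ‖(1 - modulusDefect x t) ^ (m - 1) - Real.exp (-L t)‖
      ≤ (6 * Λ ^ 2 + K + 2 * K ^ 2) * (m : ℝ)⁻¹ := by
    intro t _
    have hc0 : ∀ a, 0 ≤ 1 - Real.cos a := fun a => by linarith [Real.cos_le_one a]
    have hc2 : ∀ a, 1 - Real.cos a ≤ 2 := fun a => by linarith [Real.neg_one_le_cos a]
    set S := ∑ j, lam j * (1 - Real.cos (t j)) with hS
    set Q := ∑ j, ∑ l, lam j * lam l * (1 - Real.cos (t j - t l)) with hQ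
    have hS0 : 0 ≤ S := Finset.sum_nonneg fun j _ => mul_nonneg (hlam j) (hc0 _)
    have hS2 : S ≤ 2 * Λ := by
      rw [hΛ, Finset.mul_sum]
      exact Finset.sum_le_sum fun j _ => by nlinarith [hlam j, hc2 (t j)]
    have hQ0 : 0 ≤ Q := Finset.sum_nonneg fun j _ => Finset.sum_nonneg fun l _ =>
      mul_nonneg (mul_nonneg (hlam j) (hlam l)) (hc0 _)
    have hQ2 : Q ≤ 2 * Λ ^ 2 := by
      rw [sq, hΛ, Finset.sum_mul_sum, Finset.mul_sum]
      refine Finset.sum_le_sum fun j _ => ?_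
      rw [Finset.mul_sum]
      refine Finset.sum_le_sum fun l _ => ?_
      nlinarith [mul_nonneg (hlam j) (hlam l), hc2 (t j - t l)]
    have hLS : L t = 2 * S := by
      simp only [hL, hS, Finset.mul_sum, mul_assoc]
    have hv : modulusDefect x t = (2 * (1 - Λ / m) * S + Q / m) / m := by
      have e1 : ∑ j, x j * (1 - Real.cos (t j)) = S / m := by
        rw [hS, Finset.sum_div]
        exact Finset.sum_congr rfl fun j _ => by simp only [hx]; ring
      have e2 : ∑ j, ∑ l, x j * x l * (1 - Real.cos (t j - t l)) = Q / m / m := by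
        simp only [hQ, Finset.sum_div]
        exact Finset.sum_congr rfl fun j _ => Finset.sum_congr rfl fun l _ => by
          simp only [hx]; ring
      rw [modulusDefect, hxs, e1, e2]
      ring
    have hv0 := modulusDefect_nonneg hx0 hx1 t
    set v := modulusDefect x t
    have hΛm : 0 ≤ Λ / m := by positivity
    have hvK : v ≤ K / m := by
      rw [hv]
      refine div_le_div_of_nonneg_right ?_ hm0.le
      have h1 : 0 ≤ Λ / m * S := mul_nonneg hΛm hS0
      have h2 : Q / m ≤ Q := div_le_self hQ0 hm1
      rw [hK]; linarith
    have hv12 : v ≤ 1 / 2 := by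
      refine hvK.trans ?_
      rw [div_le_iff₀ hm0]; linarith
    have hN : ((m - 1 : ℕ) : ℝ) = m - 1 := by rw [Nat.cast_sub hm, Nat.cast_one]
    refine (abs_one_sub_pow_sub_exp_le hv0 hv12 (by rw [hLS]; positivity) _).trans ?_
    rw [hN]
    have e1 : ((m : ℝ) - 1) * v - L t = (-2 * Λ * S + Q) / m - v := by
      rw [hLS, sub_mul, one_mul]
      nth_rewrite 1 [hv]
      field_simp
      ring
    have e2 : |((m : ℝ) - 1) * v - L t| ≤ 6 * Λ ^ 2 / m + K / m := by
      rw [e1]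
      refine (abs_sub _ _).trans (add_le_add ?_ ?_)
      · rw [abs_div, abs_of_pos hm0]
        refine div_le_div_of_nonneg_right ?_ hm0.le
        rw [abs_le]
        constructor <;> nlinarith
      · rw [abs_of_nonneg hv0]; exact hvK
    have e3 : 2 * ((m : ℝ) - 1) * v ^ 2 ≤ 2 * K ^ 2 / m := by
      calc 2 * ((m : ℝ) - 1) * v ^ 2 ≤ 2 * m * (K / m) ^ 2 := by
            gcongr
            linarith
        _ = _ := by field_simp
    calc _ ≤ 6 * Λ ^ 2 / m + K / m + 2 * K ^ 2 / m := add_le_add e2 e3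
      _ = _ := by ring
  have hbox : volume (periodBox d) < ⊤ := by
    rw [periodBox, volume_pi_pi]
    exact ENNReal.prod_lt_top fun _ _ => measure_Ioc_lt_top
  have hfin := norm_setIntegral_le_of_norm_le_const hbox hpt
  rw [measureReal_periodBox, Real.norm_eq_abs] at hfin
  have h2pi : (0 : ℝ) < (2 * Real.pi) ^ d := by positivity
  rw [abs_mul, abs_of_pos (inv_pos.2 h2pi), inv_mul_le_iff₀ h2pi, mul_comm ((2 * Real.pi) ^ d)]
  exact hfin

/-! ### Chernoff bounds for indices far from the face point. -/

section Tail

/-- The generating function at the vector with `e^θ` in place `j` and ones elsewhere is `(1 + x_j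
(e^θ - 1))^N`, and `1 + u ≤ e^u`. Both signs of `θ` are used, one for each tail. -/
theorem multinomialExp_exp_le {N : ℕ} {x : Fin d → ℝ} (hx : ∀ i, 0 ≤ x i) (hx1 : ∑ i, x i ≤ 1)
    (j : Fin d) (θ : ℝ) :
    multinomialExp N x (fun k => Real.exp (θ * k j)) ≤ Real.exp (N * (x j * (Real.exp θ - 1))) := by
  have h := multinomialExp_prod_pow N x (Function.update 1 j (Real.exp θ))
  have h1 : ∀ k : Fin d → ℕ, ∏ i, Function.update (1 : Fin d → ℝ) j (Real.exp θ) i ^ k i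
      = Real.exp (θ * k j) := by
    intro k
    rw [Finset.prod_eq_single j]
    · rw [Function.update_self, ← Real.exp_nat_mul, mul_comm]
    · intro i _ hi
      simp [hi]
    · simp
  have h2 : (algebraMap ℝ ℝ) (1 - ∑ i, x i)
      + ∑ i, x i • Function.update (1 : Fin d → ℝ) j (Real.exp θ) i
      = 1 + x j * (Real.exp θ - 1) := by
    have e : ∑ i, x i • Function.update (1 : Fin d → ℝ) j (Real.exp θ) i
        = x j * Real.exp θ + ∑ i ∈ Finset.univ.erase j, x i := by
      rw [← Finset.add_sum_erase _ _ (Finset.mem_univ j), Function.update_self, smul_eq_mul]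
      congr 1
      refine Finset.sum_congr rfl fun i hi => ?_
      rw [Function.update_of_ne (Finset.ne_of_mem_erase hi), Pi.one_apply, smul_eq_mul, mul_one]
    rw [e, ← Finset.add_sum_erase _ x (Finset.mem_univ j), Algebra.algebraMap_self, RingHom.id_apply]
    ring
  simp only [h1, h2] at h
  rw [h, Real.exp_nat_mul]
  refine pow_le_pow_left₀ ?_ ?_ N
  · have hj : x j ≤ 1 := (Finset.single_le_sum (fun i _ => hx i) (Finset.mem_univ j)).trans hx1
    nlinarith [Real.exp_pos θ, hx j, mul_nonneg (hx j) (Real.exp_pos θ).le]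
  · linarith [Real.add_one_le_exp (x j * (Real.exp θ - 1))]

/-- The indicator of the indices whose rescaling is at distance at least `ρ` from `c`. -/
noncomputable def farIndicator (m : ℕ) (c : Fin d → ℝ) (ρ : ℝ) (k : Fin d → ℕ) : ℝ :=
  open Classical in if ∃ j, ρ ≤ |(k j : ℝ) / m - c j| then 1 else 0

theorem farIndicator_nonneg (m : ℕ) (c : Fin d → ℝ) (ρ : ℝ) (k : Fin d → ℕ) :
    0 ≤ farIndicator m c ρ k := by
  unfold farIndicator
  split_ifs <;> norm_num

theorem farIndicator_eq_one {m : ℕ} {c : Fin d → ℝ} {ρ : ℝ} {k : Fin d → ℕ}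
    (h : ¬ ∀ j, |(k j : ℝ) / m - c j| < ρ) : farIndicator m c ρ k = 1 := by
  push Not at h
  exact if_pos h

/-- A far index deviates upward or downward in some coordinate, and the corresponding exponential is
then at least one. -/
theorem farIndicator_le {m : ℕ} (hm : 0 < m) (c : Fin d → ℝ) (ρ : ℝ) (k : Fin d → ℕ) {h : ℝ}
    (hh : 0 ≤ h) :
    farIndicator m c ρ k ≤ ∑ j, (Real.exp (-(h * m * (c j + ρ))) * Real.exp (h * k j)
      + Real.exp (h * m * (c j - ρ)) * Real.exp (-h * k j)) := by
  have hm0 : (0 : ℝ) < m := by exact_mod_cast hm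
  have hnn : ∀ j, 0 ≤ Real.exp (-(h * m * (c j + ρ))) * Real.exp (h * k j)
      + Real.exp (h * m * (c j - ρ)) * Real.exp (-h * k j) := fun j => by positivity
  unfold farIndicator
  split_ifs with hfar
  · obtain ⟨j, hj⟩ := hfar
    refine le_trans ?_ (Finset.single_le_sum (fun j _ => hnn j) (Finset.mem_univ j))
    rw [← Real.exp_add, ← Real.exp_add]
    rcases le_abs.1 hj with h1 | h1
    · have h2 : m * (c j + ρ) ≤ k j := by
        rw [mul_comm, ← le_div_iff₀ hm0]; linarith
      have : (1 : ℝ) ≤ Real.exp (-(h * m * (c j + ρ)) + h * k j) :=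
        Real.one_le_exp (by nlinarith)
      linarith [Real.exp_pos (h * m * (c j - ρ) + -h * k j)]
    · have h2 : (k j : ℝ) ≤ m * (c j - ρ) := by
        rw [mul_comm, ← div_le_iff₀ hm0]; linarith
      have : (1 : ℝ) ≤ Real.exp (h * m * (c j - ρ) + -h * k j) :=
        Real.one_le_exp (by nlinarith)
      linarith [Real.exp_pos (-(h * m * (c j + ρ)) + h * k j)]
  · exact Finset.sum_nonneg fun j _ => hnn j

/-- In the exponent, per unit of `m`, the gain `ρh` exceeds the losses `ρh/4`, from `|x_j - c_j| ≤
ρ/4`, and `h² ≤ ρh/4`, from the expansion of `e^{±h}`; a gain of `ρh/2` remains. -/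
theorem multinomialExp_farIndicator_le {m : ℕ} (hm : 0 < m) {x c : Fin d → ℝ} (hx : ∀ i, 0 ≤ x i)
    (hx1 : ∑ i, x i ≤ 1) {ρ h : ℝ} (hh : 0 < h) (hh1 : h ≤ 1) (hhρ : h ≤ ρ / 4)
    (hxc : ∀ j, |x j - c j| ≤ ρ / 4) :
    multinomialExp (m - 1) x (farIndicator m c ρ)
      ≤ 2 * d * (Real.exp 1 * Real.exp (-(ρ * h / 2) * m)) := by
  have hm0 : (0 : ℝ) < m := by exact_mod_cast hm
  have hN : ((m - 1 : ℕ) : ℝ) = m - 1 := by rw [Nat.cast_sub hm, Nat.cast_one]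
  refine (multinomialExp_mono hx hx1 fun k _ => farIndicator_le hm c ρ k hh.le).trans ?_
  rw [multinomialExp_sum]
  have hterm : ∀ j, multinomialExp (m - 1) x (fun k =>
      Real.exp (-(h * m * (c j + ρ))) * Real.exp (h * k j)
      + Real.exp (h * m * (c j - ρ)) * Real.exp (-h * k j))
      ≤ 2 * (Real.exp 1 * Real.exp (-(ρ * h / 2) * m)) := by
    intro j
    have hxj1 : x j ≤ 1 := (Finset.single_le_sum (fun i _ => hx i) (Finset.mem_univ j)).trans hx1
    have hxj := abs_le.1 (hxc j)
    have hx0 := hx j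
    rw [multinomialExp_add, multinomialExp_const_mul, multinomialExp_const_mul, two_mul]
    have hq : 0 ≤ m * ((ρ / 4 - h) * h) := by
      have : 0 ≤ ρ / 4 - h := by linarith
      positivity
    refine add_le_add ?_ ?_
    · refine (mul_le_mul_of_nonneg_left (multinomialExp_exp_le hx hx1 j h)
        (Real.exp_pos _).le).trans ?_
      rw [← Real.exp_add, ← Real.exp_add, hN, Real.exp_le_exp]
      have he := abs_le.1 (Real.abs_exp_sub_one_sub_id_le (x := h) (by rw [abs_of_pos hh]; exact hh1))
      have he0 : 0 ≤ Real.exp h - 1 := by linarith [Real.add_one_le_exp h]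
      have e1 : ((m : ℝ) - 1) * (x j * (Real.exp h - 1)) ≤ m * (x j * (h + h ^ 2)) := by
        refine mul_le_mul (by linarith) ?_ (mul_nonneg hx0 he0) hm0.le
        exact mul_le_mul_of_nonneg_left (by linarith) hx0
      have e2 : x j * (h + h ^ 2) ≤ (c j + ρ / 4) * h + h ^ 2 := by nlinarith
      have e3 : m * (x j * (h + h ^ 2)) ≤ m * ((c j + ρ / 4) * h + h ^ 2) :=
        mul_le_mul_of_nonneg_left e2 hm0.le
      nlinarith
    · refine (mul_le_mul_of_nonneg_left (multinomialExp_exp_le hx hx1 j (-h))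
        (Real.exp_pos _).le).trans ?_
      rw [← Real.exp_add, ← Real.exp_add, hN, Real.exp_le_exp]
      have he := abs_le.1 (Real.abs_exp_sub_one_sub_id_le (x := -h)
        (by rw [abs_neg, abs_of_pos hh]; exact hh1))
      have hm1 : (0 : ℝ) ≤ m - 1 := by rw [← hN]; positivity
      have e1 : ((m : ℝ) - 1) * (x j * (Real.exp (-h) - 1)) ≤ (m - 1) * (x j * (-h + h ^ 2)) := by
        refine mul_le_mul_of_nonneg_left ?_ hm1
        exact mul_le_mul_of_nonneg_left (by nlinarith) hx0
      have e2 : x j * (-h + h ^ 2) ≤ -(c j - ρ / 4) * h + h ^ 2 := by nlinarith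
      have e3 : m * (x j * (-h + h ^ 2)) ≤ m * (-(c j - ρ / 4) * h + h ^ 2) :=
        mul_le_mul_of_nonneg_left e2 hm0.le
      -- In the lower tail, passing from `m - 1` to `m` trials costs at most one in the exponent;
      -- hence the factor `Real.exp 1`.
      have e4 : x j * (h - h ^ 2) ≤ 1 := by nlinarith
      nlinarith
  refine (Finset.sum_le_sum fun j _ => hterm j).trans (le_of_eq ?_)
  rw [Finset.sum_const, Finset.card_univ, Fintype.card_fin, nsmul_eq_mul]
  ring

/-- The multinomial distribution gives superpolynomially small mass to indices far from the limit of
the evaluation points. -/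
theorem tendsto_pow_mul_multinomialExp_farIndicator {J : Finset (Fin d)} {ι : Type*} {l : Filter ι}
    {m : ι → ℕ} {lam : ι → Fin d → ℝ} {lam₀ y : Fin d → ℝ} (hm : Tendsto m l atTop)
    (hlam : Tendsto lam l (𝓝 lam₀)) (hlam0 : ∀ᶠ i in l, ∀ j ∈ J, 0 ≤ lam i j)
    (hy : ∀ j ∉ J, 0 < y j) (hy1 : ∑ j ∈ Jᶜ, y j < 1) {ρ : ℝ} (hρ : 0 < ρ) (p : ℕ) :
    Tendsto (fun i => (m i : ℝ) ^ p * multinomialExp (m i - 1) (nearPoint J (lam i) y (m i))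
      (farIndicator (m i) (facePoint J y) ρ)) l (𝓝 0) := by
  have hmR : Tendsto (fun i => (m i : ℝ)) l atTop := tendsto_natCast_atTop_atTop.comp hm
  set h := min 1 (ρ / 4) with hh
  have hh0 : 0 < h := lt_min one_pos (by linarith)
  have hb : Tendsto (fun i => (2 * d * Real.exp 1) * ((m i : ℝ) ^ (p : ℝ)
      * Real.exp (-(ρ * h / 2) * m i))) l (𝓝 0) := by
    have := (tendsto_rpow_mul_exp_neg_mul_atTop_nhds_zero (p : ℝ) (ρ * h / 2) (by positivity)).comp hmR
    simpa using this.const_mul (2 * d * Real.exp 1)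
  have hx := tendsto_nearPoint (J := J) (y := y) hm hlam
  have hclose : ∀ᶠ i in l, ∀ j, |nearPoint J (lam i) y (m i) j - facePoint J y j| ≤ ρ / 4 := by
    refine eventually_all.2 fun j => ?_
    have := ((tendsto_pi_nhds.1 hx j).sub_const (facePoint J y j)).abs
    rw [sub_self, abs_zero] at this
    exact this.eventually_le_const (by linarith)
  refine squeeze_zero' ?_ ?_ hb
  · filter_upwards [eventually_nearPoint hm hlam hlam0 hy hy1] with i hi
    refine mul_nonneg (by positivity) (Finset.sum_nonneg fun k _ => ?_)
    exact mul_nonneg (multinomialProb_nonneg _ _ hi.1 (by linarith [hi.2])) (farIndicator_nonneg _ _ _ _)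
  · filter_upwards [eventually_nearPoint hm hlam hlam0 hy hy1, hclose, hm.eventually_gt_atTop 0]
      with i hi hc hm0
    have := multinomialExp_farIndicator_le hm0 hi.1 (by linarith [hi.2]) hh0 (min_le_left _ _)
      (min_le_right _ _) hc
    rw [Real.rpow_natCast]
    refine (mul_le_mul_of_nonneg_left this (by positivity)).trans (le_of_eq ?_)
    ring

end Tail

variable {d : ℕ}

/-! ### Cells and cell means. -/

section Cell

theorem cell_eq_pi (m : ℕ) (k : Fin d → ℕ) :
    cell m k = Set.univ.pi fun i => Set.Ioc ((k i : ℝ) / m) (((k i : ℝ) + 1) / m) := by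
  ext z
  simp [cell]

theorem measurableSet_cell (m : ℕ) (k : Fin d → ℕ) : MeasurableSet (cell m k) := by
  rw [cell_eq_pi]
  exact MeasurableSet.univ_pi fun _ => measurableSet_Ioc

theorem volume_cell_lt_top (m : ℕ) (k : Fin d → ℕ) : volume (cell m k) < ⊤ := by
  rw [cell_eq_pi, volume_pi_pi]
  exact ENNReal.prod_lt_top fun _ _ => measure_Ioc_lt_top

theorem pow_mul_setIntegral_cell_prod {m : ℕ} (k : Fin d → ℕ) (g : Fin d → ℝ → ℝ) :
    (m : ℝ) ^ d * ∫ z in cell m k, ∏ j, g j (z j)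
      = ∏ j, (m * ∫ t in ((k j : ℝ) / m)..(((k j : ℝ) + 1) / m), g j t) := by
  rw [cell_eq_pi, volume_pi, Measure.restrict_pi_pi, integral_fintype_prod_eq_prod,
    Finset.prod_mul_distrib, Finset.prod_const, Finset.card_univ, Fintype.card_fin]
  congr 1
  refine Finset.prod_congr rfl fun j _ => ?_
  rw [intervalIntegral.integral_of_le]
  exact div_le_div_of_nonneg_right (by linarith) (Nat.cast_nonneg m)

theorem pow_mul_volume_cell {m : ℕ} (hm : 0 < m) (k : Fin d → ℕ) :
    (m : ℝ) ^ d * volume.real (cell m k) = 1 := by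
  have hm0 : (m : ℝ) ≠ 0 := by positivity
  have h := pow_mul_setIntegral_cell_prod (m := m) k (fun _ _ => (1 : ℝ))
  simp only [Finset.prod_const_one, setIntegral_const, smul_eq_mul, mul_one,
    intervalIntegral.integral_const] at h
  rw [h]
  refine Finset.prod_eq_one fun j _ => ?_
  field_simp
  ring

theorem eq_of_mem_cell {m : ℕ} {k l : Fin d → ℕ} {z : Fin d → ℝ} (hk : z ∈ cell m k)
    (hl : z ∈ cell m l) : k = l := by
  -- For `m = 0` division by zero makes the cell condition read `0 < z i ≤ 0`, which is
  -- contradictory.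
  rcases Nat.eq_zero_or_pos m with rfl | hm
  · ext i
    have := hk i
    simp at this
    linarith
  have hm0 : (0 : ℝ) < m := by exact_mod_cast hm
  ext i
  obtain ⟨h1, h2⟩ := hk i
  obtain ⟨h3, h4⟩ := hl i
  have a1 : (k i : ℝ) < l i + 1 := (div_lt_div_iff_of_pos_right hm0).1 (h1.trans_le h4)
  have a2 : (l i : ℝ) < k i + 1 := (div_lt_div_iff_of_pos_right hm0).1 (h3.trans_le h2)
  have b1 : k i < l i + 1 := by exact_mod_cast a1
  have b2 : l i < k i + 1 := by exact_mod_cast a2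
  omega

/-- By disjointness at most one term is nonzero, so cross terms vanish. This reduces the second
moment of one observation's weight to a sum of squares of multinomial probabilities. -/
theorem sum_indicator_cell_sq (m : ℕ) (s : Finset (Fin d → ℕ)) (c : (Fin d → ℕ) → ℝ)
    (z : Fin d → ℝ) :
    (∑ k ∈ s, c k * (cell m k).indicator (fun _ => (1 : ℝ)) z) ^ 2
      = ∑ k ∈ s, c k ^ 2 * (cell m k).indicator (fun _ => (1 : ℝ)) z := by
  by_cases h : ∃ k ∈ s, z ∈ cell m k
  · obtain ⟨k, hks, hk⟩ := h
    have hz : ∀ l ∈ s, l ≠ k → (cell m l).indicator (fun _ => (1 : ℝ)) z = 0 := fun l _ hl =>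
      Set.indicator_of_notMem (fun hzl => hl (eq_of_mem_cell hzl hk)) _
    rw [Finset.sum_eq_single_of_mem k hks fun l hl hlk => by rw [hz l hl hlk, mul_zero],
      Finset.sum_eq_single_of_mem k hks fun l hl hlk => by rw [hz l hl hlk, mul_zero],
      Set.indicator_of_mem hk]
    ring
  · push Not at h
    rw [Finset.sum_eq_zero fun l hl => by rw [Set.indicator_of_notMem (h l hl), mul_zero],
      Finset.sum_eq_zero fun l hl => by rw [Set.indicator_of_notMem (h l hl), mul_zero]]
    ring

/-- The mean of a function over a cell. -/
noncomputable def cellMean (g : (Fin d → ℝ) → ℝ) (m : ℕ) (k : Fin d → ℕ) : ℝ :=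
  (m : ℝ) ^ d * ∫ z in cell m k, g z

theorem abs_cellMean_sub_le {g h : (Fin d → ℝ) → ℝ} {m : ℕ} (hm : 0 < m) {k : Fin d → ℕ} {δ : ℝ}
    (hg : IntegrableOn g (cell m k)) (hh : IntegrableOn h (cell m k))
    (hgh : ∀ z ∈ cell m k, |g z - h z| ≤ δ) :
    |cellMean g m k - cellMean h m k| ≤ δ := by
  have h1 := norm_setIntegral_le_of_norm_le_const (f := fun z => g z - h z)
    (volume_cell_lt_top m k) hgh
  rw [integral_sub hg hh, Real.norm_eq_abs] at h1
  have hmd : (0 : ℝ) < (m : ℝ) ^ d := by positivity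
  rw [cellMean, cellMean, ← mul_sub, abs_mul, abs_of_pos hmd]
  calc _ ≤ (m : ℝ) ^ d * (δ * volume.real (cell m k)) := mul_le_mul_of_nonneg_left h1 hmd.le
    _ = δ * ((m : ℝ) ^ d * volume.real (cell m k)) := by ring
    _ = δ := by rw [pow_mul_volume_cell hm, mul_one]

theorem cellMean_const {m : ℕ} (hm : 0 < m) (k : Fin d → ℕ) (c : ℝ) :
    cellMean (fun _ => c) m k = c := by
  rw [cellMean, setIntegral_const, smul_eq_mul, ← mul_assoc, pow_mul_volume_cell hm, one_mul]

theorem integrableOn_cell_const (m : ℕ) (k : Fin d → ℕ) (c : ℝ) :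
    IntegrableOn (fun _ => c) (cell m k) :=
  integrableOn_const (volume_cell_lt_top m k).ne

theorem integrableOn_cell_of_bounded {g : (Fin d → ℝ) → ℝ} (hg : Measurable g) {M : ℝ}
    (hM : ∀ z, |g z| ≤ M) (m : ℕ) (k : Fin d → ℕ) : IntegrableOn g (cell m k) :=
  (integrableOn_cell_const m k M).mono' hg.aestronglyMeasurable (ae_of_all _ hM)

theorem abs_cellMean_sub_const_le {g : (Fin d → ℝ) → ℝ} {m : ℕ} (hm : 0 < m) {k : Fin d → ℕ}
    {c δ : ℝ} (hg : IntegrableOn g (cell m k)) (hgc : ∀ z ∈ cell m k, |g z - c| ≤ δ) :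
    |cellMean g m k - c| ≤ δ := by
  have := abs_cellMean_sub_le hm hg (integrableOn_cell_const m k c) hgc
  rwa [cellMean_const hm] at this

theorem cellMean_nonneg {g : (Fin d → ℝ) → ℝ} (hg : ∀ z, 0 ≤ g z) (m : ℕ) (k : Fin d → ℕ) :
    0 ≤ cellMean g m k :=
  mul_nonneg (by positivity) (integral_nonneg hg)

theorem cellMean_le {g : (Fin d → ℝ) → ℝ} (hg : Measurable g) (hg0 : ∀ z, 0 ≤ g z) {M : ℝ}
    (hM : ∀ z, g z ≤ M) {m : ℕ} (hm : 0 < m) (k : Fin d → ℕ) : cellMean g m k ≤ M := by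
  have hint := integrableOn_cell_of_bounded hg (M := M)
    (fun z => by rw [abs_of_nonneg (hg0 z)]; exact hM z) m k
  have h := abs_cellMean_sub_const_le hm hint (c := 0) (δ := M)
    (fun z _ => by rw [sub_zero, abs_of_nonneg (hg0 z)]; exact hM z)
  rw [sub_zero] at h
  exact (le_abs_self _).trans h

end Cell

/-! ### Bias–variance decomposition. -/

section Moments

variable {Ω : Type*} [MeasurableSpace Ω] {P : Measure Ω} [IsProbabilityMeasure P]

/-- Bias-variance decomposition for the mean of independent variables with common first two
moments. -/
theorem integral_sq_mean_sub {Y : ℕ → Ω → ℝ} (hY : ∀ i, MemLp (Y i) 2 P)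
    (hindep : Pairwise fun i j => IndepFun (Y i) (Y j) P) {μ s : ℝ}
    (hμ : ∀ i, ∫ ω, Y i ω ∂P = μ) (hs : ∀ i, ∫ ω, Y i ω ^ 2 ∂P = s) {n : ℕ} (hn : 0 < n) (c : ℝ) :
    ∫ ω, ((n : ℝ)⁻¹ * ∑ i ∈ Finset.range n, Y i ω - c) ^ 2 ∂P
      = (n : ℝ)⁻¹ * (s - μ ^ 2) + (μ - c) ^ 2 := by
  have hn0 : (n : ℝ) ≠ 0 := by positivity
  have hvar : ∀ i, variance (Y i) P = s - μ ^ 2 := by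
    intro i
    rw [variance_eq_sub (hY i), hμ]
    simp only [Pi.pow_apply, hs]
  set S : Ω → ℝ := ∑ i ∈ Finset.range n, Y i with hS
  have hSL : MemLp S 2 P := memLp_finsetSum' _ fun i _ => hY i
  have hSvar : variance S P = n * (s - μ ^ 2) := by
    rw [hS, IndepFun.variance_sum (fun i _ => hY i) fun i _ j _ hij => hindep hij,
      Finset.sum_congr rfl fun i _ => hvar i, Finset.sum_const, Finset.card_range, nsmul_eq_mul]
  have hSmean : ∫ ω, S ω ∂P = n * μ := by
    simp only [hS, Finset.sum_apply]
    rw [integral_finsetSum _ fun i _ => (hY i).integrable (by norm_num),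
      Finset.sum_congr rfl fun i _ => hμ i, Finset.sum_const, Finset.card_range, nsmul_eq_mul]
  set Z : Ω → ℝ := fun ω => (n : ℝ)⁻¹ * S ω with hZ
  have hZL : MemLp Z 2 P := hSL.const_mul _
  have hZmean : ∫ ω, Z ω ∂P = μ := by
    rw [hZ, integral_const_mul, hSmean, inv_mul_cancel_left₀ hn0]
  have hZvar : variance Z P = (n : ℝ)⁻¹ * (s - μ ^ 2) := by
    rw [hZ, variance_const_mul, hSvar]
    field_simp
  have hZc : variance (fun ω => Z ω - c) P = variance Z P :=
    variance_sub_const hZL.aestronglyMeasurable c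
  have hL : MemLp (fun ω => Z ω - c) 2 P := hZL.sub (memLp_const c)
  have hfin := variance_eq_sub hL
  have hmean : ∫ ω, (Z ω - c) ∂P = μ - c := by
    rw [integral_sub (hZL.integrable (by norm_num)) (integrable_const c), hZmean]
    simp
  rw [hmean, hZc, hZvar] at hfin
  have : ∀ ω, (n : ℝ)⁻¹ * ∑ i ∈ Finset.range n, Y i ω - c = Z ω - c := fun ω => by
    simp [hZ, hS]
  simp_rw [this]
  have h2 : ∫ ω, (Z ω - c) ^ 2 ∂P = ∫ ω, ((fun ω => Z ω - c) ^ 2) ω ∂P := rfl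
  rw [h2]
  linarith

end Moments

/-- The expectation of the estimator. -/
noncomputable def estMean (f : (Fin d → ℝ) → ℝ) (m : ℕ) (x : Fin d → ℝ) : ℝ :=
  multinomialExp (m - 1) x (cellMean f m)

/-- The variance of the estimator for a single observation. -/
noncomputable def estVar (f : (Fin d → ℝ) → ℝ) (m : ℕ) (x : Fin d → ℝ) : ℝ :=
  (m : ℝ) ^ d * ∑ k ∈ latticeSimplex d (m - 1), cellMean f m k * multinomialProb (m - 1) k x ^ 2
    - estMean f m x ^ 2

/-- After exchanging the two sums the estimator is the empirical mean of the independent variables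
`W (X i)`. The identity is exact for every `m` and `x`; only the later limits need `x` in the
simplex. -/
theorem mse_eq {f : (Fin d → ℝ) → ℝ} (hf_nonneg : ∀ x, 0 ≤ f x) (hfm : Measurable f) {M : ℝ}
    (hM : ∀ x, f x ≤ M) {Ω : Type*} [MeasurableSpace Ω] {P : Measure Ω} [IsProbabilityMeasure P]
    {X : ℕ → Ω → Fin d → ℝ} (hX_meas : ∀ i, Measurable (X i)) (hX_indep : iIndepFun X P)
    (hX_law : ∀ i, P.map (X i) = volume.withDensity fun x => ENNReal.ofReal (f x))
    {n : ℕ} (hn : 0 < n) (m : ℕ) (x : Fin d → ℝ) :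
    mse P X f n m x = (n : ℝ)⁻¹ * estVar f m x + (estMean f m x - f x) ^ 2 := by
  set c : (Fin d → ℕ) → ℝ := fun k => (m : ℝ) ^ d * multinomialProb (m - 1) k x with hc
  set W : (Fin d → ℝ) → ℝ := fun z => ∑ k ∈ latticeSimplex d (m - 1),
    c k * (cell m k).indicator (fun _ => (1 : ℝ)) z with hW
  have hind : ∀ k, Measurable ((cell m k).indicator (fun _ => (1 : ℝ)) : (Fin d → ℝ) → ℝ) :=
    fun k => measurable_const.indicator (measurableSet_cell m k)
  have hWm : Measurable W := Finset.measurable_sum _ fun k _ => (hind k).const_mul _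
  have hind1 : ∀ k (z : Fin d → ℝ), ‖(cell m k).indicator (fun _ => (1 : ℝ)) z‖ ≤ 1 := fun k z =>
    (norm_indicator_le_norm_self _ _).trans (by simp)
  have hWb : ∀ z, ‖W z‖ ≤ ∑ k ∈ latticeSimplex d (m - 1), |c k| := fun z => by
    refine (norm_sum_le _ _).trans (Finset.sum_le_sum fun k _ => ?_)
    rw [norm_mul]
    exact mul_le_of_le_one_right (norm_nonneg _) (hind1 k z)
  have hcell : ∀ i k, ∫ ω, (cell m k).indicator (fun _ => (1 : ℝ)) (X i ω) ∂P
      = ∫ z in cell m k, f z := by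
    intro i k
    rw [← integral_map (hX_meas i).aemeasurable (hind k).aestronglyMeasurable,
      integral_indicator (measurableSet_cell m k), setIntegral_const, smul_eq_mul, mul_one,
      measureReal_def, hX_law, withDensity_apply _ (measurableSet_cell m k),
      ← ofReal_integral_eq_lintegral_ofReal (integrableOn_cell_of_bounded hfm (M := M)
        (fun z => by rw [abs_of_nonneg (hf_nonneg z)]; exact hM z) m k) (ae_of_all _ hf_nonneg),
      ENNReal.toReal_ofReal (integral_nonneg hf_nonneg)]
  have hcint : ∀ i k, Integrable (fun ω => (cell m k).indicator (fun _ => (1 : ℝ)) (X i ω)) P :=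
    fun i k => Integrable.of_bound ((hind k).comp (hX_meas i)).aestronglyMeasurable 1
      (ae_of_all _ fun ω => hind1 k _)
  have hL2 : ∀ i, MemLp (fun ω => W (X i ω)) 2 P := fun i =>
    MemLp.of_bound (hWm.comp (hX_meas i)).aestronglyMeasurable _ (ae_of_all _ fun ω => hWb _)
  have hpair : Pairwise fun i j => IndepFun (fun ω => W (X i ω)) (fun ω => W (X j ω)) P :=
    fun i j hij => (hX_indep.indepFun hij).comp hWm hWm
  have hmean : ∀ i, ∫ ω, W (X i ω) ∂P = estMean f m x := by
    intro i
    simp only [hW]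
    rw [integral_finsetSum _ fun k _ => (hcint i k).const_mul _, estMean, multinomialExp]
    refine Finset.sum_congr rfl fun k _ => ?_
    rw [integral_const_mul, hcell, hc, cellMean, smul_eq_mul]
    ring
  have hsq : ∀ i, ∫ ω, W (X i ω) ^ 2 ∂P = (m : ℝ) ^ d * ∑ k ∈ latticeSimplex d (m - 1),
      cellMean f m k * multinomialProb (m - 1) k x ^ 2 := by
    intro i
    simp only [hW, sum_indicator_cell_sq]
    rw [integral_finsetSum _ fun k _ => (hcint i k).const_mul _, Finset.mul_sum]
    refine Finset.sum_congr rfl fun k _ => ?_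
    rw [integral_const_mul, hcell, hc, cellMean]
    ring
  have hest : ∀ ω, densityEstimator n m (fun i => X i ω) x
      = (n : ℝ)⁻¹ * ∑ i ∈ Finset.range n, W (X i ω) := by
    intro ω
    simp only [densityEstimator, hW, hc]
    rw [Finset.sum_comm, Finset.mul_sum]
    refine Finset.sum_congr rfl fun k _ => ?_
    rw [← Finset.mul_sum]
    ring
  simp only [mse, hest]
  rw [integral_sq_mean_sub hL2 hpair hmean hsq hn, estVar]

variable {d : ℕ}

/-! ### Geometry of the simplex. -/

section Simplex

theorem isClosed_simplex (d : ℕ) : IsClosed (simplex d) := by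
  have : simplex d = (⋂ i, {x | 0 ≤ x i}) ∩ {x | ∑ i, x i ≤ 1} := by
    ext x; simp [simplex]
  rw [this]
  refine (isClosed_iInter fun i => isClosed_le continuous_const (continuous_apply i)).inter
    (isClosed_le (by fun_prop) continuous_const)

theorem le_one_of_mem_simplex {x : Fin d → ℝ} (hx : x ∈ simplex d) (i : Fin d) : x i ≤ 1 :=
  (Finset.single_le_sum (fun j _ => hx.1 j) (Finset.mem_univ i)).trans hx.2

theorem isCompact_simplex (d : ℕ) : IsCompact (simplex d) := by
  refine (isCompact_univ_pi fun _ : Fin d => isCompact_Icc (a := (0 : ℝ)) (b := 1)).of_isClosed_subset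
    (isClosed_simplex d) fun x hx i _ => ⟨hx.1 i, le_one_of_mem_simplex hx i⟩

theorem convex_simplex (d : ℕ) : Convex ℝ (simplex d) := by
  intro x hx z hz a b ha hb hab
  refine ⟨fun i => ?_, ?_⟩
  · simp only [Pi.add_apply, Pi.smul_apply, smul_eq_mul]
    exact add_nonneg (mul_nonneg ha (hx.1 i)) (mul_nonneg hb (hz.1 i))
  · simp only [Pi.add_apply, Pi.smul_apply, smul_eq_mul, Finset.sum_add_distrib, ← Finset.mul_sum]
    nlinarith [hx.2, hz.2]

theorem facePoint_mem_simplex (J : Finset (Fin d)) {z : Fin d → ℝ} (hz : z ∈ simplex d) :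
    facePoint J z ∈ simplex d := by
  have h : ∀ i, 0 ≤ facePoint J z i ∧ facePoint J z i ≤ z i := fun i => by
    unfold facePoint
    split_ifs
    exacts [⟨le_rfl, hz.1 i⟩, ⟨hz.1 i, le_rfl⟩]
  exact ⟨fun i => (h i).1, (Finset.sum_le_sum fun i _ => (h i).2).trans hz.2⟩

theorem measurable_of_continuousOn_simplex {f : (Fin d → ℝ) → ℝ}
    (hf_supp : ∀ x, x ∉ simplex d → f x = 0) (hf : ContinuousOn f (simplex d)) : Measurable f := by
  classical
  have h : f = (simplex d).piecewise f 0 := by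
    ext x
    by_cases hx : x ∈ simplex d
    · simp [hx]
    · simp [hx, hf_supp x hx]
  rw [h]
  exact hf.measurable_piecewise continuousOn_const (isClosed_simplex d).measurableSet

theorem exists_bound_of_continuousOn_simplex {f : (Fin d → ℝ) → ℝ}
    (hf_supp : ∀ x, x ∉ simplex d → f x = 0) (hf : ContinuousOn f (simplex d)) :
    ∃ M, 0 < M ∧ ∀ x, |f x| ≤ M := by
  obtain ⟨C, hC⟩ := (isCompact_simplex d).exists_bound_of_continuousOn hf
  refine ⟨max C 1, by positivity, fun x => ?_⟩
  by_cases hx : x ∈ simplex d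
  · exact (hC x hx).trans (le_max_left _ _)
  · rw [hf_supp x hx, abs_zero]; positivity

end Simplex

/-! ### Taylor expansion from the face. -/

section Taylor

variable {f fext : (Fin d → ℝ) → ℝ} {U : Set (Fin d → ℝ)} {J : Finset (Fin d)}

theorem fderiv_eq_zero_of_partialDeriv {g : (Fin d → ℝ) → ℝ} {x : Fin d → ℝ}
    (h : ∀ i, partialDeriv g i x = 0) : fderiv ℝ g x = 0 := by
  ext v
  have hv : v = ∑ i, v i • (Pi.single i (1 : ℝ) : Fin d → ℝ) := by
    ext j
    simp [Finset.sum_apply, Pi.single_apply]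
  rw [hv, map_sum]
  simp only [map_smul]
  refine Finset.sum_eq_zero fun i _ => ?_
  have := h i
  unfold partialDeriv at this
  rw [this, smul_zero]

theorem differentiableAt_of_mem (hU : IsOpen U) (hfext : ContDiffOn ℝ 2 fext U) {x : Fin d → ℝ}
    (hx : x ∈ U) : DifferentiableAt ℝ fext x :=
  (hfext.contDiffAt (hU.mem_nhds hx)).differentiableAt (by norm_num)

/-- Strictness matters: it compares the gradients at two points that both move near `x`, as the base
point of the expansion does in `taylor_face`. -/
theorem hasStrictFDerivAt_fderiv (hU : IsOpen U) (hfext : ContDiffOn ℝ 2 fext U) {x : Fin d → ℝ}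
    (hx : x ∈ U) : HasStrictFDerivAt (fderiv ℝ fext) (fderiv ℝ (fderiv ℝ fext) x) x :=
  ((hfext.contDiffAt (hU.mem_nhds hx)).fderiv_right (m := 1) (by norm_num)).hasStrictFDerivAt
    (by norm_num)

theorem secondPartialDeriv_eq (hU : IsOpen U) (hfext : ContDiffOn ℝ 2 fext U) {x : Fin d → ℝ}
    (hx : x ∈ U) (i j : Fin d) :
    secondPartialDeriv fext i j x
      = fderiv ℝ (fderiv ℝ fext) x (Pi.single i 1) (Pi.single j 1) := by
  have h := (hasStrictFDerivAt_fderiv hU hfext hx).hasFDerivAt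
  have h2 := (h.clm_apply (hasFDerivAt_const (Pi.single j (1 : ℝ) : Fin d → ℝ) x)).fderiv
  simp only [secondPartialDeriv]
  unfold partialDeriv
  rw [h2]
  simp

theorem secondPartialDeriv_comm (hU : IsOpen U) (hfext : ContDiffOn ℝ 2 fext U) {x : Fin d → ℝ}
    (hx : x ∈ U) (i j : Fin d) :
    secondPartialDeriv fext i j x = secondPartialDeriv fext j i x := by
  rw [secondPartialDeriv_eq hU hfext hx, secondPartialDeriv_eq hU hfext hx]
  exact ((hfext.contDiffAt (hU.mem_nhds hx)).isSymmSndFDerivAt (by simp)).eq _ _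

theorem hasDerivAt_comp_segment (hU : IsOpen U) (hfext : ContDiffOn ℝ 2 fext U)
    {a w : Fin d → ℝ} {s : ℝ} (h : a + s • w ∈ U) :
    HasDerivAt (fun s : ℝ => fext (a + s • w)) (fderiv ℝ fext (a + s • w) w) s := by
  have h1 : HasDerivAt (fun s : ℝ => a + s • w) w s := by
    simpa using ((hasDerivAt_id s).smul_const w).const_add a
  exact (differentiableAt_of_mem hU hfext h).hasFDerivAt.comp_hasDerivAt s h1

/-- The extension is constant on the face on which its gradient vanishes. -/
theorem eq_of_face (hU : IsOpen U) (hSU : simplex d ⊆ U) (hfext : ContDiffOn ℝ 2 fext U)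
    (h_shoulder : ∀ x ∈ simplex d, (∀ i ∈ J, x i = 0) → ∀ i, partialDeriv fext i x = 0)
    {a b : Fin d → ℝ} (ha : a ∈ simplex d) (hb : b ∈ simplex d) (ha0 : ∀ i ∈ J, a i = 0)
    (hb0 : ∀ i ∈ J, b i = 0) : fext b = fext a := by
  have hseg : ∀ s ∈ Set.Icc (0 : ℝ) 1, a + s • (b - a) ∈ simplex d := by
    intro s hs
    have := convex_simplex d ha hb (by linarith [hs.2] : 0 ≤ 1 - s) hs.1 (by ring)
    convert this using 1
    module
  -- The segment between two points of the face stays in the face, where the gradient vanishes; the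
  -- mean value inequality applies with constant zero.
  have h := norm_image_sub_le_of_norm_deriv_le_segment_01' (C := 0)
    (f := fun s : ℝ => fext (a + s • (b - a)))
    (fun s hs => (hasDerivAt_comp_segment hU hfext (hSU (hseg s hs))).hasDerivWithinAt)
    (fun s hs => by
      have hs' : s ∈ Set.Icc (0 : ℝ) 1 := ⟨hs.1, hs.2.le⟩
      rw [fderiv_eq_zero_of_partialDeriv (h_shoulder _ (hseg s hs') fun i hi => by
        simp [ha0 i hi, hb0 i hi])]
      simp)
  simp only [one_smul, zero_smul, add_zero, norm_le_zero_iff, sub_eq_zero] at h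
  rw [← h]
  congr 1
  abel

theorem facePoint_mem_simplex_of {y : Fin d → ℝ} (hy : ∀ j ∉ J, 0 < y j)
    (hy1 : ∑ j ∈ Jᶜ, y j < 1) : facePoint J y ∈ simplex d := by
  refine ⟨fun i => ?_, by rw [sum_facePoint]; exact hy1.le⟩
  unfold facePoint
  split_ifs with h
  exacts [le_rfl, (hy i h).le]

theorem facePoint_eq_zero (y : Fin d → ℝ) : ∀ i ∈ J, facePoint J y i = 0 := fun _ hi => if_pos hi

/-- The second derivative at a relative interior point of the face vanishes along the face. -/
theorem secondPartialDeriv_eq_zero (hU : IsOpen U) (hSU : simplex d ⊆ U)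
    (hfext : ContDiffOn ℝ 2 fext U)
    (h_shoulder : ∀ x ∈ simplex d, (∀ i ∈ J, x i = 0) → ∀ i, partialDeriv fext i x = 0)
    {y : Fin d → ℝ} (hy : ∀ j ∉ J, 0 < y j) (hy1 : ∑ j ∈ Jᶜ, y j < 1) {i : Fin d} (hi : i ∉ J)
    (j : Fin d) : secondPartialDeriv fext i j (facePoint J y) = 0 := by
  have hx := facePoint_mem_simplex_of hy hy1
  set x := facePoint J y with hxdef
  set e : Fin d → ℝ := Pi.single i 1 with he
  rw [secondPartialDeriv_eq hU hfext (hSU hx)]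
  have h1 : HasDerivAt (fun s : ℝ => x + s • e) e 0 := by
    simpa using ((hasDerivAt_id (0 : ℝ)).smul_const e).const_add x
  have hD := (hasStrictFDerivAt_fderiv hU hfext (hSU hx)).hasFDerivAt
  have h0 : x + (0 : ℝ) • e = x := by simp
  have h2 : HasDerivAt (fun s : ℝ => fderiv ℝ fext (x + s • e))
      (fderiv ℝ (fderiv ℝ fext) x e) 0 := by
    refine HasFDerivAt.comp_hasDerivAt (0 : ℝ) ?_ h1
    rwa [h0]
  -- A small move in a direction `i ∉ J` stays on the face and in the simplex, because `y i > 0` and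
  -- the sum of the `y j` is below one. The gradient is therefore locally zero along this line, and
  -- so is its derivative.
  have hev : (fun s : ℝ => fderiv ℝ fext (x + s • e)) =ᶠ[𝓝 0] fun _ => 0 := by
    have hyi := hy i hi
    have hnb : Set.Ioo (-(y i)) (1 - ∑ j ∈ Jᶜ, y j) ∈ 𝓝 (0 : ℝ) :=
      Ioo_mem_nhds (by linarith) (by linarith)
    filter_upwards [hnb] with s hs
    refine fderiv_eq_zero_of_partialDeriv (h_shoulder _ ⟨fun l => ?_, ?_⟩ fun l hl => ?_)
    · by_cases hl : l = i
      · subst hl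
        simp only [Pi.add_apply, Pi.smul_apply, he, Pi.single_eq_same, smul_eq_mul, mul_one, hxdef,
          facePoint, if_neg hi]
        linarith [hs.1]
      · simpa [he, hl] using hx.1 l
    · simp only [Pi.add_apply, Pi.smul_apply, smul_eq_mul, Finset.sum_add_distrib, ← Finset.mul_sum]
      rw [hxdef, sum_facePoint, he, Finset.sum_pi_single', if_pos (Finset.mem_univ i)]
      linarith [hs.2]
    · have hl' : l ≠ i := fun h => hi (h ▸ hl)
      simp [he, hl', hxdef, facePoint, hl]
  have h3 := (hasDerivAt_const (0 : ℝ) (0 : (Fin d → ℝ) →L[ℝ] ℝ)).congr_of_eventuallyEq hev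
  rw [h2.unique h3]
  simp

/-- The quadratic form of the second derivatives in the directions of `J`. -/
noncomputable def faceQuadratic (g : (Fin d → ℝ) → ℝ) (J : Finset (Fin d)) (x z : Fin d → ℝ) : ℝ :=
  ∑ i ∈ J, ∑ j ∈ J, secondPartialDeriv g i j x / 2 * (z i * z j)

/-- Second order Taylor expansion at a point of the face. -/
theorem taylor_face (hU : IsOpen U) (hSU : simplex d ⊆ U) (hfext : ContDiffOn ℝ 2 fext U)
    (hfeq : Set.EqOn fext f (simplex d))
    (h_shoulder : ∀ x ∈ simplex d, (∀ i ∈ J, x i = 0) → ∀ i, partialDeriv fext i x = 0)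
    {y : Fin d → ℝ} (hy : ∀ j ∉ J, 0 < y j) (hy1 : ∑ j ∈ Jᶜ, y j < 1) {δ : ℝ} (hδ : 0 < δ) :
    ∃ ρ > 0, ∀ z ∈ simplex d, (∀ j, |z j - facePoint J y j| < ρ) →
      |f z - (f (facePoint J y) + faceQuadratic fext J (facePoint J y) z)|
        ≤ δ * ∑ j ∈ J, z j ^ 2 := by
  have hx := facePoint_mem_simplex_of hy hy1
  have hx0 := facePoint_eq_zero (J := J) y
  set x := facePoint J y with hxdef
  set H := fderiv ℝ (fderiv ℝ fext) x with hH
  have hstrict := (hasStrictFDerivAt_fderiv hU hfext (hSU hx)).isLittleO.def hδ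
  obtain ⟨ρ, hρ, hball⟩ := Metric.eventually_nhds_iff_ball.1 hstrict
  refine ⟨ρ, hρ, fun z hz hzx => ?_⟩
  -- The expansion starts from the projection `z'` of `z` onto the face and not from `x`. At `z'`
  -- the value is `f x` and the gradient is zero, and `w = z - z'` has only coordinates in `J`, so
  -- the error involves only these.
  have hz' := facePoint_mem_simplex J hz
  set z' := facePoint J z with hz'def
  set w := z - z' with hw
  have hzball : z ∈ Metric.ball x ρ := by
    rw [Metric.mem_ball, dist_pi_lt_iff hρ]
    exact fun j => by rw [Real.dist_eq]; exact hzx j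
  have hz'ball : z' ∈ Metric.ball x ρ := by
    rw [Metric.mem_ball, dist_pi_lt_iff hρ]
    intro j
    rw [Real.dist_eq]
    by_cases hj : j ∈ J
    · simp only [hz'def, hxdef, facePoint, if_pos hj, sub_self, abs_zero]; exact hρ
    · have := hzx j
      simp only [hz'def, hxdef, facePoint, if_neg hj] at this ⊢
      exact this
  have hsegS : ∀ s ∈ Set.Icc (0 : ℝ) 1, z' + s • w ∈ simplex d := by
    intro s hs
    have := convex_simplex d hz' hz (by linarith [hs.2] : 0 ≤ 1 - s) hs.1 (by ring)
    convert this using 1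
    rw [hw]; module
  have hsegB : ∀ s ∈ Set.Icc (0 : ℝ) 1, z' + s • w ∈ Metric.ball x ρ := by
    intro s hs
    have := convex_ball x ρ hz'ball hzball (by linarith [hs.2] : 0 ≤ 1 - s) hs.1 (by ring)
    convert this using 1
    rw [hw]; module
  have hD0 : fderiv ℝ fext z' = 0 := fderiv_eq_zero_of_partialDeriv
    (h_shoulder _ hz' (facePoint_eq_zero z))
  -- Mean value inequality along the segment for the remainder after the quadratic term taken with
  -- the Hessian at `x`. Its derivative is bounded through strict differentiability applied to the
  -- pair `(z' + s • w, z')`.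
  have hmain := norm_image_sub_le_of_norm_deriv_le_segment_01' (C := δ * ‖w‖ ^ 2)
    (f := fun s : ℝ => fext (z' + s • w) - s ^ 2 * (H w w / 2))
    (f' := fun s : ℝ => fderiv ℝ fext (z' + s • w) w - 2 * s * (H w w / 2))
    (fun s hs => by
      have h1 := hasDerivAt_comp_segment hU hfext (hSU (hsegS s hs))
      have h2 : HasDerivAt (fun s : ℝ => s ^ 2 * (H w w / 2)) (2 * s * (H w w / 2)) s := by
        simpa using (hasDerivAt_pow 2 s).mul_const (H w w / 2)
      exact (h1.sub h2).hasDerivWithinAt)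
    (fun s hs => by
      have hs' : s ∈ Set.Icc (0 : ℝ) 1 := ⟨hs.1, hs.2.le⟩
      have hmem : (z' + s • w, z') ∈ Metric.ball (x, x) ρ := by
        rw [← ball_prod_same]
        exact ⟨hsegB s hs', hz'ball⟩
      have h3 := hball _ hmem
      simp only [hD0, sub_zero, add_sub_cancel_left] at h3
      have h4 : fderiv ℝ fext (z' + s • w) w - 2 * s * (H w w / 2)
          = (fderiv ℝ fext (z' + s • w) - H (s • w)) w := by
        simp only [map_smul, _root_.sub_apply, _root_.smul_apply,
          smul_eq_mul]
        ring
      rw [h4]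
      refine (ContinuousLinearMap.le_opNorm _ _).trans ?_
      refine (mul_le_mul_of_nonneg_right h3 (norm_nonneg _)).trans ?_
      rw [norm_smul, Real.norm_of_nonneg hs.1]
      have : s * ‖w‖ ≤ 1 * ‖w‖ := mul_le_mul_of_nonneg_right hs.2.le (norm_nonneg _)
      nlinarith [mul_nonneg hδ.le (norm_nonneg w),
        mul_le_mul_of_nonneg_left this (mul_nonneg hδ.le (norm_nonneg w))])
  have hzw : z' + w = z := by rw [hw]; abel
  have hfz' : fext z' = f x := by
    rw [eq_of_face hU hSU hfext h_shoulder hx hz' hx0 (facePoint_eq_zero z), hfeq hx]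
  have hwi : ∀ i ∈ J, w i = z i := fun i hi => by
    simp [hw, hz'def, facePoint, hi]
  have hwi0 : ∀ i ∉ J, w i = 0 := fun i hi => by
    simp [hw, hz'def, facePoint, hi]
  have hQ : H w w / 2 = faceQuadratic fext J x z := by
    have hv : w = ∑ i ∈ J, z i • (Pi.single i (1 : ℝ) : Fin d → ℝ) := by
      ext j
      by_cases hj : j ∈ J
      · simp [Finset.sum_apply, Pi.single_apply, hwi j hj, hj]
      · simp [Finset.sum_apply, Pi.single_apply, hwi0 j hj, hj]
    have : H w w = ∑ i ∈ J, ∑ j ∈ J, z i * (z j * secondPartialDeriv fext i j x) := by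
      rw [hv]
      simp only [map_sum, map_smul, _root_.sum_apply, _root_.smul_apply,
        smul_eq_mul, Finset.mul_sum, secondPartialDeriv_eq hU hfext (hSU hx), hH]
      exact Finset.sum_comm.trans (Finset.sum_congr rfl fun i _ => Finset.sum_congr rfl fun j _ => by
        ring)
    rw [this, faceQuadratic, Finset.sum_div]
    refine Finset.sum_congr rfl fun i _ => ?_
    rw [Finset.sum_div]
    exact Finset.sum_congr rfl fun j _ => by ring
  have hnorm : ‖w‖ ^ 2 ≤ ∑ j ∈ J, z j ^ 2 := by
    have hS : 0 ≤ ∑ j ∈ J, z j ^ 2 := Finset.sum_nonneg fun j _ => sq_nonneg _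
    rw [← Real.le_sqrt (norm_nonneg _) hS, pi_norm_le_iff_of_nonneg (Real.sqrt_nonneg _)]
    intro j
    by_cases hj : j ∈ J
    · rw [hwi j hj]
      refine Real.abs_le_sqrt ?_
      exact Finset.single_le_sum (f := fun j => z j ^ 2) (fun j _ => sq_nonneg _) hj
    · rw [hwi0 j hj, norm_zero]; exact Real.sqrt_nonneg _
  simp only [one_smul, zero_smul, add_zero, hzw, hQ, hfz', one_pow, one_mul, ne_eq,
    OfNat.ofNat_ne_zero, not_false_eq_true, zero_pow, zero_mul, sub_zero] at hmain
  rw [hfeq hz, Real.norm_eq_abs] at hmain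
  calc _ = |f z - faceQuadratic fext J x z - f x| := by congr 1; ring
    _ ≤ _ := hmain.trans (mul_le_mul_of_nonneg_left hnorm hδ.le)

end Taylor

variable {d : ℕ}

/-! ### Cell means of quadratic polynomials. -/

section CellQuadratic

theorem integrableOn_cell_of_continuous {g : (Fin d → ℝ) → ℝ} (hg : Continuous g) (m : ℕ)
    (k : Fin d → ℕ) : IntegrableOn g (cell m k) := by
  have hK : IsCompact (Set.univ.pi fun i : Fin d => Set.Icc ((k i : ℝ) / m) (((k i : ℝ) + 1) / m)) :=
    isCompact_univ_pi fun _ => isCompact_Icc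
  refine (hg.continuousOn.integrableOn_compact hK).mono_set ?_
  rw [cell_eq_pi]
  exact Set.pi_mono fun _ _ => Set.Ioc_subset_Icc_self

/-- `m²` times the mean of `z_i z_j` over the cell of index `k`. -/
noncomputable def cellMoment (i j : Fin d) (k : Fin d → ℕ) : ℝ :=
  if i = j then (k i : ℝ) * k j + k i + 1 / 3 else (k i : ℝ) * k j + (k i + k j) / 2 + 1 / 4

theorem cellMean_mul {m : ℕ} (hm : 0 < m) (i j : Fin d) (k : Fin d → ℕ) :
    cellMean (fun z => z i * z j) m k = cellMoment i j k / (m : ℝ) ^ 2 := by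
  have hm0 : (m : ℝ) ≠ 0 := by positivity
  -- Adding the two indicator exponents writes `z i * z j` as a product over all coordinates in both
  -- cases, with exponent `2` when `i = j`.
  have h := pow_mul_setIntegral_cell_prod (m := m) k
    (fun l t => t ^ ((if i = l then 1 else 0) + (if j = l then 1 else 0)))
  have h1 : ∀ z : Fin d → ℝ, ∏ l, z l ^ ((if i = l then 1 else 0) + (if j = l then 1 else 0))
      = z i * z j := by
    intro z
    simp only [pow_add, Finset.prod_mul_distrib, Finset.prod_pow_boole, Finset.mem_univ, if_true]
  have h_zero : ∀ a : ℝ, m * ∫ t in (a / m)..((a + 1) / m), t ^ 0 = 1 := fun a => by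
    rw [integral_pow]; push_cast; field_simp; ring
  have h_one : ∀ a : ℝ, m * ∫ t in (a / m)..((a + 1) / m), t ^ 1 = (a + 1 / 2) / m := fun a => by
    rw [integral_pow]; push_cast; field_simp; ring
  have h_two : ∀ a : ℝ, m * ∫ t in (a / m)..((a + 1) / m), t ^ 2 = (a * a + a + 1 / 3) / (m : ℝ) ^ 2 :=
    fun a => by rw [integral_pow]; push_cast; field_simp; ring
  simp only [h1] at h
  rw [cellMean, h, cellMoment]
  by_cases hij : i = j
  · subst hij
    rw [if_pos rfl, Finset.prod_eq_single i]
    · rw [if_pos rfl, h_two]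
    · intro l _ hl
      rw [if_neg (Ne.symm hl), h_zero]
    · simp
  · rw [if_neg hij, Finset.prod_eq_mul i j hij]
    · rw [if_pos rfl, if_pos rfl, if_neg hij, if_neg (Ne.symm hij), h_one, h_one]
      field_simp
      ring
    · rintro l _ ⟨hl1, hl2⟩
      rw [if_neg (Ne.symm hl1), if_neg (Ne.symm hl2), h_zero]
    · simp
    · simp

theorem cellMean_const_add_faceQuadratic {m : ℕ} (hm : 0 < m) (g : (Fin d → ℝ) → ℝ)
    (J : Finset (Fin d)) (x : Fin d → ℝ) (c : ℝ) (k : Fin d → ℕ) :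
    cellMean (fun z => c + faceQuadratic g J x z) m k
      = c + ∑ i ∈ J, ∑ j ∈ J, secondPartialDeriv g i j x / 2 * (cellMoment i j k / (m : ℝ) ^ 2) := by
  have hint : ∀ i j : Fin d, IntegrableOn (fun z : Fin d → ℝ =>
      secondPartialDeriv g i j x / 2 * (z i * z j)) (cell m k) := fun i j =>
    integrableOn_cell_of_continuous (by fun_prop) m k
  have hsum : IntegrableOn (fun z : Fin d → ℝ => faceQuadratic g J x z) (cell m k) :=
    integrable_finsetSum _ fun i _ => integrable_finsetSum _ fun j _ => hint i j
  rw [cellMean, integral_add (integrableOn_cell_const m k c) hsum, mul_add]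
  have h1 := cellMean_const hm k c
  rw [cellMean] at h1
  rw [h1]
  congr 1
  simp only [faceQuadratic]
  rw [integral_finsetSum _ fun i _ => integrable_finsetSum _ fun j _ => hint i j, Finset.mul_sum]
  refine Finset.sum_congr rfl fun i _ => ?_
  rw [integral_finsetSum _ fun j _ => hint i j, Finset.mul_sum]
  refine Finset.sum_congr rfl fun j _ => ?_
  have h2 := cellMean_mul hm i j k
  rw [cellMean] at h2
  rw [integral_const_mul, ← h2]
  ring

end CellQuadratic

/-! ### Asymptotics of the bias. -/

section Bias

variable {f fext : (Fin d → ℝ) → ℝ} {U : Set (Fin d → ℝ)} {J : Finset (Fin d)}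

/-- The second bias bracket only involves pairs of indices in `J`. -/
theorem biasBracket_eq (hU : IsOpen U) (hSU : simplex d ⊆ U) (hfext : ContDiffOn ℝ 2 fext U)
    (h_shoulder : ∀ x ∈ simplex d, (∀ i ∈ J, x i = 0) → ∀ i, partialDeriv fext i x = 0)
    {y : Fin d → ℝ} (hy : ∀ j ∉ J, 0 < y j) (hy1 : ∑ j ∈ Jᶜ, y j < 1) (lam : Fin d → ℝ) :
    biasBracket fext J lam y = ∑ i ∈ J, ∑ j ∈ J, secondPartialDeriv fext i j (facePoint J y) / 2
      * (if i = j then 2 * lam i + 1 / 3 else (lam i + lam j) / 2 + 1 / 4) := by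
  have hx := facePoint_mem_simplex_of hy hy1
  have hz := fun i hi => secondPartialDeriv_eq_zero hU hSU hfext h_shoulder hy hy1 (i := i) hi
  have hsymm := secondPartialDeriv_comm hU hfext (hSU hx)
  set x := facePoint J y
  set c : Fin d → Fin d → ℝ := fun i j => if i = j then 1 / 6 + lam i else 1 / 8 + lam j / 2 with hc
  have h1 : biasBracket fext J lam y = ∑ i ∈ J, ∑ j ∈ J, c i j * secondPartialDeriv fext i j x := by
    rw [biasBracket, ← Finset.sum_product']
    symm
    refine Finset.sum_subset (fun p hp => ?_) fun p _ hp => ?_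
    · rw [Finset.mem_product] at hp
      simp [hp.1]
    · rw [Finset.mem_product, not_and_or] at hp
      rcases hp with hp | hp
      · rw [hz _ hp, mul_zero]
      · rw [hsymm, hz _ hp, mul_zero]
  -- The weight `1/8 + λ_j/2` is not symmetric, but the Hessian is; averaging the sum with its
  -- transpose gives the symmetric weight of the statement.
  have h2 : ∑ i ∈ J, ∑ j ∈ J, c i j * secondPartialDeriv fext i j x
      = ∑ i ∈ J, ∑ j ∈ J, c j i * secondPartialDeriv fext i j x := by
    rw [Finset.sum_comm]
    exact Finset.sum_congr rfl fun i _ => Finset.sum_congr rfl fun j _ => by rw [hsymm]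
  have h3 : biasBracket fext J lam y
      = (∑ i ∈ J, ∑ j ∈ J, c i j * secondPartialDeriv fext i j x
        + ∑ i ∈ J, ∑ j ∈ J, c j i * secondPartialDeriv fext i j x) / 2 := by
    rw [← h2, h1]; ring
  rw [h3, ← Finset.sum_add_distrib, Finset.sum_div]
  refine Finset.sum_congr rfl fun i _ => ?_
  rw [← Finset.sum_add_distrib, Finset.sum_div]
  refine Finset.sum_congr rfl fun j _ => ?_
  simp only [hc]
  by_cases hij : i = j
  · subst hij; simp; ring
  · rw [if_neg hij, if_neg hij, if_neg (Ne.symm hij)]; ring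

/-- On `J` the product term tends to `λ_i λ_j` and cancels against the quadratic form at the
evaluation point; the remaining terms are what the bias bracket retains. -/
theorem multinomialExp_cellMoment (N : ℕ) (x : Fin d → ℝ) (i j : Fin d) :
    multinomialExp N x (cellMoment i j)
      = N * (N - 1) * (x i * x j) + if i = j then 2 * (N * x i) + 1 / 3
        else (N * x i + N * x j) / 2 + 1 / 4 := by
  by_cases hij : i = j
  · subst hij
    have : cellMoment i i = fun k => ((k i : ℝ) * k i + k i) + 1 / 3 := by
      ext k; simp [cellMoment]
    rw [this, multinomialExp_add, multinomialExp_add, multinomialExp_apply_mul_apply,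
      multinomialExp_apply, multinomialExp_const, if_pos rfl, if_pos rfl]
    ring
  · have : cellMoment i j = fun k => ((k i : ℝ) * k j + (1 / 2 * (k i : ℝ) + 1 / 2 * (k j : ℝ)))
        + 1 / 4 := by
      ext k; simp [cellMoment, hij]; ring
    rw [this, multinomialExp_add, multinomialExp_add, multinomialExp_add,
      multinomialExp_apply_mul_apply, multinomialExp_const_mul, multinomialExp_const_mul,
      multinomialExp_apply, multinomialExp_apply, multinomialExp_const, if_neg hij, if_neg hij]
    ring

theorem nearPoint_apply_mem {i : Fin d} (hi : i ∈ J) (lam y : Fin d → ℝ) (m : ℕ) :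
    nearPoint J lam y m i = lam i / m := if_pos hi

/-- The shifts `a = 0, 1, 2` correspond to `m`, to `N = m - 1` and to `N - 1`. -/
theorem tendsto_mul_nearPoint {i : Fin d} (hi : i ∈ J) (lam y : Fin d → ℝ) (a : ℕ) :
    Tendsto (fun m : ℕ => ((m : ℝ) - a) * nearPoint J lam y m i) atTop (𝓝 (lam i)) := by
  have hinv : Tendsto (fun m : ℕ => (m : ℝ)⁻¹) atTop (𝓝 0) := tendsto_inv_atTop_nhds_zero_nat
  have h := (tendsto_const_nhds (x := (1 : ℝ))).sub (hinv.const_mul (a : ℝ))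
  have h2 := h.mul_const (lam i)
  rw [mul_zero, sub_zero, one_mul] at h2
  refine h2.congr' ?_
  filter_upwards [eventually_gt_atTop 0] with m hm
  have hm0 : (m : ℝ) ≠ 0 := by positivity
  rw [nearPoint_apply_mem hi]
  field_simp

/-- The bias of the quadratic Taylor polynomial. -/
theorem tendsto_bias_taylor (hU : IsOpen U) (hSU : simplex d ⊆ U) (hfext : ContDiffOn ℝ 2 fext U)
    (h_shoulder : ∀ x ∈ simplex d, (∀ i ∈ J, x i = 0) → ∀ i, partialDeriv fext i x = 0)
    {y : Fin d → ℝ} (hy : ∀ j ∉ J, 0 < y j) (hy1 : ∑ j ∈ Jᶜ, y j < 1) (lam : Fin d → ℝ) (c : ℝ) :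
    Tendsto (fun m : ℕ => (m : ℝ) ^ 2 *
      (estMean (fun z => c + faceQuadratic fext J (facePoint J y) z) m (nearPoint J lam y m)
        - (c + faceQuadratic fext J (facePoint J y) (nearPoint J lam y m)))) atTop
      (𝓝 (biasBracket fext J lam y)) := by
  set x := facePoint J y
  have hlim : ∀ i ∈ J, ∀ j ∈ J, Tendsto (fun m : ℕ =>
      multinomialExp (m - 1) (nearPoint J lam y m) (cellMoment i j)
        - (m * nearPoint J lam y m i) * (m * nearPoint J lam y m j)) atTop
      (𝓝 (if i = j then 2 * lam i + 1 / 3 else (lam i + lam j) / 2 + 1 / 4)) := by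
    intro i hi j hj
    have h0 : ∀ i ∈ J, Tendsto (fun m : ℕ => (m : ℝ) * nearPoint J lam y m i) atTop
        (𝓝 (lam i)) := fun i hi => by simpa using tendsto_mul_nearPoint hi lam y 0
    have h1 := fun i hi => tendsto_mul_nearPoint (J := J) (i := i) hi lam y 1
    have h2 := tendsto_mul_nearPoint hj lam y 2
    have hq := ((h1 i hi).mul h2).sub ((h0 i hi).mul (h0 j hj))
    rw [sub_self] at hq
    have hN : ∀ m : ℕ, 1 ≤ m → ((m - 1 : ℕ) : ℝ) = m - 1 := fun m hm => by
      rw [Nat.cast_sub hm, Nat.cast_one]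
    by_cases hij : i = j
    · have := hq.add (((h1 i hi).const_mul 2).add_const (1 / 3))
      rw [zero_add] at this
      rw [if_pos hij]
      refine this.congr' ?_
      filter_upwards [eventually_ge_atTop 1] with m hm
      rw [multinomialExp_cellMoment, if_pos hij, hN m hm]
      push_cast
      ring
    · have := hq.add ((((h1 i hi).add (h1 j hj)).div_const 2).add_const (1 / 4))
      rw [zero_add] at this
      rw [if_neg hij]
      refine this.congr' ?_
      filter_upwards [eventually_ge_atTop 1] with m hm
      rw [multinomialExp_cellMoment, if_neg hij, hN m hm]
      push_cast
      ring
  rw [biasBracket_eq hU hSU hfext h_shoulder hy hy1 lam]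
  have := tendsto_finsetSum J fun i hi => tendsto_finsetSum J fun j hj =>
    (hlim i hi j hj).const_mul (secondPartialDeriv fext i j x / 2)
  refine this.congr' ?_
  filter_upwards [eventually_gt_atTop 0] with m hm
  have hm0 : (m : ℝ) ≠ 0 := by positivity
  have hcm : cellMean (fun z => c + faceQuadratic fext J x z) m = fun k => c + ∑ i ∈ J, ∑ j ∈ J,
      secondPartialDeriv fext i j x / 2 / (m : ℝ) ^ 2 * cellMoment i j k := by
    ext k
    rw [cellMean_const_add_faceQuadratic hm]
    congr 1
    exact Finset.sum_congr rfl fun i _ => Finset.sum_congr rfl fun j _ => by ring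
  rw [estMean, hcm, multinomialExp_add, multinomialExp_const, multinomialExp_sum, faceQuadratic,
    add_sub_add_left_eq_sub, ← Finset.sum_sub_distrib, Finset.mul_sum]
  refine Finset.sum_congr rfl fun i _ => ?_
  rw [multinomialExp_sum, ← Finset.sum_sub_distrib, Finset.mul_sum]
  refine Finset.sum_congr rfl fun j _ => ?_
  rw [multinomialExp_const_mul]
  field_simp

/-- In the cell of index `k` one has `z_j ≤ (k_j + 1)/m`, so this bounds `m²` times the mean Taylor
remainder uniformly in `m` when `m x_j = λ_j`. -/
theorem multinomialExp_succ_sq_le {N m : ℕ} (hNm : N ≤ m) {x : Fin d → ℝ} {j : Fin d} {a : ℝ}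
    (ha : 0 ≤ x j) (hx : m * x j = a) :
    multinomialExp N x (fun k => ((k j : ℝ) + 1) ^ 2) ≤ a ^ 2 + 3 * a + 1 := by
  have h : (fun k : Fin d → ℕ => ((k j : ℝ) + 1) ^ 2)
      = fun k => ((k j : ℝ) * k j + 2 * (k j : ℝ)) + 1 := by ext k; ring
  rw [h, multinomialExp_add, multinomialExp_add, multinomialExp_apply_mul_apply,
    multinomialExp_const_mul, multinomialExp_apply, multinomialExp_const, if_pos rfl]
  have hN : (N : ℝ) ≤ m := by exact_mod_cast hNm
  have h1 : N * x j ≤ a := hx ▸ mul_le_mul_of_nonneg_right hN ha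
  have h0 : 0 ≤ N * x j := by positivity
  nlinarith

theorem abs_faceQuadratic_le (g : (Fin d → ℝ) → ℝ) (J : Finset (Fin d)) (x : Fin d → ℝ)
    {z : Fin d → ℝ} (hz : ∀ i, |z i| ≤ 1) :
    |faceQuadratic g J x z| ≤ ∑ i ∈ J, ∑ j ∈ J, |secondPartialDeriv g i j x / 2| := by
  refine (Finset.abs_sum_le_sum_abs _ _).trans (Finset.sum_le_sum fun i _ => ?_)
  refine (Finset.abs_sum_le_sum_abs _ _).trans (Finset.sum_le_sum fun j _ => ?_)
  rw [abs_mul, abs_mul]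
  refine mul_le_of_le_one_right (abs_nonneg _) ?_
  exact mul_le_one₀ (hz i) (abs_nonneg _) (hz j)

theorem mem_cell_bounds {m : ℕ} (hm : 0 < m) {k : Fin d → ℕ} (hk : k ∈ latticeSimplex d (m - 1))
    {z : Fin d → ℝ} (hz : z ∈ cell m k) (j : Fin d) : 0 < z j ∧ z j ≤ 1 := by
  have hm0 : (0 : ℝ) < m := by exact_mod_cast hm
  refine ⟨lt_of_le_of_lt (by positivity) (hz j).1, (hz j).2.trans ?_⟩
  rw [div_le_one hm0]
  have h1 := Finset.single_le_sum (f := k) (fun _ _ => Nat.zero_le _) (Finset.mem_univ j)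
  have h2 := mem_latticeSimplex.1 hk
  have : k j + 1 ≤ m := by omega
  exact_mod_cast this

/-- A cell whose index is near a point `c` lies near `c`. -/
theorem mem_cell_near {m : ℕ} (hm : 0 < m) {k : Fin d → ℕ} {c : Fin d → ℝ} {ρ : ℝ}
    (hmρ : 2 / ρ < m) (hρ : 0 < ρ) (hk : ∀ j, |(k j : ℝ) / m - c j| < ρ / 2) {z : Fin d → ℝ}
    (hz : z ∈ cell m k) (j : Fin d) : |z j - c j| < ρ := by
  have hm0 : (0 : ℝ) < m := by exact_mod_cast hm
  have h1 := abs_lt.1 (hk j)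
  obtain ⟨h2, h3⟩ := hz j
  rw [add_div] at h3
  have h4 : 1 / (m : ℝ) < ρ / 2 := by
    rw [div_lt_div_iff₀ hm0 two_pos]
    rw [div_lt_iff₀ hρ] at hmρ
    linarith
  rw [abs_lt]
  constructor <;> linarith

/-- Nearness to the face point secures the constraint on the sum, which has slack `1 - ∑ y_j` there.
Membership is needed because the Taylor bound says nothing off the simplex, where `f` is zero. -/
theorem mem_simplex_of_near {y : Fin d → ℝ} {ρ : ℝ} (hρ : d * ρ ≤ 1 - ∑ j ∈ Jᶜ, y j)
    {z : Fin d → ℝ} (hz0 : ∀ j, 0 ≤ z j) (hz : ∀ j, |z j - facePoint J y j| < ρ) :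
    z ∈ simplex d := by
  refine ⟨hz0, ?_⟩
  calc ∑ j, z j ≤ ∑ j, (facePoint J y j + ρ) :=
        Finset.sum_le_sum fun j _ => by linarith [(abs_lt.1 (hz j)).2]
    _ ≤ 1 := by
      rw [Finset.sum_add_distrib, sum_facePoint, Finset.sum_const, Finset.card_univ,
        Fintype.card_fin, nsmul_eq_mul]
      linarith

/-- The bias of the estimator near the face. -/
theorem tendsto_bias (hf_supp : ∀ x, x ∉ simplex d → f x = 0)
    (hU : IsOpen U) (hSU : simplex d ⊆ U) (hfext : ContDiffOn ℝ 2 fext U)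
    (hfeq : Set.EqOn fext f (simplex d))
    (h_shoulder : ∀ x ∈ simplex d, (∀ i ∈ J, x i = 0) → ∀ i, partialDeriv fext i x = 0)
    {lam y : Fin d → ℝ} (hlam : ∀ i ∈ J, 0 ≤ lam i) (hy : ∀ j ∉ J, 0 < y j)
    (hy1 : ∑ j ∈ Jᶜ, y j < 1) :
    Tendsto (fun m : ℕ => (m : ℝ) ^ 2 *
      (estMean f m (nearPoint J lam y m) - f (nearPoint J lam y m))) atTop
      (𝓝 (biasBracket fext J lam y)) := by
  have hfc : ContinuousOn f (simplex d) :=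
    (hfext.continuousOn.mono hSU).congr fun x hx => (hfeq hx).symm
  have hfm := measurable_of_continuousOn_simplex hf_supp hfc
  obtain ⟨M, hM0, hM⟩ := exists_bound_of_continuousOn_simplex hf_supp hfc
  set x₀ := facePoint J y with hx₀
  set T : (Fin d → ℝ) → ℝ := fun z => f x₀ + faceQuadratic fext J x₀ z with hT
  have hTc : Continuous T := by
    simp only [hT]; unfold faceQuadratic; fun_prop
  set x := fun m : ℕ => nearPoint J lam y m with hx
  have hmain := tendsto_bias_taylor hU hSU hfext h_shoulder hy hy1 lam (f x₀)
  -- Replacing `f` by its Taylor polynomial costs `o(m⁻²)`: near indices contribute `δ` times a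
  -- bounded multiple of `m⁻²`, far ones a bounded amount times a superpolynomially small mass.
  have hdiff : Tendsto (fun m : ℕ => (m : ℝ) ^ 2 * (estMean f m (x m) - estMean T m (x m))
      - (m : ℝ) ^ 2 * (f (x m) - T (x m))) atTop (𝓝 0) := by
    -- The first sum bounds the mean of the remainder, the second the remainder at the evaluation
    -- point, both scaled by `m²`. With `δ = ε / (2 * (Q + 1))` they use at most `ε/2`; the other
    -- half is left to the far indices.
    set Q := ∑ j ∈ J, (lam j ^ 2 + 3 * lam j + 1) + ∑ j ∈ J, lam j ^ 2 with hQ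
    have hQ0 : 0 ≤ Q := add_nonneg
      (Finset.sum_nonneg fun j hj => by have := hlam j hj; positivity)
      (Finset.sum_nonneg fun j _ => sq_nonneg _)
    set K := M + (M + ∑ i ∈ J, ∑ j ∈ J, |secondPartialDeriv fext i j x₀ / 2|) with hK
    have hK0 : 0 ≤ K := by positivity
    rw [Metric.tendsto_nhds]
    intro ε hε
    set δ := ε / (2 * (Q + 1)) with hδ
    have hδ0 : 0 < δ := by positivity
    clear_value δ
    obtain ⟨ρ₁, hρ₁, htaylor⟩ := taylor_face hU hSU hfext hfeq h_shoulder hy hy1 hδ0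
    -- The second bound gives `d * ρ ≤ 1 - ∑ y_j`, so nonnegative points within `ρ` of the face
    -- point lie in the simplex. Indices are tested at `ρ/2`, which leaves room for the width `1/m`
    -- of a cell.
    set ρ := min ρ₁ ((1 - ∑ j ∈ Jᶜ, y j) / (d + 1)) with hρdef
    have hρ : 0 < ρ := lt_min hρ₁ (div_pos (by linarith) (by positivity))
    have hρd : d * ρ ≤ 1 - ∑ j ∈ Jᶜ, y j := by
      have h1 : ρ * (d + 1) ≤ 1 - ∑ j ∈ Jᶜ, y j := by
        rw [← le_div_iff₀ (by positivity)]; exact min_le_right _ _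
      nlinarith
    have hlam' : ∀ᶠ i in atTop, ∀ j ∈ J, 0 ≤ (fun _ : ℕ => lam) i j := .of_forall fun _ => hlam
    have htail := tendsto_pow_mul_multinomialExp_farIndicator (J := J) (y := y) tendsto_id
      (tendsto_const_nhds (x := lam)) hlam' hy hy1 (half_pos hρ) 2
    have htail' := (htail.const_mul K).eventually_lt_const
      (by rw [mul_zero]; exact half_pos hε)
    have hnear := eventually_nearPoint (J := J) (y := y) tendsto_id
      (tendsto_const_nhds (x := lam)) hlam' hy hy1
    have hxlim := tendsto_nearPoint (J := J) (y := y) tendsto_id (tendsto_const_nhds (x := lam))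
    have hxnear : ∀ᶠ m : ℕ in atTop, ∀ j, |x m j - x₀ j| < ρ := by
      refine eventually_all.2 fun j => ?_
      have := ((tendsto_pi_nhds.1 hxlim j).sub_const (x₀ j)).abs
      rw [sub_self, abs_zero] at this
      exact this.eventually_lt_const hρ
    filter_upwards [htail', hnear, hxnear, eventually_gt_atTop 0,
      tendsto_natCast_atTop_atTop.eventually_gt_atTop (2 / ρ)] with m h1 h2 h3 hm hmρ
    simp only [id] at h1 h2
    obtain ⟨hx0, hxs⟩ := h2
    have hxs1 : ∑ j, x m j ≤ 1 := by linarith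
    have hm0 : (0 : ℝ) < m := by exact_mod_cast hm
    have hcell : ∀ k ∈ latticeSimplex d (m - 1), |cellMean f m k - cellMean T m k|
        ≤ δ / (m : ℝ) ^ 2 * ∑ j ∈ J, ((k j : ℝ) + 1) ^ 2 + K * farIndicator m x₀ (ρ / 2) k := by
      intro k hk
      refine abs_cellMean_sub_le hm (integrableOn_cell_of_bounded hfm hM m k)
        (integrableOn_cell_of_continuous hTc m k) fun z hz => ?_
      have hs0 : 0 ≤ δ / (m : ℝ) ^ 2 * ∑ j ∈ J, ((k j : ℝ) + 1) ^ 2 :=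
        mul_nonneg (by positivity) (Finset.sum_nonneg fun j _ => sq_nonneg _)
      have hzb := mem_cell_bounds hm hk hz
      by_cases hfar : ∀ j, |(k j : ℝ) / m - x₀ j| < ρ / 2
      · have hzn := mem_cell_near hm hmρ hρ hfar hz
        have hzS := mem_simplex_of_near hρd (fun j => (hzb j).1.le) hzn
        have := htaylor z hzS fun j => (hzn j).trans_le (min_le_left _ _)
        refine this.trans (le_trans ?_ (le_add_of_nonneg_right
          (mul_nonneg hK0 (farIndicator_nonneg _ _ _ _))))
        rw [div_mul_eq_mul_div, mul_div_assoc, Finset.sum_div]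
        refine mul_le_mul_of_nonneg_left (Finset.sum_le_sum fun j _ => ?_) hδ0.le
        rw [← div_pow]
        exact pow_le_pow_left₀ (hzb j).1.le (hz j).2 2
      · rw [farIndicator_eq_one hfar, mul_one]
        refine le_trans ?_ (le_add_of_nonneg_left hs0)
        refine (abs_sub _ _).trans (add_le_add (hM z) ((abs_add_le _ _).trans (add_le_add (hM _) ?_)))
        exact abs_faceQuadratic_le _ _ _ fun i => by
          rw [abs_of_pos (hzb i).1]; exact (hzb i).2
    have hE : |estMean f m (x m) - estMean T m (x m)|
        ≤ δ / (m : ℝ) ^ 2 * ∑ j ∈ J, (lam j ^ 2 + 3 * lam j + 1)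
          + K * multinomialExp (m - 1) (x m) (farIndicator m x₀ (ρ / 2)) := by
      rw [estMean, estMean, ← multinomialExp_sub]
      refine (abs_multinomialExp_le hx0 hxs1 _).trans
        ((multinomialExp_mono hx0 hxs1 hcell).trans ?_)
      rw [multinomialExp_add, multinomialExp_const_mul, multinomialExp_const_mul,
        multinomialExp_sum]
      refine add_le_add_left (mul_le_mul_of_nonneg_left (Finset.sum_le_sum fun j hj => ?_)
        (by positivity)) _
      refine multinomialExp_succ_sq_le (Nat.sub_le m 1) (hx0 j) ?_
      rw [nearPoint_apply_mem hj]
      field_simp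
    have hF : |f (x m) - T (x m)| ≤ δ / (m : ℝ) ^ 2 * ∑ j ∈ J, lam j ^ 2 := by
      have := htaylor (x m) ⟨hx0, hxs1⟩ fun j => (h3 j).trans_le (min_le_left _ _)
      refine this.trans (le_of_eq ?_)
      rw [div_mul_eq_mul_div, mul_div_assoc, Finset.sum_div]
      congr 1
      refine Finset.sum_congr rfl fun j hj => ?_
      rw [hx]
      simp only [nearPoint_apply_mem hj, div_pow]
    have hm2 : (0 : ℝ) < (m : ℝ) ^ 2 := by positivity
    rw [Real.dist_eq, sub_zero]
    refine (abs_sub _ _).trans_lt ?_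
    rw [abs_mul, abs_mul, abs_of_pos hm2]
    have e1 := mul_le_mul_of_nonneg_left hE hm2.le
    have e2 := mul_le_mul_of_nonneg_left hF hm2.le
    have e3 : (m : ℝ) ^ 2 * (δ / (m : ℝ) ^ 2 * ∑ j ∈ J, (lam j ^ 2 + 3 * lam j + 1)
          + K * multinomialExp (m - 1) (x m) (farIndicator m x₀ (ρ / 2)))
        + (m : ℝ) ^ 2 * (δ / (m : ℝ) ^ 2 * ∑ j ∈ J, lam j ^ 2)
        = δ * Q + K * ((m : ℝ) ^ 2 * multinomialExp (m - 1) (x m) (farIndicator m x₀ (ρ / 2))) := by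
      rw [hQ]
      field_simp
      ring
    have e4 : δ * Q ≤ ε / 2 := by
      rw [hδ, div_mul_eq_mul_div, div_le_div_iff₀ (by positivity) two_pos]
      nlinarith
    linarith
  have := hdiff.add hmain
  rw [zero_add] at this
  refine this.congr fun m => ?_
  simp only [hT]
  ring

end Bias

variable {d : ℕ}

/-! ### Asymptotics of the variance. -/

section Variance

variable {f : (Fin d → ℝ) → ℝ} {J : Finset (Fin d)}

theorem varianceConst_eq (f : (Fin d → ℝ) → ℝ) (J : Finset (Fin d)) (lam y : Fin d → ℝ) :
    varianceConst f J lam y = f (facePoint J y) * collisionConst J lam y := by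
  rw [varianceConst, collisionConst, mul_assoc]

/-- Since `(d + |J|)/2 + |Jᶜ|/2 = d`, the factor `m^d` splits into the order of the variance and the
scale of the local limit theorem. -/
theorem rpow_mul_sqrt_pow {m : ℕ} (hm : 0 < m) (J : Finset (Fin d)) :
    (m : ℝ) ^ (((d : ℝ) + J.card) / 2) * √(m : ℝ) ^ Jᶜ.card = (m : ℝ) ^ d := by
  have hm0 : (0 : ℝ) < m := by exact_mod_cast hm
  rw [Real.sqrt_eq_rpow, ← Real.rpow_mul_natCast hm0.le, ← Real.rpow_add hm0, ← Real.rpow_natCast]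
  congr 1
  have hc := Finset.card_compl J
  have hle := Finset.card_le_univ J
  rw [Fintype.card_fin] at hc hle
  rw [hc, Nat.cast_sub hle]
  ring

theorem sqrt_pow_le {m : ℕ} (hm : 0 < m) (J : Finset (Fin d)) :
    √(m : ℝ) ^ Jᶜ.card ≤ (m : ℝ) ^ d := by
  have hm1 : (1 : ℝ) ≤ m := by exact_mod_cast hm
  rw [← rpow_mul_sqrt_pow hm J]
  exact le_mul_of_one_le_left (by positivity) (Real.one_le_rpow hm1 (by positivity))

/-- From `0 ≤ P ≤ 1` follows `P² ≤ P`. The bound is crude, but the tails to which it is applied beat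
every power of `m`. -/
theorem sum_mul_sq_le {N : ℕ} {x : Fin d → ℝ} (hx : ∀ i, 0 ≤ x i) (hx1 : ∑ i, x i ≤ 1)
    {g : (Fin d → ℕ) → ℝ} (hg : ∀ k, 0 ≤ g k) :
    ∑ k ∈ latticeSimplex d N, g k * multinomialProb N k x ^ 2 ≤ multinomialExp N x g := by
  refine Finset.sum_le_sum fun k hk => ?_
  have h0 := multinomialProb_nonneg N k hx hx1
  have h1 := multinomialProb_le_one hx hx1 hk
  rw [smul_eq_mul, sq, mul_comm]
  exact mul_le_mul_of_nonneg_right (by nlinarith) (hg k)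

theorem estMean_sq_le (hfm : Measurable f) (hf0 : ∀ z, 0 ≤ f z) {M : ℝ} (hM : ∀ z, |f z| ≤ M)
    {m : ℕ} (hm : 0 < m) {x : Fin d → ℝ} (hx : ∀ i, 0 ≤ x i) (hx1 : ∑ i, x i ≤ 1) :
    estMean f m x ^ 2 ≤ M ^ 2 := by
  have h1 : 0 ≤ estMean f m x := Finset.sum_nonneg fun k _ =>
    mul_nonneg (multinomialProb_nonneg _ _ hx hx1) (cellMean_nonneg hf0 m k)
  have h2 : estMean f m x ≤ M := by
    refine (multinomialExp_mono hx hx1 (h := fun _ => M) fun k _ =>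
      cellMean_le hfm hf0 (fun z => (le_abs_self _).trans (hM z)) hm k).trans_eq ?_
    exact multinomialExp_const _ _ _
  exact pow_le_pow_left₀ h1 h2 2

/-- Three pieces: the collision probability with its limit, the oscillation of the cell means around
`c`, and the squared mean, which is bounded and divided by a positive power of `m`. -/
theorem estVar_div_eq {m : ℕ} (hm : 0 < m) (J : Finset (Fin d)) (x : Fin d → ℝ) (c : ℝ) :
    estVar f m x / (m : ℝ) ^ (((d : ℝ) + J.card) / 2)
      = c * (√(m : ℝ) ^ Jᶜ.card * ∑ k ∈ latticeSimplex d (m - 1), multinomialProb (m - 1) k x ^ 2)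
        + √(m : ℝ) ^ Jᶜ.card * ∑ k ∈ latticeSimplex d (m - 1),
          (cellMean f m k - c) * multinomialProb (m - 1) k x ^ 2
        - estMean f m x ^ 2 / (m : ℝ) ^ (((d : ℝ) + J.card) / 2) := by
  have hm0 : (0 : ℝ) < m := by exact_mod_cast hm
  have he : (0 : ℝ) < (m : ℝ) ^ (((d : ℝ) + J.card) / 2) := Real.rpow_pos_of_pos hm0 _
  rw [estVar, ← rpow_mul_sqrt_pow hm J, sub_div, mul_assoc, mul_div_cancel_left₀ _ he.ne']
  congr 1
  simp only [sub_mul, Finset.sum_sub_distrib, ← Finset.mul_sum]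
  ring

/-- The leading term of the variance near the face, locally uniformly in the parameters. -/
theorem tendsto_estVar (hd : 0 < d) (hf_nonneg : ∀ x, 0 ≤ f x)
    (hf_supp : ∀ x, x ∉ simplex d → f x = 0) (hfc : ContinuousOn f (simplex d))
    {ι : Type*} {l : Filter ι} [l.IsCountablyGenerated] {m : ι → ℕ} {lam : ι → Fin d → ℝ}
    {lam₀ y : Fin d → ℝ} (hm : Tendsto m l atTop) (hlam : Tendsto lam l (𝓝 lam₀))
    (hlam0 : ∀ᶠ i in l, ∀ j ∈ J, 0 ≤ lam i j) (hlam1 : ∀ j ∈ J, 0 ≤ lam₀ j)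
    (hy : ∀ j ∉ J, 0 < y j) (hy1 : ∑ j ∈ Jᶜ, y j < 1) :
    Tendsto (fun i => estVar f (m i) (nearPoint J (lam i) y (m i))
      / (m i : ℝ) ^ (((d : ℝ) + J.card) / 2)) l (𝓝 (varianceConst f J lam₀ y)) := by
  have hfm := measurable_of_continuousOn_simplex hf_supp hfc
  obtain ⟨M, hM0, hM⟩ := exists_bound_of_continuousOn_simplex hf_supp hfc
  have hmR : Tendsto (fun i => (m i : ℝ)) l atTop := tendsto_natCast_atTop_atTop.comp hm
  set x₀ := facePoint J y with hx₀
  set x := fun i => nearPoint J (lam i) y (m i) with hx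
  have hS := tendsto_scaled_sum_multinomialProb_sq hm hlam hlam0 hlam1 hy hy1
  have hnear := eventually_nearPoint hm hlam hlam0 hy hy1
  have hd0 : (0 : ℝ) < d := by exact_mod_cast hd
  have hpow : Tendsto (fun i => (m i : ℝ) ^ (((d : ℝ) + J.card) / 2)) l atTop :=
    (tendsto_rpow_atTop (by positivity)).comp hmR
  have hT3 : Tendsto (fun i => estMean f (m i) (x i) ^ 2 / (m i : ℝ) ^ (((d : ℝ) + J.card) / 2)) l
      (𝓝 0) := by
    refine squeeze_zero' (.of_forall fun i => by positivity) ?_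
      ((tendsto_const_nhds (x := M ^ 2)).div_atTop hpow)
    filter_upwards [hnear, hm.eventually_gt_atTop 0] with i hi hm0
    exact div_le_div_of_nonneg_right (estMean_sq_le hfm hf_nonneg hM hm0 hi.1 (by linarith [hi.2]))
      (by positivity)
  -- Continuity at the face point makes the oscillation at most `δ` on near cells, against a
  -- convergent collision mass; on far cells the tail bound absorbs the factor `m^d`.
  have hT2 : Tendsto (fun i => √(m i : ℝ) ^ Jᶜ.card * ∑ k ∈ latticeSimplex d (m i - 1),
      (cellMean f (m i) k - f x₀) * multinomialProb (m i - 1) k (x i) ^ 2) l (𝓝 0) := by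
    rw [Metric.tendsto_nhds]
    intro ε hε
    set κ := |collisionConst J lam₀ y| + 1 with hκ
    have hκ0 : 0 < κ := by positivity
    set δ := ε / (2 * κ) with hδ
    have hδ0 : 0 < δ := by positivity
    have hx₀S := facePoint_mem_simplex_of hy hy1
    obtain ⟨ρ₁, hρ₁, hcont⟩ := Metric.continuousWithinAt_iff.1 (hfc x₀ hx₀S) δ hδ0
    set ρ := min ρ₁ ((1 - ∑ j ∈ Jᶜ, y j) / (d + 1)) with hρdef
    have hρ : 0 < ρ := lt_min hρ₁ (div_pos (by linarith) (by positivity))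
    have hρd : d * ρ ≤ 1 - ∑ j ∈ Jᶜ, y j := by
      have h1 : ρ * (d + 1) ≤ 1 - ∑ j ∈ Jᶜ, y j := by
        rw [← le_div_iff₀ (by positivity)]; exact min_le_right _ _
      nlinarith
    have htail := tendsto_pow_mul_multinomialExp_farIndicator hm hlam hlam0 hy hy1 (half_pos hρ) d
    have htail' := (htail.const_mul (2 * M)).eventually_lt_const
      (by rw [mul_zero]; exact half_pos hε)
    have hSκ := hS.eventually_lt_const (by
      rw [hκ]; exact (le_abs_self _).trans_lt (lt_add_one _) : collisionConst J lam₀ y < κ)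
    filter_upwards [htail', hSκ, hnear, hm.eventually_gt_atTop 0,
      hmR.eventually_gt_atTop (2 / ρ)] with i h1 h2 h3 hm0 hmρ
    obtain ⟨hx0, hxs⟩ := h3
    have hx1 : ∑ j, x i j ≤ 1 := by linarith
    have hcell : ∀ k ∈ latticeSimplex d (m i - 1), |cellMean f (m i) k - f x₀|
        ≤ δ + 2 * M * farIndicator (m i) x₀ (ρ / 2) k := by
      intro k hk
      refine abs_cellMean_sub_const_le hm0 (integrableOn_cell_of_bounded hfm hM _ k) fun z hz => ?_
      have hzb := mem_cell_bounds hm0 hk hz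
      by_cases hfar : ∀ j, |(k j : ℝ) / m i - x₀ j| < ρ / 2
      · have hzn := mem_cell_near hm0 hmρ hρ hfar hz
        have hzS := mem_simplex_of_near hρd (fun j => (hzb j).1.le) hzn
        have hdist : dist z x₀ < ρ₁ := by
          rw [dist_pi_lt_iff hρ₁]
          exact fun j => (hzn j).trans_le (min_le_left _ _)
        have := (hcont hzS hdist).le
        rw [Real.dist_eq] at this
        exact this.trans (le_add_of_nonneg_right
          (mul_nonneg (by positivity) (farIndicator_nonneg _ _ _ _)))
      · rw [farIndicator_eq_one hfar, mul_one]
        have := abs_sub (f z) (f x₀)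
        linarith [hM z, hM x₀]
    have hsq : √(m i : ℝ) ^ Jᶜ.card * ∑ k ∈ latticeSimplex d (m i - 1),
        (2 * M * farIndicator (m i) x₀ (ρ / 2) k) * multinomialProb (m i - 1) k (x i) ^ 2
        ≤ 2 * M * ((m i : ℝ) ^ d
          * multinomialExp (m i - 1) (x i) (farIndicator (m i) x₀ (ρ / 2))) := by
      have hb := sum_mul_sq_le (N := m i - 1) hx0 hx1 (g := fun k => 2 * M * farIndicator (m i) x₀ (ρ / 2) k)
        fun k => mul_nonneg (by positivity) (farIndicator_nonneg _ _ _ _)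
      rw [multinomialExp_const_mul] at hb
      have hE0 : 0 ≤ multinomialExp (m i - 1) (x i) (farIndicator (m i) x₀ (ρ / 2)) :=
        Finset.sum_nonneg fun k _ => mul_nonneg (multinomialProb_nonneg _ _ hx0 hx1)
          (farIndicator_nonneg _ _ _ _)
      calc _ ≤ √(m i : ℝ) ^ Jᶜ.card * (2 * M
            * multinomialExp (m i - 1) (x i) (farIndicator (m i) x₀ (ρ / 2))) :=
            mul_le_mul_of_nonneg_left hb (by positivity)
        _ ≤ (m i : ℝ) ^ d * (2 * M
            * multinomialExp (m i - 1) (x i) (farIndicator (m i) x₀ (ρ / 2))) :=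
            mul_le_mul_of_nonneg_right (sqrt_pow_le hm0 J) (by positivity)
        _ = _ := by ring
    rw [Real.dist_eq, sub_zero, abs_mul, abs_of_nonneg (by positivity)]
    have hstep : |∑ k ∈ latticeSimplex d (m i - 1),
        (cellMean f (m i) k - f x₀) * multinomialProb (m i - 1) k (x i) ^ 2|
        ≤ ∑ k ∈ latticeSimplex d (m i - 1), (δ * multinomialProb (m i - 1) k (x i) ^ 2
          + (2 * M * farIndicator (m i) x₀ (ρ / 2) k) * multinomialProb (m i - 1) k (x i) ^ 2) := by
      refine (Finset.abs_sum_le_sum_abs _ _).trans (Finset.sum_le_sum fun k hk => ?_)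
      rw [abs_mul, abs_of_nonneg (sq_nonneg (multinomialProb (m i - 1) k (x i))), ← add_mul]
      exact mul_le_mul_of_nonneg_right (hcell k hk) (sq_nonneg _)
    refine (mul_le_mul_of_nonneg_left hstep (by positivity)).trans_lt ?_
    rw [Finset.sum_add_distrib, mul_add, ← Finset.mul_sum]
    have e1 : δ * κ = ε / 2 := by rw [hδ]; field_simp
    have e2 : √(m i : ℝ) ^ Jᶜ.card * (δ * ∑ k ∈ latticeSimplex d (m i - 1),
        multinomialProb (m i - 1) k (x i) ^ 2) ≤ δ * κ := by
      rw [mul_left_comm]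
      exact mul_le_mul_of_nonneg_left h2.le hδ0.le
    linarith
  have := ((hS.const_mul (f x₀)).add hT2).sub hT3
  rw [add_zero, sub_zero, ← varianceConst_eq] at this
  refine this.congr' ?_
  filter_upwards [hm.eventually_gt_atTop 0] with i hi
  rw [estVar_div_eq hi J (x i) (f x₀)]

/-- The rate of convergence of the variance at the vertex. -/
theorem exists_abs_estVar_sub_le (hd : 0 < d) (hf_nonneg : ∀ x, 0 ≤ f x)
    (hf_supp : ∀ x, x ∉ simplex d → f x = 0) (hfc : ContinuousOn f (simplex d))
    {fext : (Fin d → ℝ) → ℝ} (hfeq : Set.EqOn fext f (simplex d))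
    (hdiff : DifferentiableAt ℝ fext 0) {lam : Fin d → ℝ} (hlam : ∀ i, 0 ≤ lam i)
    (y : Fin d → ℝ) :
    ∃ C : ℝ, ∀ᶠ m : ℕ in atTop, |estVar f m (nearPoint Finset.univ lam y m)
      / (m : ℝ) ^ (((d : ℝ) + (Finset.univ : Finset (Fin d)).card) / 2)
      - varianceConst f Finset.univ lam y| ≤ C * (m : ℝ)⁻¹ := by
  have hfm := measurable_of_continuousOn_simplex hf_supp hfc
  obtain ⟨M, hM0, hM⟩ := exists_bound_of_continuousOn_simplex hf_supp hfc
  have h0S : (0 : Fin d → ℝ) ∈ simplex d := ⟨fun i => le_rfl, by simp⟩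
  -- A Lipschitz bound from the vertex on the whole orthant, since cells may leave the simplex. Near
  -- `0` in the simplex it is differentiability of the extension; elsewhere `‖z‖ ≥ ρ` or `∑ z_j >
  -- 1`, and the trivial bound `2M` is absorbed.
  obtain ⟨C₁, hC₁, hLip⟩ : ∃ C₁ : ℝ, 0 ≤ C₁ ∧ ∀ z : Fin d → ℝ, (∀ j, 0 ≤ z j) →
      |f z - f 0| ≤ C₁ * ∑ j, z j := by
    obtain ⟨c, hc⟩ := hdiff.hasFDerivAt.isBigO_sub.bound
    obtain ⟨ρ, hρ, hball⟩ := Metric.eventually_nhds_iff.1 hc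
    refine ⟨|c| + 2 * M / ρ + 2 * M, by positivity, fun z hz => ?_⟩
    have hs0 : 0 ≤ ∑ j, z j := Finset.sum_nonneg fun j _ => hz j
    have hnorm : ‖z‖ ≤ ∑ j, z j := by
      rw [pi_norm_le_iff_of_nonneg hs0]
      intro j
      rw [Real.norm_of_nonneg (hz j)]
      exact Finset.single_le_sum (fun i _ => hz i) (Finset.mem_univ j)
    have htriv : |f z - f 0| ≤ 2 * M := by
      have := abs_sub (f z) (f 0)
      linarith [hM z, hM 0]
    have hc0 : 0 ≤ |c| * ∑ j, z j := by positivity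
    have hM1 : 0 ≤ 2 * M / ρ * ∑ j, z j := by positivity
    have hM2 : 0 ≤ 2 * M * ∑ j, z j := by positivity
    rw [add_mul, add_mul]
    by_cases hzS : z ∈ simplex d
    · by_cases hzρ : ‖z‖ < ρ
      · have := hball (y := z) (by rwa [dist_zero_right])
        rw [hfeq hzS, hfeq h0S, sub_zero, Real.norm_eq_abs] at this
        have h2 : c * ‖z‖ ≤ |c| * ∑ j, z j :=
          mul_le_mul (le_abs_self c) hnorm (norm_nonneg _) (abs_nonneg _)
        linarith
      · have h2 : 2 * M ≤ 2 * M / ρ * ∑ j, z j := by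
          rw [div_mul_eq_mul_div, le_div_iff₀ hρ]
          exact mul_le_mul_of_nonneg_left ((not_lt.1 hzρ).trans hnorm) (by positivity)
        linarith
    · have h1 : 1 < ∑ j, z j := by
        by_contra h
        exact hzS ⟨hz, not_lt.1 h⟩
      nlinarith
  obtain ⟨C₂, hC₂⟩ := exists_abs_sum_multinomialProb_sq_sub_le hlam
  set Λ := ∑ i, lam i with hΛ
  -- The three constants belong to the three pieces of `estVar_div_eq`: the rate of the collision
  -- probability, the Lipschitz bound with the mean of `k_j + 1` at most `λ_j + 1`, and the squared
  -- mean with `m^{-d} ≤ m⁻¹`.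
  refine ⟨|f 0| * C₂ + C₁ * (Λ + d) + M ^ 2, ?_⟩
  have hmR := tendsto_natCast_atTop_atTop (R := ℝ)
  filter_upwards [hC₂, eventually_gt_atTop 0, hmR.eventually_ge_atTop Λ] with m h1 hm hmΛ
  have hm0 : (0 : ℝ) < m := by exact_mod_cast hm
  have hm1 : (1 : ℝ) ≤ m := by exact_mod_cast hm
  set x : Fin d → ℝ := fun i => lam i / m with hx
  have hxnear : nearPoint Finset.univ lam y m = x := by
    ext i; simp [nearPoint, hx]
  have hface : facePoint Finset.univ y = 0 := by
    ext i; simp [facePoint]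
  have hx0 : ∀ i, 0 ≤ x i := fun i => div_nonneg (hlam i) hm0.le
  have hxs : ∑ i, x i = Λ / m := by rw [hx, ← Finset.sum_div]
  have hx1 : ∑ i, x i ≤ 1 := by rw [hxs, div_le_one hm0]; exact hmΛ
  have hcoll : collisionConst Finset.univ lam y
      = ∏ i, (Real.exp (-2 * lam i) * besselI 0 (2 * lam i)) := by
    simp [collisionConst, psi]
  rw [hxnear, estVar_div_eq hm Finset.univ x (f 0), varianceConst_eq, hface, hcoll]
  simp only [Finset.compl_univ, Finset.card_empty, pow_zero, one_mul]
  have hN : ((m - 1 : ℕ) : ℝ) ≤ m := by exact_mod_cast Nat.sub_le m 1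
  have e2 : |∑ k ∈ latticeSimplex d (m - 1), (cellMean f m k - f 0) * multinomialProb (m - 1) k x ^ 2|
      ≤ C₁ * (Λ + d) * (m : ℝ)⁻¹ := by
    have hcell : ∀ k ∈ latticeSimplex d (m - 1), |cellMean f m k - f 0|
        ≤ C₁ * (m : ℝ)⁻¹ * ∑ j, ((k j : ℝ) + 1) := by
      intro k hk
      refine abs_cellMean_sub_const_le hm (integrableOn_cell_of_bounded hfm hM _ k) fun z hz => ?_
      have hzb := mem_cell_bounds hm hk hz
      refine (hLip z fun j => (hzb j).1.le).trans ?_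
      have e : (m : ℝ)⁻¹ * ∑ j, ((k j : ℝ) + 1) = ∑ j, ((k j : ℝ) + 1) / m := by
        rw [Finset.mul_sum]
        exact Finset.sum_congr rfl fun j _ => (div_eq_inv_mul _ _).symm
      rw [mul_assoc, e]
      exact mul_le_mul_of_nonneg_left (Finset.sum_le_sum fun j _ => (hz j).2) hC₁
    calc _ ≤ ∑ k ∈ latticeSimplex d (m - 1), (C₁ * (m : ℝ)⁻¹ * ∑ j, ((k j : ℝ) + 1))
          * multinomialProb (m - 1) k x ^ 2 := by
          refine (Finset.abs_sum_le_sum_abs _ _).trans (Finset.sum_le_sum fun k hk => ?_)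
          rw [abs_mul, abs_of_nonneg (sq_nonneg (multinomialProb (m - 1) k x))]
          exact mul_le_mul_of_nonneg_right (hcell k hk) (sq_nonneg _)
      _ ≤ multinomialExp (m - 1) x fun k => C₁ * (m : ℝ)⁻¹ * ∑ j, ((k j : ℝ) + 1) :=
          sum_mul_sq_le hx0 hx1 fun k => by positivity
      _ = C₁ * (m : ℝ)⁻¹ * ∑ j, (((m - 1 : ℕ) : ℝ) * x j + 1) := by
          rw [multinomialExp_const_mul, multinomialExp_sum]
          congr 1
          refine Finset.sum_congr rfl fun j _ => ?_
          rw [multinomialExp_add, multinomialExp_apply, multinomialExp_const]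
      _ ≤ C₁ * (m : ℝ)⁻¹ * ∑ j, (lam j + 1) := by
          refine mul_le_mul_of_nonneg_left (Finset.sum_le_sum fun j _ => ?_) (by positivity)
          have : ((m - 1 : ℕ) : ℝ) * x j ≤ m * x j := mul_le_mul_of_nonneg_right hN (hx0 j)
          have h2 : (m : ℝ) * x j = lam j := by rw [hx]; field_simp
          linarith
      _ = _ := by
          rw [Finset.sum_add_distrib, Finset.sum_const, Finset.card_univ, Fintype.card_fin]
          simp only [nsmul_eq_mul, mul_one]
          ring
  have e3 : |estMean f m x ^ 2 / (m : ℝ) ^ (((d : ℝ) + (Finset.univ : Finset (Fin d)).card) / 2)|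
      ≤ M ^ 2 * (m : ℝ)⁻¹ := by
    have hexp : (((d : ℝ) + (Finset.univ : Finset (Fin d)).card) / 2) = (d : ℝ) := by
      rw [Finset.card_univ, Fintype.card_fin]; ring
    rw [hexp, Real.rpow_natCast, abs_of_nonneg (by positivity), ← div_eq_mul_inv]
    refine div_le_div₀ (by positivity) (estMean_sq_le hfm hf_nonneg hM hm hx0 hx1) hm0 ?_
    exact le_self_pow₀ hm1 (by omega)
  set S := ∑ k ∈ latticeSimplex d (m - 1), multinomialProb (m - 1) k x ^ 2
  set B := ∏ i, (Real.exp (-2 * lam i) * besselI 0 (2 * lam i))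
  have e1 : |f 0 * S - f 0 * B| ≤ |f 0| * C₂ * (m : ℝ)⁻¹ := by
    rw [← mul_sub, abs_mul, mul_assoc]
    exact mul_le_mul_of_nonneg_left h1 (abs_nonneg _)
  rw [abs_le] at e1 e2 e3 ⊢
  constructor <;> linarith [e1.1, e1.2, e2.1, e2.2, e3.1, e3.2]

end Variance

/-! ### Error rates independent of `lam`. -/

section Uniform

/-- A diagonal sequence dominating a countable family of uniform rates. -/
theorem exists_tendsto_zero_of_uniform {α : Type*} (S : ℕ → Set α) (E : α → ℕ → ℝ)
    (h : ∀ N : ℕ, ∀ δ : ℝ, 0 < δ → ∀ᶠ m in atTop, ∀ a ∈ S N, |E a m| ≤ δ) :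
    ∃ ε : ℕ → ℝ, Tendsto ε atTop (𝓝 0) ∧ ∀ N, ∀ a ∈ S N, ∀ᶠ m in atTop, |E a m| ≤ ε m := by
  have h' : ∀ N : ℕ, ∃ m₀ : ℕ, ∀ m ≥ m₀, ∀ N' ≤ N, ∀ a ∈ S N', |E a m| ≤ 1 / ((N : ℝ) + 1) := by
    intro N
    have : ∀ᶠ m in atTop, ∀ N' ∈ Finset.range (N + 1), ∀ a ∈ S N', |E a m| ≤ 1 / ((N : ℝ) + 1) :=
      (Finset.eventually_all _).2 fun N' _ => h N' _ (by positivity)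
    obtain ⟨m₀, hm₀⟩ := eventually_atTop.1 this
    exact ⟨m₀, fun m hm N' hN' => hm₀ m hm N' (Finset.mem_range.2 (by omega))⟩
  choose m₀ hm₀ using h'
  -- `g m` is the largest level `N ≤ m` whose threshold has been passed. Beyond `m₀ 0` level `0`
  -- qualifies, so the greatest one really satisfies the condition.
  set g : ℕ → ℕ := fun m => Nat.findGreatest (fun N => m₀ N ≤ m) m with hg
  have hgT : Tendsto g atTop atTop := by
    refine tendsto_atTop.2 fun N => ?_
    filter_upwards [eventually_ge_atTop (max N (m₀ N))] with m hm
    exact Nat.le_findGreatest ((le_max_left _ _).trans hm) ((le_max_right _ _).trans hm)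
  refine ⟨fun m => 1 / ((g m : ℝ) + 1), tendsto_one_div_add_atTop_nhds_zero_nat.comp hgT, ?_⟩
  intro N a ha
  filter_upwards [hgT.eventually_ge_atTop N, eventually_ge_atTop (m₀ 0)] with m hm hm'
  refine hm₀ (g m) m ?_ N hm a ha
  exact Nat.findGreatest_spec (P := fun N => m₀ N ≤ m) (Nat.zero_le m) hm'

variable {f : (Fin d → ℝ) → ℝ} {J : Finset (Fin d)}

/-- The integral form of the Bessel factors is continuous in the parameter everywhere, and agrees
with them on the nonnegative orthant. -/
theorem continuousOn_varianceConst (f : (Fin d → ℝ) → ℝ) (J : Finset (Fin d)) (y : Fin d → ℝ) :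
    ContinuousOn (fun lam => varianceConst f J lam y) {lam | ∀ i, 0 ≤ lam i} := by
  have hb : Continuous fun a : ℝ => ∫ t in (-Real.pi)..Real.pi,
      Real.exp (-(2 * a * (1 - Real.cos t))) :=
    intervalIntegral.continuous_parametric_intervalIntegral_of_continuous' (by fun_prop) _ _
  have hc : Continuous fun lam : Fin d → ℝ => f (facePoint J y) * psi Jᶜ y
      * ∏ i ∈ J, ((2 * Real.pi)⁻¹ * ∫ t in (-Real.pi)..Real.pi,
        Real.exp (-(2 * lam i * (1 - Real.cos t)))) := by
    refine continuous_const.mul (continuous_finsetProd _ fun i _ => continuous_const.mul ?_)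
    exact hb.comp (continuous_apply i)
  refine hc.continuousOn.congr fun lam hlam => ?_
  rw [varianceConst]
  congr 1
  refine Finset.prod_congr rfl fun i _ => ?_
  rw [intervalIntegral.integral_of_le (by linarith [Real.pi_pos]),
    integral_exp_one_sub_cos (hlam i), inv_mul_cancel_left₀ (by positivity)]

/-- The variance expansion holds with an error depending only on the coordinates off the face. -/
theorem exists_uniform_estVar_rate (hd : 0 < d) (hf_nonneg : ∀ x, 0 ≤ f x)
    (hf_supp : ∀ x, x ∉ simplex d → f x = 0) (hfc : ContinuousOn f (simplex d))
    (J : Finset (Fin d)) :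
    ∃ ε : (Fin d → ℝ) → ℕ → ℝ, (∀ y, Tendsto (ε y) atTop (𝓝 0)) ∧
      ∀ lam y : Fin d → ℝ, (∀ i ∈ J, 0 ≤ lam i) → (∀ j ∉ J, 0 < y j) → ∑ j ∈ Jᶜ, y j < 1 →
        ∀ᶠ m : ℕ in atTop, |estVar f m (nearPoint J lam y m)
          / (m : ℝ) ^ (((d : ℝ) + J.card) / 2) - varianceConst f J lam y| ≤ ε y m := by
  have hy_all : ∀ y : Fin d → ℝ, ∃ ε : ℕ → ℝ, Tendsto ε atTop (𝓝 0) ∧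
      ∀ lam : Fin d → ℝ, (∀ i ∈ J, 0 ≤ lam i) → (∀ j ∉ J, 0 < y j) → ∑ j ∈ Jᶜ, y j < 1 →
        ∀ᶠ m : ℕ in atTop, |estVar f m (nearPoint J lam y m)
          / (m : ℝ) ^ (((d : ℝ) + J.card) / 2) - varianceConst f J lam y| ≤ ε m := by
    intro y
    by_cases hadm : (∀ j ∉ J, 0 < y j) ∧ ∑ j ∈ Jᶜ, y j < 1
    swap
    · exact ⟨0, tendsto_const_nhds, fun lam _ h1 h2 => absurd ⟨h1, h2⟩ hadm⟩
    obtain ⟨hy, hy1⟩ := hadm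
    set F : ℕ → (Fin d → ℝ) → ℝ := fun m lam => estVar f m (nearPoint J lam y m)
      / (m : ℝ) ^ (((d : ℝ) + J.card) / 2) with hF
    -- On a compact box, uniform convergence amounts to convergence along `atTop ×ˢ 𝓝[K] lam₀` at
    -- each point. This is why the variance limit is proved for a general filter with varying `lam`.
    have hunif : ∀ N : ℕ, TendstoUniformlyOn F (fun lam => varianceConst f J lam y) atTop
        (Set.Icc (0 : Fin d → ℝ) fun _ => (N : ℝ)) := by
      intro N
      rw [← tendstoLocallyUniformlyOn_iff_tendstoUniformlyOn_of_compact isCompact_Icc,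
        tendstoLocallyUniformlyOn_iff_forall_tendsto]
      intro lam₀ hlam₀
      set K := Set.Icc (0 : Fin d → ℝ) fun _ => (N : ℝ) with hK
      have hKpos : ∀ lam ∈ K, ∀ i, 0 ≤ lam i := fun lam h i => h.1 i
      have hsnd : Tendsto (Prod.snd : ℕ × (Fin d → ℝ) → _) (atTop ×ˢ 𝓝[K] lam₀) (𝓝[K] lam₀) :=
        tendsto_snd
      have h1 : Tendsto (fun p : ℕ × (Fin d → ℝ) => varianceConst f J p.2 y)
          (atTop ×ˢ 𝓝[K] lam₀) (𝓝 (varianceConst f J lam₀ y)) :=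
        (((continuousOn_varianceConst f J y).mono hKpos) lam₀ hlam₀).tendsto.comp hsnd
      have h2 : Tendsto (fun p : ℕ × (Fin d → ℝ) => F p.1 p.2)
          (atTop ×ˢ 𝓝[K] lam₀) (𝓝 (varianceConst f J lam₀ y)) := by
        refine tendsto_estVar hd hf_nonneg hf_supp hfc tendsto_fst
          (hsnd.mono_right nhdsWithin_le_nhds) ?_ (fun j _ => hKpos lam₀ hlam₀ j) hy hy1
        filter_upwards [hsnd.eventually self_mem_nhdsWithin] with p hp j _ using hKpos _ hp j
      exact (h1.prodMk_nhds h2).mono_right (nhds_le_uniformity _)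
    obtain ⟨ε, hε, hεb⟩ := exists_tendsto_zero_of_uniform
      (fun N : ℕ => Set.Icc (0 : Fin d → ℝ) fun _ => (N : ℝ))
      (fun lam m => F m lam - varianceConst f J lam y) (fun N δ hδ => by
        filter_upwards [Metric.tendstoUniformlyOn_iff.1 (hunif N) δ hδ] with m hm lam hlam
        have := (hm lam hlam).le
        rwa [dist_comm, Real.dist_eq] at this)
    refine ⟨ε, hε, fun lam hlam _ _ => ?_⟩
    -- Coordinates of `lam` off `J` are unconstrained but irrelevant; setting them to zero places
    -- the parameter in one of the boxes.
    set lam' : Fin d → ℝ := fun i => if i ∈ J then lam i else 0 with hlam'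
    have hlam'0 : ∀ i, 0 ≤ lam' i := fun i => by
      simp only [hlam']; split_ifs with h; exacts [hlam i h, le_rfl]
    obtain ⟨N, hN⟩ := exists_nat_ge (∑ i, lam' i)
    have hmem : lam' ∈ Set.Icc (0 : Fin d → ℝ) fun _ => (N : ℝ) :=
      ⟨hlam'0, fun i =>
        (Finset.single_le_sum (fun j _ => hlam'0 j) (Finset.mem_univ i)).trans hN⟩
    have hn : ∀ m, nearPoint J lam' y m = nearPoint J lam y m := fun m => by
      ext i
      unfold nearPoint
      split_ifs with h <;> simp [hlam', h]
    have hv : varianceConst f J lam' y = varianceConst f J lam y := by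
      rw [varianceConst, varianceConst]
      congr 1
      exact Finset.prod_congr rfl fun i hi => by simp [hlam', hi]
    filter_upwards [hεb N lam' hmem] with m hm
    simpa only [hF, hn, hv] using hm
  choose ε hε hεb using hy_all
  exact ⟨ε, hε, fun lam y => hεb y lam⟩

end Uniform

/-! ### Optimization of the bandwidth. -/

section Optimization

/-- The factor of `n^{1/(d+4)}` in the optimal bandwidth. -/
noncomputable def optScale (d : ℕ) (A B : ℝ) : ℝ :=
  |B| ^ (2 / ((d : ℝ) + 4)) / ((d : ℝ) / 4 * A) ^ (1 / ((d : ℝ) + 4))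

/-- The limit risk profile at the bandwidth `t` times the optimal one. -/
noncomputable def riskProfile (d : ℕ) (A B t : ℝ) : ℝ :=
  A * optScale d A B ^ d * t ^ d + B ^ 2 / optScale d A B ^ 4 * (t ^ 4)⁻¹

variable {d : ℕ} {A B : ℝ}

theorem optScale_pos (hd : 0 < d) (hA : 0 < A) (hB : B ≠ 0) : 0 < optScale d A B := by
  have hd0 : (0 : ℝ) < d := by exact_mod_cast hd
  have := abs_pos.2 hB
  unfold optScale
  positivity

theorem optBandwidth_eq (n : ℕ) :
    optBandwidth d A B n = (n : ℝ) ^ (1 / ((d : ℝ) + 4)) * optScale d A B := by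
  rw [optBandwidth, optScale, mul_div_assoc]

/-- The first-order condition `c₁ d = 4 c₂` for `c₁ t^d + c₂ t^{-4}` to be stationary at `t = 1`;
the scale is chosen to satisfy it. -/
theorem mul_optScale_pow (hd : 0 < d) (hA : 0 < A) (hB : B ≠ 0) :
    A * optScale d A B ^ d * d = 4 * (B ^ 2 / optScale d A B ^ 4) := by
  have hd0 : (0 : ℝ) < d := by exact_mod_cast hd
  have hq := optScale_pos hd hA hB
  have hB0 := abs_pos.2 hB
  have h : optScale d A B ^ (d + 4) = B ^ 2 / (d / 4 * A) := by
    rw [optScale, div_pow, ← Real.rpow_mul_natCast hB0.le,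
      ← Real.rpow_mul_natCast (by positivity)]
    have e1 : 2 / ((d : ℝ) + 4) * ((d + 4 : ℕ) : ℝ) = (2 : ℕ) := by
      push_cast; field_simp
    have e2 : 1 / ((d : ℝ) + 4) * ((d + 4 : ℕ) : ℝ) = 1 := by
      push_cast; field_simp
    rw [e1, e2, Real.rpow_one, Real.rpow_natCast, sq_abs]
  rw [pow_add, eq_div_iff (by positivity)] at h
  field_simp
  linarith

/-- By the first-order condition the minimum is `(4/d + 1) c₂`; the rest is bookkeeping of the
powers of `|B|`, `A` and `d/4`. -/
theorem optMseConst_eq (hd : 0 < d) (hA : 0 < A) (hB : B ≠ 0) :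
    optMseConst d A B = riskProfile d A B 1 := by
  have hd0 : (0 : ℝ) < d := by exact_mod_cast hd
  have hB0 := abs_pos.2 hB
  have hq := optScale_pos hd hA hB
  have h1 := mul_optScale_pow hd hA hB
  have h2 : riskProfile d A B 1 = (4 / d + 1) * (B ^ 2 / optScale d A B ^ 4) := by
    rw [riskProfile, one_pow, one_pow, inv_one, mul_one, mul_one]
    rw [← eq_div_iff hd0.ne'] at h1
    rw [h1]
    ring
  have h3 : optScale d A B ^ 4 = |B| ^ (8 / ((d : ℝ) + 4))
      / (((d : ℝ) / 4) ^ (4 / ((d : ℝ) + 4)) * A ^ (4 / ((d : ℝ) + 4))) := by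
    rw [optScale, div_pow, ← Real.rpow_mul_natCast hB0.le, ← Real.rpow_mul_natCast (by positivity),
      ← Real.mul_rpow (by positivity) hA.le]
    congr 2
    · push_cast; ring
    · push_cast; ring
  have h4 : |B| ^ (2 * (d : ℝ) / ((d : ℝ) + 4)) * |B| ^ (8 / ((d : ℝ) + 4)) = B ^ 2 := by
    rw [← Real.rpow_add hB0]
    have : 2 * (d : ℝ) / ((d : ℝ) + 4) + 8 / ((d : ℝ) + 4) = (2 : ℕ) := by
      push_cast; field_simp; ring
    rw [this, Real.rpow_natCast, sq_abs]
  have h5 : (4 / (d : ℝ)) ^ (4 / ((d : ℝ) + 4)) = (((d : ℝ) / 4) ^ (4 / ((d : ℝ) + 4)))⁻¹ := by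
    rw [← Real.inv_rpow (by positivity), inv_div]
  have h6 : A ^ (-4 / ((d : ℝ) + 4)) = (A ^ (4 / ((d : ℝ) + 4)))⁻¹ := by
    rw [← Real.rpow_neg hA.le]; congr 1; ring
  rw [h2, h3, ← h4, optMseConst, h5, h6]
  have p1 : 0 < ((d : ℝ) / 4) ^ (4 / ((d : ℝ) + 4)) := by positivity
  have p2 : 0 < A ^ (4 / ((d : ℝ) + 4)) := by positivity
  have p3 : 0 < |B| ^ (8 / ((d : ℝ) + 4)) := by positivity
  have p4 : (0 : ℝ) < 4 / d + 1 := by positivity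
  generalize ((d : ℝ) / 4) ^ (4 / ((d : ℝ) + 4)) = a at *
  generalize A ^ (4 / ((d : ℝ) + 4)) = b at *
  generalize |B| ^ (8 / ((d : ℝ) + 4)) = c at *
  generalize (4 : ℝ) / d + 1 = e at *
  field_simp

theorem riskProfile_pos (hd : 0 < d) (hA : 0 < A) (hB : B ≠ 0) {t : ℝ} (ht : 0 < t) :
    0 < riskProfile d A B t := by
  have hq := optScale_pos hd hA hB
  have hB2 : 0 < B ^ 2 := by positivity
  unfold riskProfile
  positivity

/-- The risk profile is minimal at `1`, with a quantitative gap. -/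
theorem riskProfile_one_add_le (hd : 0 < d) (hA : 0 < A) (hB : B ≠ 0) {t : ℝ} (ht : 0 < t) :
    riskProfile d A B 1 + 4 * (B ^ 2 / optScale d A B ^ 4) * ((t - 1) ^ 2 / t)
      ≤ riskProfile d A B t := by
  have hq := optScale_pos hd hA hB
  have h1 := mul_optScale_pow hd hA hB
  have hB2 : 0 < B ^ 2 := by positivity
  have hc1 : 0 < A * optScale d A B ^ d := by positivity
  have hc2 : 0 < B ^ 2 / optScale d A B ^ 4 := by positivity
  unfold riskProfile
  set c₁ := A * optScale d A B ^ d
  set c₂ := B ^ 2 / optScale d A B ^ 4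
  -- Bernoulli linearizes the variance term. With `c₁ d = 4 c₂` the gap is at least `c₂ (t⁻⁴ + 4t -
  -- 5)`, a one-variable function independent of `d`.
  have hbern : 1 + d * (t - 1) ≤ t ^ d := by
    have := one_add_mul_le_pow (show (-2 : ℝ) ≤ t - 1 by linarith) d
    rwa [add_sub_cancel] at this
  have h2 := mul_le_mul_of_nonneg_left hbern hc1.le
  have h3 : 4 * ((t - 1) ^ 2 / t) ≤ (t ^ 4)⁻¹ + 4 * t - 5 := by
    have e : (t ^ 4)⁻¹ + 4 * t - 5 - 4 * ((t - 1) ^ 2 / t)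
        = (t - 1) ^ 2 * (3 * t ^ 2 + 2 * t + 1) / t ^ 4 := by
      field_simp; ring
    have : 0 ≤ (t - 1) ^ 2 * (3 * t ^ 2 + 2 * t + 1) / t ^ 4 := by positivity
    linarith
  have h4 := mul_le_mul_of_nonneg_left h3 hc2.le
  simp only [one_pow, inv_one, mul_one]
  nlinarith

section Sequences

variable {R : ℕ → ℕ → ℝ} {α β : ℕ → ℝ}

theorem tendsto_optBandwidth (hd : 0 < d) (hA : 0 < A) (hB : B ≠ 0) :
    Tendsto (optBandwidth d A B) atTop atTop := by
  have h : Tendsto (fun n : ℕ => (n : ℝ) ^ (1 / ((d : ℝ) + 4))) atTop atTop :=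
    (tendsto_rpow_atTop (by positivity)).comp tendsto_natCast_atTop_atTop
  refine (h.atTop_mul_const (optScale_pos hd hA hB)).congr fun n => (optBandwidth_eq n).symm

theorem optBandwidth_pos (hd : 0 < d) (hA : 0 < A) (hB : B ≠ 0) {n : ℕ} (hn : 0 < n) :
    0 < optBandwidth d A B n := by
  rw [optBandwidth_eq]
  have := optScale_pos hd hA hB
  positivity

theorem isEquivalent_optBandwidth_iff (hd : 0 < d) (hA : 0 < A) (hB : B ≠ 0) {m : ℕ → ℕ} :
    (fun n => (m n : ℝ)) ~[atTop] optBandwidth d A B ↔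
      Tendsto (fun n => (m n : ℝ) / optBandwidth d A B n) atTop (𝓝 1) := by
  refine isEquivalent_iff_tendsto_one ?_
  filter_upwards [eventually_gt_atTop 0] with n hn using (optBandwidth_pos hd hA hB hn).ne'

/-- The risk in terms of the ratio of the bandwidth to the optimal one. -/
theorem risk_eq (hd : 0 < d) (hA : 0 < A) (hB : B ≠ 0)
    (hR : ∀ n m, 0 < n → 0 < m →
      R n m = (n : ℝ)⁻¹ * (m : ℝ) ^ d * α m + ((m : ℝ) ^ 4)⁻¹ * β m)
    {n m : ℕ} (hn : 0 < n) (hm : 0 < m) :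
    R n m = (n : ℝ) ^ (-4 / ((d : ℝ) + 4)) *
      (A * optScale d A B ^ d * ((m : ℝ) / optBandwidth d A B n) ^ d * (α m / A)
        + B ^ 2 / optScale d A B ^ 4 * (((m : ℝ) / optBandwidth d A B n) ^ 4)⁻¹ * (β m / B ^ 2)) := by
  have hq := optScale_pos hd hA hB
  have hn0 : (0 : ℝ) < n := by exact_mod_cast hn
  have hm0 : (0 : ℝ) < m := by exact_mod_cast hm
  have hr : (0 : ℝ) < (n : ℝ) ^ (1 / ((d : ℝ) + 4)) := by positivity
  have e1 : ((n : ℝ) ^ (1 / ((d : ℝ) + 4))) ^ (d + 4) = n := by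
    rw [← Real.rpow_mul_natCast hn0.le]
    have : 1 / ((d : ℝ) + 4) * ((d + 4 : ℕ) : ℝ) = 1 := by push_cast; field_simp
    rw [this, Real.rpow_one]
  have e2 : (n : ℝ) ^ (-4 / ((d : ℝ) + 4)) = (((n : ℝ) ^ (1 / ((d : ℝ) + 4))) ^ 4)⁻¹ := by
    rw [← Real.rpow_mul_natCast hn0.le, ← Real.rpow_neg hn0.le]
    congr 1
    push_cast
    ring
  have e3 : (n : ℝ)⁻¹ = (((n : ℝ) ^ (1 / ((d : ℝ) + 4))) ^ (d + 4))⁻¹ := by rw [e1]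
  rw [hR n m hn hm, e2, optBandwidth_eq, e3]
  generalize (n : ℝ) ^ (1 / ((d : ℝ) + 4)) = r at *
  rw [pow_add, div_pow, mul_pow, div_pow, mul_pow]
  field_simp

theorem abs_div_sub_one_eventually {a : ℕ → ℝ} {c : ℝ} (hc : 0 < c) (ha : Tendsto a atTop (𝓝 c))
    {η : ℝ} (hη : 0 < η) : ∀ᶠ m in atTop, 1 - η ≤ a m / c := by
  have h := ha.div_const c
  rw [div_self hc.ne'] at h
  exact h.eventually_const_le (by linarith)

/-- Every bandwidth sequence tending to infinity has at least the risk profile. -/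
theorem eventually_riskProfile_le (hd : 0 < d) (hA : 0 < A) (hB : B ≠ 0)
    (hα : Tendsto α atTop (𝓝 A)) (hβ : Tendsto β atTop (𝓝 (B ^ 2)))
    (hR : ∀ n m, 0 < n → 0 < m →
      R n m = (n : ℝ)⁻¹ * (m : ℝ) ^ d * α m + ((m : ℝ) ^ 4)⁻¹ * β m)
    {m : ℕ → ℕ} (hm : Tendsto m atTop atTop) {η : ℝ} (hη : 0 < η) :
    ∀ᶠ n : ℕ in atTop, (n : ℝ) ^ (-4 / ((d : ℝ) + 4)) *
      ((1 - η) * riskProfile d A B ((m n : ℝ) / optBandwidth d A B n)) ≤ R n (m n) := by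
  have hq := optScale_pos hd hA hB
  filter_upwards [eventually_gt_atTop 0, hm.eventually_gt_atTop 0,
    hm.eventually (abs_div_sub_one_eventually hA hα hη),
    hm.eventually (abs_div_sub_one_eventually (by positivity : 0 < B ^ 2) hβ hη)] with n hn hmn h1 h2
  rw [risk_eq hd hA hB hR hn hmn]
  have hκ := optBandwidth_pos hd hA hB hn
  have hm0 : (0 : ℝ) < m n := by exact_mod_cast hmn
  refine mul_le_mul_of_nonneg_left ?_ (by positivity)
  rw [riskProfile, mul_comm, add_mul]
  exact add_le_add (mul_le_mul_of_nonneg_left h1 (by positivity))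
    (mul_le_mul_of_nonneg_left h2 (by positivity))

/-- The risk of bandwidth sequences equivalent to the optimal one. -/
theorem tendsto_risk (hd : 0 < d) (hA : 0 < A) (hB : B ≠ 0)
    (hα : Tendsto α atTop (𝓝 A)) (hβ : Tendsto β atTop (𝓝 (B ^ 2)))
    (hR : ∀ n m, 0 < n → 0 < m →
      R n m = (n : ℝ)⁻¹ * (m : ℝ) ^ d * α m + ((m : ℝ) ^ 4)⁻¹ * β m)
    {m : ℕ → ℕ} (hm : Tendsto m atTop atTop)
    (ht : Tendsto (fun n => (m n : ℝ) / optBandwidth d A B n) atTop (𝓝 1)) :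
    Tendsto (fun n => R n (m n) / (n : ℝ) ^ (-4 / ((d : ℝ) + 4))) atTop
      (𝓝 (riskProfile d A B 1)) := by
  have hB2 : B ^ 2 ≠ 0 := by positivity
  have h1 := ((ht.pow d).const_mul (A * optScale d A B ^ d)).mul ((hα.comp hm).div_const A)
  have h2 := (((ht.pow 4).inv₀ (by norm_num)).const_mul (B ^ 2 / optScale d A B ^ 4)).mul
    ((hβ.comp hm).div_const (B ^ 2))
  have h := h1.add h2
  rw [div_self hA.ne', div_self hB2, mul_one, mul_one] at h
  refine h.congr' ?_
  filter_upwards [eventually_gt_atTop 0, hm.eventually_gt_atTop 0] with n hn hmn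
  have hn0 : (0 : ℝ) < n := by exact_mod_cast hn
  rw [risk_eq hd hA hB hR hn hmn, mul_div_cancel_left₀ _ (by positivity)]
  rfl

theorem tendsto_atTop_of_ratio (hd : 0 < d) (hA : 0 < A) (hB : B ≠ 0) {m : ℕ → ℕ}
    (ht : Tendsto (fun n => (m n : ℝ) / optBandwidth d A B n) atTop (𝓝 1)) :
    Tendsto m atTop atTop := by
  rw [← tendsto_natCast_atTop_iff (R := ℝ)]
  refine (ht.pos_mul_atTop one_pos (tendsto_optBandwidth hd hA hB)).congr' ?_
  filter_upwards [eventually_gt_atTop 0] with n hn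
  exact div_mul_cancel₀ _ (optBandwidth_pos hd hA hB hn).ne'

theorem tendsto_one_of_sq_div {t : ℕ → ℝ} (ht : ∀ᶠ n in atTop, 0 < t n)
    (h : ∀ ε : ℝ, 0 < ε → ∀ᶠ n in atTop, (t n - 1) ^ 2 / t n ≤ ε) : Tendsto t atTop (𝓝 1) := by
  rw [Metric.tendsto_nhds]
  intro δ hδ
  -- The bound `1/4` first confines `t` to `t ≤ 9/4`; then `(t - 1)² ≤ (9/16) δ² < δ²`.
  filter_upwards [ht, h (min (1 / 4) (δ ^ 2 / 4)) (by positivity)] with n hn h1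
  have h2 := (div_le_iff₀ hn).1 (h1.trans (min_le_left _ _))
  have h3 := (div_le_iff₀ hn).1 (h1.trans (min_le_right _ _))
  have h4 : t n ≤ 9 / 4 := by nlinarith
  rw [Real.dist_eq]
  refine abs_lt_of_sq_lt_sq ?_ hδ.le
  nlinarith [sq_pos_of_pos hδ]

/-- A bandwidth sequence is asymptotically optimal iff it is equivalent to the optimal one. -/
theorem isAsymptoticallyOptimal_iff (hd : 0 < d) (hA : 0 < A) (hB : B ≠ 0)
    (hα : Tendsto α atTop (𝓝 A)) (hβ : Tendsto β atTop (𝓝 (B ^ 2)))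
    (hR : ∀ n m, 0 < n → 0 < m →
      R n m = (n : ℝ)⁻¹ * (m : ℝ) ^ d * α m + ((m : ℝ) ^ 4)⁻¹ * β m) (m : ℕ → ℕ) :
    IsAsymptoticallyOptimal R m ↔ (fun n => (m n : ℝ)) ~[atTop] optBandwidth d A B := by
  rw [isEquivalent_optBandwidth_iff hd hA hB]
  have hq := optScale_pos hd hA hB
  have hc2 : 0 < B ^ 2 / optScale d A B ^ 4 := by positivity
  have hu := riskProfile_pos hd hA hB one_pos
  set u := riskProfile d A B 1 with hu_def
  have hprofile : ∀ {t : ℝ}, 0 < t → u ≤ riskProfile d A B t := fun {t} ht => by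
    have := riskProfile_one_add_le hd hA hB ht
    have h0 : 0 ≤ 4 * (B ^ 2 / optScale d A B ^ 4) * ((t - 1) ^ 2 / t) := by positivity
    linarith
  constructor
  · rintro ⟨hm, hopt⟩
    -- The rounded optimum is the competitor against which an optimal sequence is tested.
    set m' : ℕ → ℕ := fun n => ⌈optBandwidth d A B n⌉₊ with hm'
    have hκ := tendsto_optBandwidth hd hA hB
    have ht' : Tendsto (fun n => (m' n : ℝ) / optBandwidth d A B n) atTop (𝓝 1) :=
      (tendsto_nat_ceil_div_atTop (R := ℝ)).comp hκ
    have hm'T := tendsto_atTop_of_ratio hd hA hB ht'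
    have hlim := tendsto_risk hd hA hB hα hβ hR hm'T ht'
    refine tendsto_one_of_sq_div ?_ fun ε hε => ?_
    · filter_upwards [eventually_gt_atTop 0, hm.eventually_gt_atTop 0] with n hn hmn
      have := optBandwidth_pos hd hA hB hn
      positivity
    · set e := 4 * (B ^ 2 / optScale d A B ^ 4) * ε with he
      have he0 : 0 < e := by positivity
      -- Tuned so that `(1 + η₁)(u + e/4) ≤ u + e/2 = (1 - η₂)(u + e)`. The profile is then at most
      -- `u + e`, and the gap inequality gives `(t - 1)²/t ≤ ε`.
      set η₁ := e / (4 * (u + e)) with hη₁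
      have hη₁0 : 0 < η₁ := by positivity
      set η₂ := e / (2 * (u + e)) with hη₂
      have hη₂0 : 0 < η₂ := by positivity
      filter_upwards [eventually_gt_atTop 0, hm.eventually_gt_atTop 0, hopt m' hm'T η₁ hη₁0,
        hlim.eventually_le_const (by linarith : u < u + e / 4),
        eventually_riskProfile_le hd hA hB hα hβ hR hm hη₂0] with n hn hmn h1 h2 h3
      have hn0 : (0 : ℝ) < n := by exact_mod_cast hn
      have hE : (0 : ℝ) < (n : ℝ) ^ (-4 / ((d : ℝ) + 4)) := by positivity
      have hκn := optBandwidth_pos hd hA hB hn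
      have htn : 0 < (m n : ℝ) / optBandwidth d A B n := by
        have : (0 : ℝ) < m n := by exact_mod_cast hmn
        positivity
      set t := (m n : ℝ) / optBandwidth d A B n
      set E := (n : ℝ) ^ (-4 / ((d : ℝ) + 4))
      rw [div_le_iff₀ hE] at h2
      have h4 : (1 - η₂) * riskProfile d A B t ≤ (1 + η₁) * (u + e / 4) := by
        refine le_of_mul_le_mul_left ?_ hE
        calc E * ((1 - η₂) * riskProfile d A B t) ≤ (1 + η₁) * R n (m' n) := h3.trans h1
          _ ≤ (1 + η₁) * ((u + e / 4) * E) := mul_le_mul_of_nonneg_left h2 (by positivity)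
          _ = _ := by ring
      have h5 : (1 - η₂) * (u + e) = u + e / 2 := by
        rw [hη₂]; field_simp; ring
      have h6 : (1 + η₁) * (u + e / 4) ≤ u + e / 2 := by
        have : η₁ * (u + e / 4) ≤ e / 4 := by
          rw [hη₁, div_mul_eq_mul_div, div_le_div_iff₀ (by positivity) (by positivity)]
          nlinarith
        linarith
      have h7 : 0 < 1 - η₂ := by
        by_contra h
        have := mul_nonpos_of_nonpos_of_nonneg (not_lt.1 h) (by positivity : 0 ≤ u + e)
        linarith
      have h8 : riskProfile d A B t ≤ u + e := by
        refine le_of_mul_le_mul_left ?_ h7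
        linarith
      have h9 := riskProfile_one_add_le hd hA hB htn
      refine le_of_mul_le_mul_left (a := 4 * (B ^ 2 / optScale d A B ^ 4)) ?_ (by positivity)
      linarith
  · intro ht
    have hm := tendsto_atTop_of_ratio hd hA hB ht
    refine ⟨hm, fun m' hm' η hη => ?_⟩
    have hlim := tendsto_risk hd hA hB hα hβ hR hm ht
    -- The solution of `(1 + η)(1 - η₁) = 1 + η/2`.
    set η₁ := η / (2 * (1 + η)) with hη₁
    have hη₁0 : 0 < η₁ := by positivity
    filter_upwards [eventually_gt_atTop 0, hm'.eventually_gt_atTop 0,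
      hlim.eventually_le_const (by nlinarith : u < (1 + η / 2) * u),
      eventually_riskProfile_le hd hA hB hα hβ hR hm' hη₁0] with n hn hmn h1 h2
    have hn0 : (0 : ℝ) < n := by exact_mod_cast hn
    have hE : (0 : ℝ) < (n : ℝ) ^ (-4 / ((d : ℝ) + 4)) := by positivity
    have hκn := optBandwidth_pos hd hA hB hn
    have htn : 0 < (m' n : ℝ) / optBandwidth d A B n := by
      have : (0 : ℝ) < m' n := by exact_mod_cast hmn
      positivity
    set E := (n : ℝ) ^ (-4 / ((d : ℝ) + 4))
    rw [div_le_iff₀ hE] at h1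
    have h3 : (1 + η) * (1 - η₁) = 1 + η / 2 := by rw [hη₁]; field_simp; ring
    have h4 : 0 ≤ 1 - η₁ := by
      by_contra h
      have := mul_nonpos_of_nonneg_of_nonpos (by positivity : 0 ≤ 1 + η) (not_le.1 h).le
      linarith
    calc R n (m n) ≤ (1 + η / 2) * u * E := h1
      _ = (1 + η) * (E * ((1 - η₁) * u)) := by rw [← h3]; ring
      _ ≤ (1 + η) * R n (m' n) := by
        refine mul_le_mul_of_nonneg_left (le_trans ?_ h2) (by positivity)
        exact mul_le_mul_of_nonneg_left (mul_le_mul_of_nonneg_left (hprofile htn) h4) hE.le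

end Sequences

end Optimization

/-! ### The vertex case and the main theorem. -/

section Main

variable {d : ℕ} {f fext : (Fin d → ℝ) → ℝ} {U : Set (Fin d → ℝ)}

theorem varianceConst_univ (lam y : Fin d → ℝ) :
    varianceConst f Finset.univ lam y
      = f 0 * ∏ i, (Real.exp (-2 * lam i) * besselI 0 (2 * lam i)) := by
  have h : facePoint Finset.univ y = 0 := by
    funext i; simp [facePoint]
  rw [varianceConst, h, psi]
  simp

theorem nearPoint_univ (lam y : Fin d → ℝ) (m : ℕ) :
    nearPoint Finset.univ lam y m = nearPoint Finset.univ lam 0 m := by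
  funext i; simp [nearPoint]

theorem varianceConst_univ_pos (hf_nonneg : ∀ x, 0 ≤ f x) (hf0 : f 0 ≠ 0) {lam : Fin d → ℝ}
    (hlam : ∀ i, 0 ≤ lam i) (y : Fin d → ℝ) : 0 < varianceConst f Finset.univ lam y := by
  rw [varianceConst_univ]
  exact mul_pos ((hf_nonneg 0).lt_of_ne' hf0)
    (Finset.prod_pos fun i _ => mul_pos (Real.exp_pos _) (besselI_zero_pos (hlam i)))

/-- A constant, depending only on `lam`, for the relative error of the variance at the vertex. -/
theorem exists_vertex_rate (hd : 0 < d) (hf_nonneg : ∀ x, 0 ≤ f x)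
    (hf_supp : ∀ x, x ∉ simplex d → f x = 0) (hfc : ContinuousOn f (simplex d))
    (hfeq : Set.EqOn fext f (simplex d)) (hdiff : DifferentiableAt ℝ fext 0) :
    ∃ C : (Fin d → ℝ) → ℝ, (∀ lam, 0 ≤ C lam) ∧ ∀ lam y : Fin d → ℝ, (∀ i, 0 ≤ lam i) → ∀ᶠ m : ℕ in atTop,
      |estVar f m (nearPoint Finset.univ lam y m)
          / (m : ℝ) ^ (((d : ℝ) + (Finset.univ : Finset (Fin d)).card) / 2)
        - varianceConst f Finset.univ lam y| ≤ C lam * (m : ℝ)⁻¹ := by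
  -- The constant is chosen at `y = 0`: for `J = [d]` nothing depends on `y`, so it depends on `lam`
  -- alone.
  have h : ∀ lam : Fin d → ℝ, ∃ C : ℝ, 0 ≤ C ∧ ((∀ i, 0 ≤ lam i) → ∀ᶠ m : ℕ in atTop,
      |estVar f m (nearPoint Finset.univ lam 0 m)
          / (m : ℝ) ^ (((d : ℝ) + (Finset.univ : Finset (Fin d)).card) / 2)
        - varianceConst f Finset.univ lam 0| ≤ C * (m : ℝ)⁻¹) := by
    intro lam
    by_cases hlam : ∀ i, 0 ≤ lam i
    · obtain ⟨C, hC⟩ := exists_abs_estVar_sub_le hd hf_nonneg hf_supp hfc hfeq hdiff hlam 0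
      exact ⟨|C|, abs_nonneg C, fun _ => hC.mono fun m hm =>
        hm.trans (mul_le_mul_of_nonneg_right (le_abs_self C) (by positivity))⟩
    · exact ⟨0, le_rfl, fun h => absurd h hlam⟩
  choose C hC0 hC using h
  refine ⟨C, hC0, fun lam y hlam => (hC lam hlam).mono fun m hm => ?_⟩
  rw [nearPoint_univ, varianceConst_univ]
  rwa [varianceConst_univ] at hm

end Main

end BernsteinSimplex

theorem corollary2 {d : ℕ} (hd : 0 < d)
    -- the density, supported on the simplex, with its `C²` extension
    (f : (Fin d → ℝ) → ℝ) (hf_nonneg : ∀ x, 0 ≤ f x) (hf_supp : ∀ x, x ∉ simplex d → f x = 0)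
    (U : Set (Fin d → ℝ)) (hU : IsOpen U) (hSU : simplex d ⊆ U)
    (fext : (Fin d → ℝ) → ℝ) (hfext : ContDiffOn ℝ 2 fext U) (hfeq : Set.EqOn fext f (simplex d))
    -- independent observations with density `f`
    {Ω : Type*} [MeasurableSpace Ω] (P : Measure Ω) [IsProbabilityMeasure P]
    (X : ℕ → Ω → Fin d → ℝ) (hX_meas : ∀ i, Measurable (X i)) (hX_indep : iIndepFun X P)
    (hX_law : ∀ i, P.map (X i) = volume.withDensity fun x => ENNReal.ofReal (f x))
    -- the conditions on the partial derivatives on the face `x_J = 0`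
    (J : Finset (Fin d))
    (h_shoulder : ∀ x ∈ simplex d, (∀ i ∈ J, x i = 0) → ∀ i, partialDeriv fext i x = 0)
    (h_second : ∀ x ∈ simplex d, (∀ i ∈ J, x i = 0) →
      ∀ i ∉ J, ∀ j ∉ J, secondPartialDeriv fext i j x = 0) :
    -- expansion of the mean squared error near the face `x_J = 0`
    (∃ (C : (Fin d → ℝ) → ℝ) (ε : (Fin d → ℝ) → ℕ → ℝ),
      (∀ y, Tendsto (ε y) atTop (𝓝 0)) ∧
      ∀ lam y : Fin d → ℝ, (∀ i ∈ J, 0 ≤ lam i) → (∀ i ∉ J, 0 < y i ∧ y i < 1) →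
        ∑ i ∈ Jᶜ, y i < 1 →
        ∀ m : ℕ → ℕ, Tendsto m atTop atTop →
        ∃ r₁ r₂ r₃ : ℕ → ℝ,
          (∀ᶠ n in atTop,
            mse P X f n (m n) (nearPoint J lam y (m n)) =
              (n : ℝ)⁻¹ * (m n : ℝ) ^ (((d : ℝ) + J.card) / 2) * varianceConst f J lam y
              + (m n : ℝ) ^ (-4 : ℤ) * biasBracket fext J lam y ^ 2
              + (n : ℝ)⁻¹ * (m n : ℝ) ^ (((d : ℝ) + J.card) / 2)
                  * (r₁ n + if J ≠ Finset.univ then r₂ n else 0)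
              + r₃ n) ∧
          (∀ᶠ n in atTop, |r₁ n| ≤ C lam * (m n : ℝ) ^ (-1 : ℤ)) ∧
          (∀ᶠ n in atTop, |r₂ n| ≤ ε y (m n)) ∧
          r₃ =o[atTop] (fun n => (m n : ℝ) ^ (-4 : ℤ)
            + if J ≠ Finset.univ then (m n : ℝ) ^ (-3 : ℤ) else 0)) ∧
    -- optimal bandwidth and optimal mean squared error near the vertex `0`
    (J = Finset.univ → f 0 ≠ 0 →
      ∀ lam : Fin d → ℝ, (∀ i, 0 ≤ lam i) → biasBracket fext J lam 0 ≠ 0 →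
        (∀ m : ℕ → ℕ,
          IsAsymptoticallyOptimal (fun n k => mse P X f n k (nearPoint J lam 0 k)) m ↔
            (fun n => (m n : ℝ)) ~[atTop]
              optBandwidth d (varianceConst f J lam 0) (biasBracket fext J lam 0)) ∧
        (∀ m : ℕ → ℕ,
          (fun n => (m n : ℝ)) ~[atTop]
            optBandwidth d (varianceConst f J lam 0) (biasBracket fext J lam 0) →
          (fun n => mse P X f n (m n) (nearPoint J lam 0 (m n))
              - (n : ℝ) ^ (-4 / ((d : ℝ) + 4))
                * optMseConst d (varianceConst f J lam 0) (biasBracket fext J lam 0))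
            =o[atTop] (fun n => (n : ℝ) ^ (-4 / ((d : ℝ) + 4))))) := by
  have hfc : ContinuousOn f (simplex d) := (hfext.continuousOn.mono hSU).congr hfeq.symm
  have hfm := measurable_of_continuousOn_simplex hf_supp hfc
  obtain ⟨M, -, hM⟩ := exists_bound_of_continuousOn_simplex hf_supp hfc
  have h0 : (0 : Fin d → ℝ) ∈ simplex d := by simp [simplex]
  have hmse : ∀ {n : ℕ}, 0 < n → ∀ (m : ℕ) (x : Fin d → ℝ),
      mse P X f n m x = (n : ℝ)⁻¹ * estVar f m x + (estMean f m x - f x) ^ 2 :=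
    mse_eq hf_nonneg hfm (fun x => (le_abs_self _).trans (hM x)) hX_meas hX_indep hX_law
  refine ⟨?_, ?_⟩
  · obtain ⟨ε, hε, hrate⟩ := exists_uniform_estVar_rate hd hf_nonneg hf_supp hfc J
    obtain ⟨C, hC0, hC⟩ := exists_vertex_rate hd hf_nonneg hf_supp hfc hfeq
      (differentiableAt_of_mem hU hfext (hSU h0))
    refine ⟨C, ε, hε, fun lam y hlam hy hy1 m hm => ?_⟩
    have hy0 : ∀ j ∉ J, 0 < y j := fun j hj => (hy j hj).1
    set err : ℕ → ℝ := fun n => estVar f (m n) (nearPoint J lam y (m n))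
      / (m n : ℝ) ^ (((d : ℝ) + J.card) / 2) - varianceConst f J lam y with herr
    set r₃ : ℕ → ℝ := fun n => (estMean f (m n) (nearPoint J lam y (m n))
      - f (nearPoint J lam y (m n))) ^ 2 - (m n : ℝ) ^ (-4 : ℤ) * biasBracket fext J lam y ^ 2
      with hr₃
    -- Squaring the bias limit, `(m² * bias)² → B²`, leaves a remainder `o(m⁻⁴)` for every `J`; the
    -- additional `m⁻³` in the statement only weakens this.
    have hsmall : r₃ =o[atTop] (fun n => (m n : ℝ) ^ (-4 : ℤ)) := by
      have hb := ((tendsto_bias hf_supp hU hSU hfext hfeq h_shoulder hlam hy0 hy1).comp hm).pow 2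
      rw [isLittleO_iff_tendsto']
      · have h := hb.sub_const (biasBracket fext J lam y ^ 2)
        rw [sub_self] at h
        refine h.congr' ?_
        filter_upwards [hm.eventually_gt_atTop 0] with n hn
        have hn0 : (m n : ℝ) ≠ 0 := by exact_mod_cast hn.ne'
        have e : (m n : ℝ) ^ (-4 : ℤ) = ((m n : ℝ) ^ 4)⁻¹ := by
          rw [zpow_neg]
          norm_cast
        simp only [hr₃, Function.comp_apply, e]
        field_simp
      · filter_upwards [hm.eventually_gt_atTop 0] with n hn h
        have hn0 : (0 : ℝ) < m n := by exact_mod_cast hn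
        exact absurd h (by positivity)
    -- The whole relative error of the variance goes to `r₁` at the vertex and otherwise to `r₂`,
    -- where the rate depends only on `y`.
    refine ⟨fun n => if J = Finset.univ then err n else 0, err, r₃, ?_, ?_, ?_, ?_⟩
    · filter_upwards [eventually_gt_atTop 0, hm.eventually_gt_atTop 0] with n hn hmn
      have hmp : (0 : ℝ) < (m n : ℝ) ^ (((d : ℝ) + J.card) / 2) := by
        have : (0 : ℝ) < m n := by exact_mod_cast hmn
        positivity
      have hsum : (if J = Finset.univ then err n else 0) + (if J ≠ Finset.univ then err n else 0)
          = err n := by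
        by_cases h : J = Finset.univ <;> simp [h]
      have hvar : estVar f (m n) (nearPoint J lam y (m n))
          = (m n : ℝ) ^ (((d : ℝ) + J.card) / 2) * (varianceConst f J lam y + err n) := by
        simp only [herr]
        rw [add_sub_cancel, mul_div_cancel₀ _ hmp.ne']
      rw [hmse hn, hsum, hvar]
      simp only [hr₃]
      ring
    · by_cases h : J = Finset.univ
      · subst h
        simp only [if_true, zpow_neg_one]
        exact hm.eventually (hC lam y fun i => hlam i (Finset.mem_univ i))
      · simp only [if_neg h, abs_zero]
        exact Eventually.of_forall fun n => mul_nonneg (hC0 lam) (by positivity)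
    · exact hm.eventually (hrate lam y hlam hy0 hy1)
    · refine hsmall.trans_isBigO (IsBigO.of_bound 1 (Eventually.of_forall fun n => ?_))
      have h1 : (0 : ℝ) ≤ (m n : ℝ) ^ (-4 : ℤ) := by positivity
      have h2 : (0 : ℝ) ≤ if J ≠ Finset.univ then (m n : ℝ) ^ (-3 : ℤ) else 0 := by
        split_ifs <;> positivity
      rw [one_mul, Real.norm_of_nonneg h1, Real.norm_of_nonneg (add_nonneg h1 h2)]
      linarith
  · intro hJ hf0 lam hlam hB
    subst hJ
    have hA := varianceConst_univ_pos hf_nonneg hf0 hlam 0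
    have hvar := tendsto_estVar (l := atTop) (m := fun m : ℕ => m) (lam := fun _ => lam)
      (lam₀ := lam) (y := 0) (J := Finset.univ) hd hf_nonneg hf_supp hfc tendsto_id
      tendsto_const_nhds (Eventually.of_forall fun _ j _ => hlam j) (fun j _ => hlam j)
      (fun j hj => absurd (Finset.mem_univ j) hj) (by simp)
    have hbias := (tendsto_bias (y := 0) hf_supp hU hSU hfext hfeq h_shoulder
      (fun i _ => hlam i) (fun j hj => absurd (Finset.mem_univ j) hj) (by simp)).pow 2
    set A := varianceConst f Finset.univ lam 0
    set B := biasBracket fext Finset.univ lam 0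
    -- The risk takes the form `n⁻¹ m^d α_m + m⁻⁴ β_m` with `α` and `β` functions of `m` only, so
    -- their limits apply along every bandwidth sequence.
    have hR : ∀ n m : ℕ, 0 < n → 0 < m → mse P X f n m (nearPoint Finset.univ lam 0 m)
        = (n : ℝ)⁻¹ * (m : ℝ) ^ d * (estVar f m (nearPoint Finset.univ lam 0 m)
            / (m : ℝ) ^ (((d : ℝ) + (Finset.univ : Finset (Fin d)).card) / 2))
          + ((m : ℝ) ^ 4)⁻¹ * ((m : ℝ) ^ 2 * (estMean f m (nearPoint Finset.univ lam 0 m)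
            - f (nearPoint Finset.univ lam 0 m))) ^ 2 := by
      intro n m hn hm
      have hm0 : (0 : ℝ) < m := by exact_mod_cast hm
      have he : (m : ℝ) ^ (((d : ℝ) + (Finset.univ : Finset (Fin d)).card) / 2) = (m : ℝ) ^ d := by
        rw [Finset.card_univ, Fintype.card_fin, add_self_div_two, Real.rpow_natCast]
      rw [hmse hn, he]
      field_simp
    refine ⟨fun m => isAsymptoticallyOptimal_iff hd hA hB hvar hbias hR m, fun m hm => ?_⟩
    rw [isEquivalent_optBandwidth_iff hd hA hB] at hm
    have hlim := tendsto_risk hd hA hB hvar hbias hR (tendsto_atTop_of_ratio hd hA hB hm) hm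
    rw [← optMseConst_eq hd hA hB] at hlim
    have hpos : ∀ᶠ n : ℕ in atTop, (0 : ℝ) < (n : ℝ) ^ (-4 / ((d : ℝ) + 4)) := by
      filter_upwards [eventually_gt_atTop 0] with n hn
      have : (0 : ℝ) < n := by exact_mod_cast hn
      positivity
    rw [isLittleO_iff_tendsto' (hpos.mono fun n hn h => absurd h hn.ne')]
    have h := hlim.sub_const (optMseConst d A B)
    rw [sub_self] at h
    refine h.congr' (hpos.mono fun n hn => ?_)
    beta_reduce
    rw [sub_div, mul_div_cancel_left₀ _ hn.ne']
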